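/- Let $H$ be an infinite-dimensional separable real Hilbert space with orthonormal basis $(v_j)$, and let $C_\mu, C$ be covariance operators with $C_\mu v_j=\mu_j v_j$, $C v_j=\lambda_j v_j$, $\mu_j,\lambda_j>0$, $\sum_j\mu_j<\infty$, $\sum_j\lambda_j<\infty$. Let $X$ solve $dX_t=-\tfrac12X_t\,dt+\sqrt C\,dW_t$ with $X_0\sim\mathcal N(0,C_\mu)$, where $W$ is a cylindrical Wiener process, and let $Y_k=\langle v_{\eta(k)},X_0\rangle+B_k$, $k=1,\dots,n$, with $\eta$ injective and $B\sim\mathcal N(0,\sigma_B^2I_n)$, $\sigma_B\ge0$; $X_0,W,B$ are independent. Put $\mathcal I=\{\eta(1),\dots,\eta(n)\}$. For $y\in\mathbb R^n$ put $y^{(\eta(k))}=y_k$ and $y^{(j)}=0$ for $j\notin\mathcal I$; put $p^{(j)}=\lambda_j/\mu_j$, $q^{(j)}=\mu_j/\sigma_B^2$ for $j\in\mathcal I$ (if $\sigma_B>0$), $q^{(j)}=0$ for $j\notin\mathcal I$, and $D_j(T)=1+(e^T-1)p^{(j)}(1+q^{(j)})$. For $t>0$ let $$S(t,x,y)=-(1-e^{-t})^{-1}\big(x-e^{-t/2}\,\mathbb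 E[X_0\mid Y=y,X_t=x]\big)$$ be the conditional score, in its version continuous in $(x,y)$. For $T>0$ and $y\in\mathbb R^n$ let $Z$ be any $H$-valued solution on $[0,T)$ of $$dZ_t=\tfrac12Z_t\,dt+S(T-t,Z_t,y)\,dt+\sqrt C\,dW_t,$$ with $Z_0$ independent of the driving Wiener process, and write $Z^{(j)}_t=\langle v_j,Z_t\rangle$ and $Z^{(j)}_T=\lim_{t\uparrow T}Z^{(j)}_t$. Then the law of $X_t$ given $Y=y$ has, for every $t\ge0$, a version defined for every $y$ and weakly continuous in $y$, and with this version the following hold. 1. (Explicit law.) Suppose $\sigma_B>0$ or $j\notin\mathcal I$. If $Z_0^{(j)}\sim\mathcal N(\bar z_0,\Sigma_0)$, then $Z_T^{(j)}$ exists almost surely and $Z^{(j)}_T\sim\mathcal N(\bar z_T,\Sigma_T)$ with $$\bar z_T=\frac{\bar z_0e^{T/2}}{D_j(T)}+\frac{y^{(j)}q^{(j)}}{1+q^{(j)}}\Big(1-\frac1{D_j(T)}\Big),\qquad \Sigma_T=\Sigma_0\frac{e^T}{D_j(T)^2}+\frac{\mu_j}{1+q^{(j)}}\Big(1-\frac1{D_j(T)}\Big).$$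 2. (Convergence.) Suppose $\sigma_B>0$ or $j\notin\mathcal I$. For fixed $\bar z_0,\Sigma_0,y,j$ there is a constant $K$ such that for all $T>0$ $$\Big|\bar z_T-\frac{y^{(j)}q^{(j)}}{1+q^{(j)}}\Big|\le Ke^{-T/2},\qquad\Big|\Sigma_T-\frac{\mu_j}{1+q^{(j)}}\Big|\le Ke^{-T},$$ and $\mathcal N(\bar z_T,\Sigma_T)$ converges weakly, as $T\to\infty$, to $\mathcal N\big(\tfrac{y^{(j)}q^{(j)}}{1+q^{(j)}},\tfrac{\mu_j}{1+q^{(j)}}\big)$. 3. (Conditional mode laws.) Suppose $\sigma_B>0$ or $j\notin\mathcal I$. For every $t\ge0$, the law of $\langle X_t,v_j\rangle$ given $Y=y$ is $$\mathcal N\Big(\frac{e^{-t/2}y^{(j)}q^{(j)}}{1+q^{(j)}},\ \frac{\mu_je^{-t}}{1+q^{(j)}}+\lambda_j(1-e^{-t})\Big);$$ in particular the limit law in 2 is the posterior law of $\langle X_0,v_j\rangle$ given $Y=y$. If $\sigma_B=0$ and $j\in\mathcal I$, the law is $\mathcal N(e^{-t/2}y^{(j)},\lambda_j(1-e^{-t}))$.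 4. (Exactness, for all $\sigma_B\ge0$.) If, for some $j$, $Z_0^{(j)}$ has the law of $\langle X_T,v_j\rangle$ given $Y=y$, then for every $t\in(0,T]$ the variable $Z_{T-t}^{(j)}$ has the law of $\langle X_t,v_j\rangle$ given $Y=y$, and $Z_T^{(j)}$ exists almost surely and has exactly the law of $\langle X_0,v_j\rangle$ given $Y=y$. If $Z_0$ has the law of $X_T$ given $Y=y$ on $H$, then $Z_{T-t}$ has the law of $X_t$ given $Y=y$ on $H$ for every $t\in(0,T]$, and there is an $H$-valued random variable $Z_T$ with $\langle v_j,Z_t\rangle\to\langle v_j,Z_T\rangle$ as $t\uparrow T$ for all $j$ almost surely, which has the law of $X_0$ given $Y=y$. 5. (Noiseless observations.) If $\sigma_B=0$ and $j\in\mathcal I$, then $\lim_{t\uparrow T}Z^{(j)}_t=y^{(j)}$ almost surely, whatever the law of $Z_0$. -/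

import Mathlib

open MeasureTheory ProbabilityTheory Filter Topology Set
open scoped NNReal BoundedContinuousFunction

noncomputable section

/-- `U` has the centred Gaussian law `N(0, Q)` on `H`: every continuous linear functional of `U`
is a centred real Gaussian variable whose variance is given by the covariance operator `Q`. -/
def HasCenteredGaussianLaw {Ω H : Type*} [MeasurableSpace Ω] [NormedAddCommGroup H]
    [InnerProductSpace ℝ H] (U : Ω → H) (Q : H →L[ℝ] H) (P : Measure Ω) : Prop :=
  ∀ h : H, HasLaw (fun ω => inner ℝ h (U ω)) (gaussianReal 0 (inner ℝ h (Q h)).toNNReal) P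

/-- `N` is a Wiener process on `H` with covariance operator `C`, that is, the process `√C W` for a
cylindrical Wiener process `W`: it starts at `0`, has continuous paths and independent increments,
and `N t - N s` has law `N(0, (t - s) C)`. -/
structure IsWienerProcess {Ω H : Type*} [MeasurableSpace Ω] [NormedAddCommGroup H]
    [InnerProductSpace ℝ H] [MeasurableSpace H]
    (C : H →L[ℝ] H) (N : ℝ≥0 → Ω → H) (P : Measure Ω) : Prop where
  measurable : ∀ t, Measurable (N t)
  zero : ∀ᵐ ω ∂P, N 0 ω = 0
  continuous : ∀ᵐ ω ∂P, Continuous fun t => N t ω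
  indep_increments : HasIndepIncrements N P
  increments : ∀ s t : ℝ≥0, s ≤ t →
    HasCenteredGaussianLaw (fun ω => N t ω - N s ω) (((t : ℝ) - (s : ℝ)) • C) P

/-- The observation `Y = A X₀ + B`, where `(A f)_k = ⟨v_{η k}, f⟩`. -/
def observation {Ω H : Type*} [NormedAddCommGroup H] [InnerProductSpace ℝ H] {n : ℕ}
    (v : HilbertBasis ℕ ℝ H) (η : Fin n → ℕ) (X : ℝ → Ω → H) (B : Ω → Fin n → ℝ) (ω : Ω) :
    Fin n → ℝ :=
  fun k => inner ℝ (v (η k)) (X 0 ω) + B ω k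

/-- The forward model: `X` solves `dX = -X/2 dt + √C dW` on `[0, ∞)` with `X 0 ∼ N(0, Cμ)`, and
`B ∼ N(0, σB² Iₙ)` is the observation noise; `X 0`, `W` and `B` are independent.
`N` is the process `√C W`. -/
structure IsForwardModel {Ω H : Type*} [MeasurableSpace Ω] [NormedAddCommGroup H]
    [InnerProductSpace ℝ H] [MeasurableSpace H] {n : ℕ}
    (Cμ C : H →L[ℝ] H) (σB : ℝ) (X : ℝ → Ω → H) (N : ℝ≥0 → Ω → H) (B : Ω → Fin n → ℝ)
    (P : Measure Ω) : Prop where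
  wiener : IsWienerProcess C N P
  measurable_state : ∀ t, 0 ≤ t → Measurable (X t)
  measurable_noise : Measurable B
  prior : HasCenteredGaussianLaw (X 0) Cμ P
  noise : HasLaw B (Measure.pi fun _ : Fin n => gaussianReal 0 (σB ^ 2).toNNReal) P
  indep_wiener : IndepFun (X 0) (fun ω t => N t ω) P
  indep_noise : IndepFun B (fun ω => (X 0 ω, fun t => N t ω)) P
  continuous : ∀ᵐ ω ∂P, ContinuousOn (fun t => X t ω) (Ici 0)
  equation : ∀ᵐ ω ∂P, ∀ t : ℝ, 0 ≤ t →
    X t ω = X 0 ω + (∫ s in (0 : ℝ)..t, -((1 / 2 : ℝ) • X s ω)) + N t.toNNReal ω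

/-- `S` is the conditional score
`S(t, x, y) = -(1 - e^{-t})⁻¹ (x - e^{-t/2} E[X₀ | Y = y, X_t = x])`, `t > 0`,
where the conditional expectation is taken in its version that is continuous in `(x, y)`. -/
def IsConditionalScore {Ω H : Type*} [mΩ : MeasurableSpace Ω] [NormedAddCommGroup H]
    [InnerProductSpace ℝ H] [CompleteSpace H] [MeasurableSpace H] {n : ℕ}
    (X : ℝ → Ω → H) (Y : Ω → Fin n → ℝ) (P : Measure Ω) (S : ℝ → H → (Fin n → ℝ) → H) : Prop :=
  ∀ t : ℝ, 0 < t →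
    (Continuous fun z : H × (Fin n → ℝ) => S t z.1 z.2) ∧
    ∀ᵐ ω ∂P, S t (X t ω) (Y ω) =
      -((1 - Real.exp (-t))⁻¹ • (X t ω - Real.exp (-t / 2) •
        condExp (MeasurableSpace.comap (fun ω' => (X t ω', Y ω')) inferInstance) P (X 0) ω))

/-- `κ y` is the conditional law of `U` given `Y = y`, in its version that is weakly continuous
in `y`. -/
structure IsConditionalLaw {Ω H : Type*} [MeasurableSpace Ω] [TopologicalSpace H]
    [MeasurableSpace H] {n : ℕ} (U : Ω → H) (Y : Ω → Fin n → ℝ) (P : Measure Ω)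
    (κ : Kernel (Fin n → ℝ) H) : Prop where
  markov : IsMarkovKernel κ
  condDistrib : HasCondDistrib U Y κ P
  continuous : ∀ f : H →ᵇ ℝ, Continuous fun y => ∫ x, f x ∂(κ y)

/-- `Z` solves the reverse-time equation `dZ = Z/2 dt + S(T - t, Z, y) dt + √C dW` on `[0, T)`,
with `Z 0` independent of `W`. `N` is the process `√C W`. -/
structure IsReverseSolution {Ω H : Type*} [MeasurableSpace Ω] [NormedAddCommGroup H]
    [InnerProductSpace ℝ H] [MeasurableSpace H] {n : ℕ}
    (C : H →L[ℝ] H) (S : ℝ → H → (Fin n → ℝ) → H) (y : Fin n → ℝ) (T : ℝ)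
    (Z : ℝ → Ω → H) (N : ℝ≥0 → Ω → H) (P : Measure Ω) : Prop where
  wiener : IsWienerProcess C N P
  measurable : ∀ t ∈ Ico 0 T, Measurable (Z t)
  indep : IndepFun (Z 0) (fun ω t => N t ω) P
  continuous : ∀ᵐ ω ∂P, ContinuousOn (fun t => Z t ω) (Ico 0 T)
  equation : ∀ᵐ ω ∂P, ∀ t ∈ Ico 0 T,
    Z t ω = Z 0 ω + (∫ s in (0 : ℝ)..t, ((1 / 2 : ℝ) • Z s ω + S (T - s) (Z s ω) y))
      + N t.toNNReal ω

/-- The real process `z` on `[0, T)` has almost surely a limit `z_T` as `t ↑ T`, and this terminal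
value has law `ν`. -/
def HasTerminalLaw {Ω : Type*} [MeasurableSpace Ω] (z : ℝ → Ω → ℝ) (T : ℝ) (ν : Measure ℝ)
    (P : Measure Ω) : Prop :=
  ∃ zT : Ω → ℝ, (∀ᵐ ω ∂P, Tendsto (fun t => z t ω) (𝓝[<] T) (𝓝 (zT ω))) ∧ HasLaw zT ν P

/-- `y^{(j)}`: the observed value of mode `j`, and `0` for an unobserved mode. -/
def modeObs {n : ℕ} (η : Fin n → ℕ) (y : Fin n → ℝ) (j : ℕ) : ℝ :=
  Function.extend η y 0 j

open Classical in
/-- `q^{(j)}`: `μ_j / σB²` for an observed mode, and `0` for an unobserved one. (For observed modes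
this is used only if `σB > 0`.) -/
def modeQ {n : ℕ} (μ : ℕ → ℝ) (σB : ℝ) (η : Fin n → ℕ) (j : ℕ) : ℝ :=
  if j ∈ range η then μ j / σB ^ 2 else 0

/-- `1 + (e^T - 1) p (1 + q)`. -/
def modeDenom (p q T : ℝ) : ℝ := 1 + (Real.exp T - 1) * p * (1 + q)

/-- The mean at time `T` of the mode started from mean `z₀`. -/
def terminalMean (p q y z₀ T : ℝ) : ℝ :=
  z₀ * Real.exp (T / 2) / modeDenom p q T + y * q / (1 + q) * (1 - 1 / modeDenom p q T)

/-- The variance at time `T` of the mode with prior variance `m`, started from variance `V₀`. -/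
def terminalVar (m p q V₀ T : ℝ) : ℝ :=
  V₀ * (Real.exp T / modeDenom p q T ^ 2) + m / (1 + q) * (1 - 1 / modeDenom p q T)

/-- The real Gaussian law as an element of the space of probability measures on `ℝ`. -/
def gaussianPM (a : ℝ) (V : ℝ≥0) : ProbabilityMeasure ℝ := ⟨gaussianReal a V, inferInstance⟩

end

/-! All operators are diagonal in the basis `v`, so the problem splits into scalar linear Gaussian
ones. The forward equation gives `X_t = e^{-t/2} X₀ + G_t` with `G_t ∼ N(0, (1 - e^{-t}) C)`, and
`X₀`, `G_t`, `B` are independent (`IsForwardModel.integral_expI_tripleForm`). Given `Y = y`, mode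
`j` of `X₀` has mean `w_j y^{(j)}` and variance `m_j = μ_j (1 - w_j)`, where `w_j = μ_j / (μ_j +
σB²)` on observed modes and `0` elsewhere. Unlike `q`, this weight makes sense at `σB = 0`, so the
noisy and noiseless cases run together. Mode `j` of `X_t` then has conditional variance `V_j(t) =
m_j e^{-t} + λ_j (1 - e^{-t})`. The residual `X_t - E[X_t | Y]` is independent of `Y`, so its
translates are the conditional laws and depend continuously on `y`.

Regressing `X₀` on `(X_t, Y)` gives mode `j` of the score as `-(λ_j / V_j(t)) (x_j - e^{-t/2} w_j
y^{(j)})` along the forward process. The formula holds at every `(x, y)`, because `(X_t, Y)` charges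
every open set for `t > 0`, even without noise (`IsForwardModel.eq_of_ae_eq`,
`IsForwardModel.inner_score`).

Centred at the conditional mean, a reverse mode therefore solves `dw = (1/2 - λ / V(T - t)) w dt +
dN_j`. Since `V' = λ - V`, the integrating factor is explicit, and `w_t` is `Φ(t) w₀` plus an
independent centred Gaussian of variance `V(T - t) - Φ(t)² V(T)`. A start with variance `V(T)` thus
yields exactly `V(T - t)`, which is exactness; any Gaussian start yields the explicit law at `t =
T`. If `m_j = 0`, then `Φ(T) = 0` and the stochastic term is `N_j` minus a weighted average of its
past that concentrates at `T`, so `w` tends to `0`.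

No stochastic calculus is used: the noise is additive, so Wiener integrals of smooth functions are
defined pathwise by integration by parts, and laws are identified by characteristic functions
(`integral_mul_expI_wienerIntegral`, `integral_expI_revMode`). -/

set_option linter.unusedSectionVars false

/-! ### Scalar characteristic functions and Gaussian exponentials. -/

/-- The unit complex number `e^{ix}`. -/
noncomputable def expI (x : ℝ) : ℂ := Complex.exp (x * Complex.I)

lemma norm_expI (x : ℝ) : ‖expI x‖ = 1 := Complex.norm_exp_ofReal_mul_I x

@[fun_prop]
lemma continuous_expI : Continuous expI := by unfold expI; fun_prop

@[fun_prop]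
lemma measurable_expI : Measurable expI := continuous_expI.measurable

lemma expI_add (x y : ℝ) : expI (x + y) = expI x * expI y := by
  simp [expI, add_mul, Complex.exp_add]

@[simp]
lemma expI_zero : expI 0 = 1 := by simp [expI]

lemma expI_finset_sum {ι : Type*} (s : Finset ι) (f : ι → ℝ) :
    expI (∑ i ∈ s, f i) = ∏ i ∈ s, expI (f i) := by
  simp [expI, Finset.sum_mul, Complex.exp_sum]

lemma charFun_eq_integral_expI {Ω H : Type*} [MeasurableSpace Ω] [NormedAddCommGroup H]
    [InnerProductSpace ℝ H] [MeasurableSpace H] [BorelSpace H] [SecondCountableTopology H]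
    {P : Measure Ω} {U : Ω → H} (hU : AEMeasurable U P) (h : H) :
    charFun (P.map U) h = ∫ ω, expI (inner ℝ h (U ω)) ∂P := by
  rw [charFun_apply, integral_map hU (by fun_prop)]
  simp [expI, real_inner_comm]

lemma charFun_eq_integral_expI_mul {Ω : Type*} [MeasurableSpace Ω]
    {P : Measure Ω} {U : Ω → ℝ} (hU : AEMeasurable U P) (c : ℝ) :
    charFun (P.map U) c = ∫ ω, expI (c * U ω) ∂P := by
  rw [charFun_eq_integral_expI hU]
  simp [mul_comm]

/-- The characteristic function of the real Gaussian law with mean `m` and variance `V`, at `1`. -/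
noncomputable def gaussExp (m V : ℝ) : ℂ := Complex.exp (m * Complex.I - V / 2)

lemma gaussExp_eq (m V : ℝ) : gaussExp m V = expI m * gaussExp 0 V := by
  simp [gaussExp, expI, sub_eq_add_neg, Complex.exp_add]

lemma gaussExp_add (m m' V V' : ℝ) :
    gaussExp (m + m') (V + V') = gaussExp m V * gaussExp m' V' := by
  rw [gaussExp, gaussExp, gaussExp, ← Complex.exp_add]
  push_cast
  ring_nf

@[simp]
lemma gaussExp_zero : gaussExp 0 0 = 1 := by simp [gaussExp]

lemma continuous_gaussExp : Continuous fun z : ℝ × ℝ => gaussExp z.1 z.2 := by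
  unfold gaussExp; fun_prop

lemma gaussExp_finset_sum {ι : Type*} (s : Finset ι) (f : ι → ℝ) :
    gaussExp 0 (∑ i ∈ s, f i) = ∏ i ∈ s, gaussExp 0 (f i) := by
  classical
  induction s using Finset.induction_on with
  | empty => simp
  | insert a s ha ih =>
    rw [Finset.sum_insert ha, Finset.prod_insert ha, ← ih, ← gaussExp_add, add_zero]

lemma integral_expI_of_hasLaw {Ω : Type*} [MeasurableSpace Ω] {P : Measure Ω} {U : Ω → ℝ} {m : ℝ}
    {V : ℝ≥0} (hU : HasLaw U (gaussianReal m V) P) (c : ℝ) :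
    ∫ ω, expI (c * U ω) ∂P = gaussExp (c * m) (c ^ 2 * V) := by
  rw [← charFun_eq_integral_expI_mul hU.aemeasurable, hU.map_eq, charFun_gaussianReal, gaussExp]
  push_cast
  ring_nf

lemma hasLaw_gaussianReal_of_expI {Ω : Type*} [MeasurableSpace Ω] {P : Measure Ω}
    [IsProbabilityMeasure P] {U : Ω → ℝ} (hU : AEMeasurable U P) {m : ℝ} {V : ℝ≥0}
    (h : ∀ c : ℝ, ∫ ω, expI (c * U ω) ∂P = gaussExp (c * m) (c ^ 2 * V)) :
    HasLaw U (gaussianReal m V) P := by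
  have := Measure.isProbabilityMeasure_map hU
  refine ⟨hU, Measure.ext_of_charFun (funext fun c => ?_)⟩
  rw [charFun_eq_integral_expI_mul hU, h, charFun_gaussianReal, gaussExp]
  push_cast
  ring_nf

/-! ### Operators diagonal in a Hilbert basis. -/

section Diagonal

variable {H : Type*} [NormedAddCommGroup H] [InnerProductSpace ℝ H] {v : HilbertBasis ℕ ℝ H}

lemma HilbertBasis.inner_eq_ite {ι : Type*} [DecidableEq ι] (v : HilbertBasis ι ℝ H) (i j : ι) :
    inner ℝ (v i) (v j) = if i = j then (1 : ℝ) else 0 :=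
  orthonormal_iff_ite.1 v.orthonormal i j

lemma HilbertBasis.hasSum_inner_smul (v : HilbertBasis ℕ ℝ H) (x : H) :
    HasSum (fun j => inner ℝ (v j) x • v j) x := by
  simpa [v.repr_apply_apply] using v.hasSum_repr x

lemma inner_diagonal {Q : H →L[ℝ] H} {q : ℕ → ℝ} (hQ : ∀ j, Q (v j) = q j • v j) (j : ℕ) (x : H) :
    inner ℝ (v j) (Q x) = q j * inner ℝ (v j) x := by
  have h1 := ((v.hasSum_inner_smul x).mapL Q).mapL (innerSL ℝ (v j))
  refine h1.unique ?_
  have h2 := hasSum_ite_eq j (q j * inner ℝ (v j) x)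
  refine h2.congr_fun ?_
  intro k
  simp only [map_smul, hQ, innerSL_apply_apply, v.inner_eq_ite, smul_eq_mul, eq_comm (a := j)]
  split_ifs with h <;> simp [h, mul_comm]

lemma hasSum_inner_diagonal {Q : H →L[ℝ] H} {q : ℕ → ℝ} (hQ : ∀ j, Q (v j) = q j • v j)
    (x y : H) :
    HasSum (fun j => q j * (inner ℝ (v j) x * inner ℝ (v j) y)) (inner ℝ x (Q y)) := by
  refine (v.hasSum_inner_mul_inner x (Q y)).congr_fun fun j => ?_
  rw [inner_diagonal hQ, real_inner_comm]
  ring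

lemma inner_diagonal_comm {Q : H →L[ℝ] H} {q : ℕ → ℝ} (hQ : ∀ j, Q (v j) = q j • v j) (x y : H) :
    inner ℝ x (Q y) = inner ℝ y (Q x) :=
  (hasSum_inner_diagonal hQ x y).unique
    ((hasSum_inner_diagonal hQ y x).congr_fun fun j => by ring)

lemma inner_diagonal_nonneg {Q : H →L[ℝ] H} {q : ℕ → ℝ} (hQ : ∀ j, Q (v j) = q j • v j)
    (hq : ∀ j, 0 < q j) (x : H) : 0 ≤ inner ℝ x (Q x) :=
  (hasSum_inner_diagonal hQ x x).nonneg fun j => mul_nonneg (hq j).le (mul_self_nonneg _)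

/-- Parseval. This turns a bound on the score that is uniform over modes into a bound in norm. -/
lemma norm_le_of_inner_basis_le (v : HilbertBasis ℕ ℝ H) {x y : H} {K : ℝ} (hK : 0 ≤ K)
    (h : ∀ j, |inner ℝ (v j) x| ≤ K * |inner ℝ (v j) y|) : ‖x‖ ≤ K * ‖y‖ := by
  have hx := v.hasSum_inner_mul_inner x x
  have hy := (v.hasSum_inner_mul_inner y y).mul_left (K ^ 2)
  rw [real_inner_self_eq_norm_sq] at hx hy
  have := hasSum_le (fun j => ?_) hx hy
  · rw [← mul_pow] at this
    exact le_of_sq_le_sq this (by positivity)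
  · rw [real_inner_comm, real_inner_comm (v j) y, ← sq, ← sq, ← mul_pow, ← sq_abs,
      ← sq_abs (K * _), abs_mul, abs_of_nonneg hK]
    gcongr
    exact h j

/-- Characteristic functions are continuous and finite combinations of basis vectors are dense, so
joint laws of finitely many modes determine a law on `H`. -/
lemma measure_ext_of_charFun_basis [CompleteSpace H] [SecondCountableTopology H]
    [MeasurableSpace H] [BorelSpace H] (v : HilbertBasis ℕ ℝ H) {ν₁ ν₂ : Measure H}
    [IsFiniteMeasure ν₁] [IsFiniteMeasure ν₂]
    (h : ∀ (F : Finset ℕ) (c : ℕ → ℝ),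
      charFun ν₁ (∑ j ∈ F, c j • v j) = charFun ν₂ (∑ j ∈ F, c j • v j)) : ν₁ = ν₂ := by
  have hcont : ∀ ν : Measure H, IsFiniteMeasure ν → Continuous (charFun ν) := fun ν _ =>
    continuous_charFun
  refine Measure.ext_of_charFun (funext fun x => ?_)
  have h1 := ((hcont ν₁ inferInstance).tendsto x).comp (v.hasSum_inner_smul x)
  have h2 := ((hcont ν₂ inferInstance).tendsto x).comp (v.hasSum_inner_smul x)
  refine tendsto_nhds_unique h1 (h2.congr fun F => ?_)
  exact (h F _).symm

end Diagonal

/-! ### Riemann and Riemann–Stieltjes sums. -/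

section RiemannSum

/-- The increments of `J` telescope, so local errors `o(b - a)`, uniform in position, add up to
`o(1)`. Using `n + 1` cells avoids an empty partition. -/
lemma tendsto_sum_increments {R : ℝ → ℝ → ℝ} {J : ℝ → ℝ} {t : ℝ} (ht : 0 ≤ t)
    (h : ∀ ε > 0, ∃ δ > 0, ∀ a b, 0 ≤ a → a ≤ b → b ≤ t → b - a < δ →
      |J b - J a - R a b| ≤ ε * (b - a)) :
    Tendsto (fun n : ℕ => ∑ i ∈ Finset.range (n + 1),
      R (t * (i / (n + 1))) (t * ((i + 1) / (n + 1)))) atTop (𝓝 (J t - J 0)) := by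
  rw [Metric.tendsto_atTop]
  intro ε hε
  -- The total error is `t` times this constant; `t + 1` keeps the division valid at `t = 0` and the
  -- final inequality strict.
  obtain ⟨δ, hδ, hJ⟩ := h (ε / (t + 1)) (by positivity)
  obtain ⟨n₀, hn₀⟩ := exists_nat_gt (t / δ)
  refine ⟨n₀, fun n hn => ?_⟩
  have hn1 : (0 : ℝ) < n + 1 := by positivity
  have hmesh : ∀ i : ℕ, t * (((i : ℝ) + 1) / (n + 1)) - t * (i / (n + 1)) = t / (n + 1) := by
    intro i; field_simp; ring
  have hsmall : t / (n + 1) < δ := by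
    rw [div_lt_iff₀ hn1]
    rw [div_lt_iff₀ hδ] at hn₀
    have : (n₀ : ℝ) ≤ n := by exact_mod_cast hn
    nlinarith
  have htel : ∑ i ∈ Finset.range (n + 1), (J (t * (((i : ℝ) + 1) / (n + 1))) - J (t * (i / (n + 1))))
      = J t - J 0 := by
    have := Finset.sum_range_sub (fun i : ℕ => J (t * ((i : ℝ) / (n + 1)))) (n + 1)
    push_cast at this
    rw [this, div_self hn1.ne']
    simp
  rw [Real.dist_eq, ← htel, abs_sub_comm, ← Finset.sum_sub_distrib]
  have hb : ∑ i ∈ Finset.range (n + 1), ε / (t + 1) * (t / (n + 1)) = ε / (t + 1) * t := by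
    rw [Finset.sum_const, Finset.card_range, nsmul_eq_mul]
    push_cast
    field_simp
  calc _ ≤ ∑ i ∈ Finset.range (n + 1), ε / (t + 1) * (t / (n + 1)) := by
        refine (Finset.abs_sum_le_sum_abs _ _).trans (Finset.sum_le_sum fun i hi => ?_)
        rw [← hmesh i]
        have hi' : (i : ℝ) + 1 ≤ n + 1 := by
          exact_mod_cast Finset.mem_range.1 hi
        refine hJ _ _ (by positivity) ?_ ?_ ((hmesh i).trans_lt hsmall)
        · gcongr; linarith
        · exact mul_le_of_le_one_right ht ((div_le_one hn1).2 hi')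
    _ = ε / (t + 1) * t := hb
    _ < ε := by
        rw [div_mul_eq_mul_div, div_lt_iff₀ (by positivity)]
        nlinarith

lemma tendsto_riemannSum {f : ℝ → ℝ} {t : ℝ} (ht : 0 ≤ t) (hf : ContinuousOn f (Icc 0 t)) :
    Tendsto (fun n : ℕ => ∑ i ∈ Finset.range (n + 1),
      (t * ((i + 1) / (n + 1)) - t * (i / (n + 1))) * f (t * (i / (n + 1)))) atTop
      (𝓝 (∫ s in (0 : ℝ)..t, f s)) := by
  have key := tendsto_sum_increments (R := fun a b => (b - a) * f a)
    (J := fun u => ∫ s in (0 : ℝ)..u, f s) ht ?_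
  · simpa using key
  intro ε hε
  obtain ⟨δ, hδ, hu⟩ := Metric.uniformContinuousOn_iff.1
    (isCompact_Icc.uniformContinuousOn_of_continuous hf) ε hε
  refine ⟨δ, hδ, fun a b ha hab hb hba => ?_⟩
  have hint : ∀ c d, 0 ≤ c → c ≤ d → d ≤ t → IntervalIntegrable f volume c d := fun c d hc hcd hd =>
    (hf.mono (by rw [uIcc_of_le hcd]; exact Icc_subset_Icc hc hd)).intervalIntegrable
  have : (∫ s in (0 : ℝ)..b, f s) - (∫ s in (0 : ℝ)..a, f s) - (b - a) * f a
      = ∫ s in a..b, (f s - f a) := by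
    rw [intervalIntegral.integral_interval_sub_left (hint 0 b le_rfl (ha.trans hab) hb)
      (hint 0 a le_rfl ha (hab.trans hb)), intervalIntegral.integral_sub (hint a b ha hab hb)
      intervalIntegrable_const, intervalIntegral.integral_const, smul_eq_mul]
  rw [this, ← Real.norm_eq_abs, ← abs_of_nonneg (sub_nonneg.2 hab)]
  refine intervalIntegral.norm_integral_le_of_norm_le_const fun s hs => ?_
  rw [uIoc_of_le hab] at hs
  rw [← dist_eq_norm]
  refine (hu s ⟨by linarith [hs.1], hs.2.trans hb⟩ a ⟨ha, hab.trans hb⟩ ?_).le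
  rw [Real.dist_eq, abs_of_nonneg (by linarith [hs.1])]
  linarith [hs.2]

variable {H : Type*} [NormedAddCommGroup H] [InnerProductSpace ℝ H]

/-- Riemann–Stieltjes sums of `g` against a continuous path `x` converge to the integral defined by
integration by parts. -/
lemma tendsto_stieltjesSum [CompleteSpace H] {g g' x : ℝ → H} {t : ℝ} (ht : 0 ≤ t)
    (hg : ∀ s ∈ Icc 0 t, HasDerivAt g (g' s) s) (hg' : ContinuousOn g' (Icc 0 t))
    (hx : Continuous x) (hx0 : x 0 = 0) :
    Tendsto (fun n : ℕ => ∑ i ∈ Finset.range (n + 1),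
      inner ℝ (g (t * (i / (n + 1)))) (x (t * ((i + 1) / (n + 1))) - x (t * (i / (n + 1))))) atTop
      (𝓝 (inner ℝ (g t) (x t) - ∫ s in (0 : ℝ)..t, inner ℝ (g' s) (x s))) := by
  have key := tendsto_sum_increments (R := fun a b => inner ℝ (g a) (x b - x a))
    (J := fun u => inner ℝ (g u) (x u) - ∫ s in (0 : ℝ)..u, inner ℝ (g' s) (x s)) ht ?_
  · simpa [hx0] using key
  intro ε hε
  obtain ⟨K, hK⟩ := isCompact_Icc.exists_bound_of_continuousOn hg'
  have hK0 : 0 ≤ K := (norm_nonneg _).trans (hK 0 ⟨le_rfl, ht⟩)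
  obtain ⟨δ, hδ, hu⟩ := Metric.uniformContinuousOn_iff.1
    (isCompact_Icc.uniformContinuousOn_of_continuous (hx.continuousOn (s := Icc 0 t)))
    (ε / (K + 1)) (by positivity)
  refine ⟨δ, hδ, fun a b ha hab hb hba => ?_⟩
  have hsub : ∀ c d, 0 ≤ c → c ≤ d → d ≤ t → uIcc c d ⊆ Icc 0 t := fun c d hc hcd hd => by
    rw [uIcc_of_le hcd]; exact Icc_subset_Icc hc hd
  have hint : ∀ c d, 0 ≤ c → c ≤ d → d ≤ t →
      IntervalIntegrable (fun s => inner ℝ (g' s) (x s)) volume c d := fun c d hc hcd hd =>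
    ((hg'.inner (𝕜 := ℝ) hx.continuousOn).mono (hsub c d hc hcd hd)).intervalIntegrable
  have hgint : IntervalIntegrable g' volume a b :=
    (hg'.mono (hsub a b ha hab hb)).intervalIntegrable
  have hconst : ∫ s in a..b, inner ℝ (g' s) (x b) = inner ℝ (g b - g a) (x b) := by
    rw [← intervalIntegral.integral_eq_sub_of_hasDerivAt
      (fun s hs => hg s (hsub a b ha hab hb hs)) hgint]
    have := ((innerSL ℝ (x b))).intervalIntegral_comp_comm hgint
    simpa [real_inner_comm] using this
  have hcint : IntervalIntegrable (fun s => inner ℝ (g' s) (x b)) volume a b :=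
    ((hg'.mono (hsub a b ha hab hb)).inner (𝕜 := ℝ) continuousOn_const).intervalIntegrable
  -- Integration by parts on one cell leaves only the oscillation of `x` integrated against `g'`, so
  -- continuity of `x` is enough; bounded variation is not needed.
  have heq : inner ℝ (g b) (x b) - (∫ s in (0 : ℝ)..b, inner ℝ (g' s) (x s)) -
      (inner ℝ (g a) (x a) - ∫ s in (0 : ℝ)..a, inner ℝ (g' s) (x s)) -
      inner ℝ (g a) (x b - x a) = ∫ s in a..b, inner ℝ (g' s) (x b - x s) := by
    have h1 := intervalIntegral.integral_interval_sub_left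
      (hint 0 b le_rfl (ha.trans hab) hb) (hint 0 a le_rfl ha (hab.trans hb))
    simp only [inner_sub_right]
    rw [intervalIntegral.integral_sub hcint (hint a b ha hab hb), hconst, ← h1, inner_sub_left]
    ring
  rw [heq, ← Real.norm_eq_abs, ← abs_of_nonneg (sub_nonneg.2 hab)]
  refine intervalIntegral.norm_integral_le_of_norm_le_const fun s hs => ?_
  rw [uIoc_of_le hab] at hs
  have h2 : ‖x b - x s‖ ≤ ε / (K + 1) := by
    rw [← dist_eq_norm]
    refine (hu b ⟨ha.trans hab, hb⟩ s ⟨by linarith [hs.1], hs.2.trans hb⟩ ?_).le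
    rw [Real.dist_eq, abs_of_nonneg (by linarith [hs.2])]
    linarith [hs.1]
  calc ‖inner ℝ (g' s) (x b - x s)‖ ≤ ‖g' s‖ * ‖x b - x s‖ := norm_inner_le_norm _ _
    _ ≤ K * (ε / (K + 1)) := by
        gcongr
        exact hK s ⟨by linarith [hs.1], hs.2.trans hb⟩
    _ ≤ ε := by
        rw [mul_div_assoc', div_le_iff₀ (by positivity)]
        nlinarith

end RiemannSum

/-! ### Pathwise Wiener integrals and their characteristic functions. -/

section Wiener

variable {Ω H : Type*} [MeasurableSpace Ω] [NormedAddCommGroup H] [InnerProductSpace ℝ H]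
  [MeasurableSpace H] [BorelSpace H] [SecondCountableTopology H] {C : H →L[ℝ] H}
  {N : ℝ≥0 → Ω → H} {P : Measure Ω}

lemma integral_expI_of_hasCenteredGaussianLaw {U : Ω → H} {Q : H →L[ℝ] H}
    (hQ : ∀ h, 0 ≤ inner ℝ h (Q h)) (hU : HasCenteredGaussianLaw U Q P) (h : H) :
    ∫ ω, expI (inner ℝ h (U ω)) ∂P = gaussExp 0 (inner ℝ h (Q h)) := by
  have := integral_expI_of_hasLaw (hU h) 1
  simpa [Real.coe_toNNReal _ (hQ h)] using this

/-- Riemann–Stieltjes sum of `g` against the path `p`, on the regular partition of `[0, t]`. -/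
noncomputable def pathSum (g : ℝ → H) (t : ℝ) (n : ℕ) (p : ℝ≥0 → H) : ℝ :=
  ∑ i ∈ Finset.range (n + 1), inner ℝ (g (t * (i / (n + 1))))
    (p (t * ((i + 1) / (n + 1))).toNNReal - p (t * (i / (n + 1))).toNNReal)

lemma measurable_pathSum (g : ℝ → H) (t : ℝ) (n : ℕ) :
    Measurable (pathSum g t n : (ℝ≥0 → H) → ℝ) := by
  unfold pathSum
  fun_prop

/-- Independent increments make the expectation a product, and the variances of the factors add up
to a Riemann sum of `⟨g, C g⟩`. -/
lemma integral_expI_pathSum (hN : IsWienerProcess C N P) (hC : ∀ h, 0 ≤ inner ℝ h (C h))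
    (g : ℝ → H) {t : ℝ} (ht : 0 ≤ t) (n : ℕ) :
    ∫ ω, expI (pathSum g t n fun s => N s ω) ∂P =
      gaussExp 0 (∑ i ∈ Finset.range (n + 1),
        (t * ((i + 1) / (n + 1)) - t * (i / (n + 1))) *
          inner ℝ (g (t * (i / (n + 1)))) (C (g (t * (i / (n + 1)))))) := by
  have hle : ∀ i : ℕ, t * ((i : ℝ) / (n + 1)) ≤ t * (((i : ℝ) + 1) / (n + 1)) := fun i => by
    gcongr; linarith
  have hind := hN.indep_increments (n + 1) (fun i => (t * ((i : ℕ) / ((n : ℝ) + 1))).toNNReal)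
    (fun i j hij => Real.toNNReal_le_toNNReal (by
      have : ((i : ℕ) : ℝ) ≤ ((j : ℕ) : ℝ) := by exact_mod_cast hij
      gcongr))
  have hN' := hN.measurable
  have h1 := hind.integral_fun_prod_comp
    (f := fun (i : Fin (n + 1)) x => expI (inner ℝ (g (t * ((i : ℕ) / ((n : ℝ) + 1)))) x))
    (fun i => ((hN' _).sub (hN' _)).aemeasurable) (fun i => by fun_prop)
  simp only [Fin.val_succ, Fin.val_castSucc, Nat.cast_add, Nat.cast_one] at h1
  simp only [pathSum, expI_finset_sum, gaussExp_finset_sum]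
  simp only [Finset.prod_range]
  rw [h1]
  refine Finset.prod_congr rfl fun i _ => ?_
  have h2 := hN.increments _ _ (Real.toNNReal_le_toNNReal (hle i))
  rw [Real.coe_toNNReal _ (by positivity), Real.coe_toNNReal _ (by positivity)] at h2
  rw [integral_expI_of_hasCenteredGaussianLaw (fun h => ?_) h2]
  · simp [inner_smul_right]
  · simpa [inner_smul_right] using mul_nonneg (sub_nonneg.2 (hle i)) (hC h)

/-- The Wiener integral `∫₀ᵗ ⟨g, dN⟩` of a continuously differentiable function `g`, defined by
integration by parts. -/
noncomputable def wienerIntegral (g g' : ℝ → H) (t : ℝ) (p : ℝ≥0 → H) : ℝ :=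
  inner ℝ (g t) (p t.toNNReal) - ∫ s in (0 : ℝ)..t, inner ℝ (g' s) (p s.toNNReal)

lemma tendsto_pathSum [CompleteSpace H] {g g' : ℝ → H} {t : ℝ} (ht : 0 ≤ t)
    (hg : ∀ s ∈ Icc 0 t, HasDerivAt g (g' s) s) (hg' : ContinuousOn g' (Icc 0 t))
    {p : ℝ≥0 → H} (hp : Continuous p) (hp0 : p 0 = 0) :
    Tendsto (fun n => pathSum g t n p) atTop (𝓝 (wienerIntegral g g' t p)) :=
  tendsto_stieltjesSum (x := fun s => p s.toNNReal) ht hg hg'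
    (hp.comp continuous_real_toNNReal) (by simpa using hp0)

/-- The random variable `F` is uncorrelated with every bounded functional of the process `N`. -/
def UncorrelatedWithPath (F : Ω → ℂ) (N : ℝ≥0 → Ω → H) (P : Measure Ω) : Prop :=
  ∀ Ψ : (ℝ≥0 → H) → ℂ, Measurable Ψ →
    ∫ ω, F ω * Ψ (fun s => N s ω) ∂P = (∫ ω, F ω ∂P) * ∫ ω, Ψ (fun s => N s ω) ∂P

/-- The Itô isometry in characteristic-function form, with a factor `F` carrying the independent
initial data. Both sides are limits of the same identity for `pathSum`; all integrands are bounded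
by `1`, so dominated convergence applies. -/
lemma integral_mul_expI_wienerIntegral [CompleteSpace H] [IsProbabilityMeasure P]
    (hN : IsWienerProcess C N P) (hC : ∀ h, 0 ≤ inner ℝ h (C h)) {g g' : ℝ → H} {t : ℝ}
    (ht : 0 ≤ t) (hg : ∀ s ∈ Icc 0 t, HasDerivAt g (g' s) s) (hg' : ContinuousOn g' (Icc 0 t))
    {F : Ω → ℂ} (hF : AEStronglyMeasurable F P) (hF1 : ∀ ω, ‖F ω‖ ≤ 1)
    (hind : UncorrelatedWithPath F N P) :
    ∫ ω, F ω * expI (wienerIntegral g g' t fun s => N s ω) ∂P =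
      (∫ ω, F ω ∂P) * gaussExp 0 (∫ s in (0 : ℝ)..t, inner ℝ (g s) (C (g s))) := by
  have hN' := hN.measurable
  have hpath : Measurable fun ω => fun s => N s ω := measurable_pi_lambda _ hN'
  have h1 : Tendsto (fun n => ∫ ω, F ω * expI (pathSum g t n fun s => N s ω) ∂P) atTop
      (𝓝 (∫ ω, F ω * expI (wienerIntegral g g' t fun s => N s ω) ∂P)) := by
    refine tendsto_integral_of_dominated_convergence (fun _ => 1) (fun n => ?_)
      (integrable_const _) (fun n => ae_of_all _ fun ω => ?_) ?_
    · exact hF.mul (measurable_expI.comp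
        ((measurable_pathSum g t n).comp hpath)).aestronglyMeasurable
    · rw [norm_mul, norm_expI, mul_one]
      exact hF1 ω
    · filter_upwards [hN.continuous, hN.zero] with ω hω hω0
      exact ((continuous_expI.tendsto _).comp
        (tendsto_pathSum ht hg hg' hω hω0)).const_mul _
  refine tendsto_nhds_unique h1 ?_
  have hgc : ContinuousOn g (Icc 0 t) := fun s hs => (hg s hs).continuousAt.continuousWithinAt
  have h2 := tendsto_riemannSum ht
    (hgc.inner (𝕜 := ℝ) (C.continuous.comp_continuousOn hgc))
  have h3 : Tendsto (fun V => (∫ ω, F ω ∂P) * gaussExp 0 V) (𝓝 (∫ s in (0 : ℝ)..t,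
      inner ℝ (g s) (C (g s)))) (𝓝 _) :=
    ((continuous_gaussExp.comp (by fun_prop : Continuous fun V : ℝ => ((0 : ℝ), V))).tendsto
      _).const_mul _
  refine (h3.comp h2).congr fun n => ?_
  rw [hind (fun p => expI (pathSum g t n p))
    (measurable_expI.comp (measurable_pathSum g t n)), integral_expI_pathSum hN hC g ht n]
  rfl

lemma UncorrelatedWithPath.of_indepFun {E : Type*} [MeasurableSpace E] {U : Ω → E}
    (h : IndepFun U (fun ω s => N s ω) P) (hU : AEMeasurable U P) (hN : ∀ s, Measurable (N s))
    {f : E → ℂ} (hf : Measurable f) : UncorrelatedWithPath (fun ω => f (U ω)) N P :=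
  fun _ hΨ => h.integral_fun_comp_mul_comp hU (measurable_pi_lambda _ hN).aemeasurable
    hf.aestronglyMeasurable hΨ.aestronglyMeasurable

end Wiener

/-! ### Variation of constants; independence from characteristic functions. -/

/-- Variation of constants for the integral equation `w = w₀ + ∫ a w + M`. -/
lemma variation_of_constants {w M a ψ : ℝ → ℝ} {T : ℝ} (hw : ContinuousOn w (Ico 0 T))
    (hM : Continuous M) (ha : ContinuousOn a (Ico 0 T))
    (hψ : ∀ s ∈ Ico 0 T, HasDerivAt ψ (-(a s * ψ s)) s)
    (heq : ∀ t ∈ Ico 0 T, w t = w 0 + (∫ s in (0 : ℝ)..t, a s * w s) + M t)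
    {t : ℝ} (ht : t ∈ Ico 0 T) :
    ψ t * (w t - M t) = ψ 0 * w 0 + ∫ s in (0 : ℝ)..t, a s * ψ s * M s := by
  have hsub : Icc 0 t ⊆ Ico 0 T := fun s hs => ⟨hs.1, hs.2.trans_lt ht.2⟩
  have hψc : ContinuousOn ψ (Icc 0 t) := fun s hs =>
    (hψ s (hsub hs)).continuousAt.continuousWithinAt
  have haw : ContinuousOn (fun s => a s * w s) (Icc 0 t) := (ha.mul hw).mono hsub
  have hM0 : M 0 = 0 := by
    have := heq 0 ⟨le_rfl, ht.1.trans_lt ht.2⟩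
    simpa using this
  -- The path `M` need not be differentiable, but `w - M` is a primitive of `a w`, so the product
  -- rule is applied to `ψ (w - M)`.
  have hx : ∀ s ∈ Ioo 0 t, HasDerivAt (fun s => w s - M s) (a s * w s) s := by
    intro s hs
    have h1 : HasDerivAt (fun u => w 0 + ∫ r in (0 : ℝ)..u, a r * w r) (a s * w s) s := by
      have hnhds : Icc 0 t ∈ 𝓝 s := Icc_mem_nhds hs.1 hs.2
      refine (intervalIntegral.integral_hasDerivAt_right ?_ ?_ (haw.continuousAt hnhds)).const_add _
      · refine (haw.mono ?_).intervalIntegrable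
        rw [uIcc_of_le hs.1.le]
        exact Icc_subset_Icc le_rfl hs.2.le
      · exact ContinuousOn.stronglyMeasurableAtFilter isOpen_Ioo (haw.mono Ioo_subset_Icc_self) s hs
    refine h1.congr_of_eventuallyEq ?_
    filter_upwards [Icc_mem_nhds hs.1 hs.2] with u hu
    rw [heq u (hsub hu)]
    ring
  have hF := intervalIntegral.integral_eq_sub_of_hasDerivAt_of_le
    (f := fun s => ψ s * (w s - M s)) (f' := fun s => a s * ψ s * M s) ht.1
    (hψc.mul ((hw.mono hsub).sub hM.continuousOn)) (fun s hs => ?_) ?_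
  · rw [hF, hM0]
    ring
  · refine ((hψ s (hsub (Ioo_subset_Icc_self hs))).mul (hx s hs)).congr_deriv ?_
    ring
  · refine ContinuousOn.intervalIntegrable ?_
    rw [uIcc_of_le ht.1]
    exact ((ha.mono hsub).mul hψc).mul hM.continuousOn

/-- Two random variables whose linear functionals form a centred Gaussian family are independent as
soon as these functionals are orthogonal for the covariance form. -/
lemma indepFun_of_expI {Ω V E F : Type*} [MeasurableSpace Ω] [Add V] {P : Measure Ω}
    [IsProbabilityMeasure P]
    [NormedAddCommGroup E] [NormedSpace ℝ E] [CompleteSpace E] [SecondCountableTopology E]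
    [MeasurableSpace E] [BorelSpace E]
    [NormedAddCommGroup F] [NormedSpace ℝ F] [CompleteSpace F] [SecondCountableTopology F]
    [MeasurableSpace F] [BorelSpace F]
    {ℓ : V → Ω → ℝ} (hadd : ∀ p p' ω, ℓ (p + p') ω = ℓ p ω + ℓ p' ω) {q : V → ℝ}
    (hq : ∀ p, ∫ ω, expI (ℓ p ω) ∂P = gaussExp 0 (q p))
    {U : Ω → E} {W : Ω → F} (hU : AEMeasurable U P) (hW : AEMeasurable W P)
    (A : StrongDual ℝ E → V) (A' : StrongDual ℝ F → V)
    (hA : ∀ L ω, L (U ω) = ℓ (A L) ω) (hA' : ∀ L ω, L (W ω) = ℓ (A' L) ω)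
    (horth : ∀ L L', q (A L + A' L') = q (A L) + q (A' L')) : IndepFun U W P := by
  rw [indepFun_iff_charFunDual_prod hU hW]
  intro L
  have hsplit : ∀ ω, L (U ω, W ω) =
      L.comp (.inl ℝ E F) (U ω) + L.comp (.inr ℝ E F) (W ω) := fun ω => by
    simp only [ContinuousLinearMap.comp_apply, ← map_add]
    simp
  simp only [charFunDual_apply]
  rw [integral_map (hU.prodMk hW) (by fun_prop), integral_map hU (by fun_prop),
    integral_map hW (by fun_prop)]
  have h0 : ∀ x : ℝ, Complex.exp (x * Complex.I) = expI x := fun _ => rfl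
  simp only [hsplit, h0, hA, hA']
  simp only [← hadd]
  rw [hq, hq, hq, horth, ← gaussExp_add, add_zero]

/-! ### Full support of non-degenerate Gaussian laws. -/

section Support

variable {Ω H : Type*} [MeasurableSpace Ω] {P : Measure Ω} [IsProbabilityMeasure P]

/-- Conditionally on `R`, a non-degenerate Gaussian has the same null sets as Lebesgue measure,
which is translation invariant; Fubini concludes. -/
lemma measure_shift_eq_zero {E : Type*} [NormedAddCommGroup E] [NormedSpace ℝ E]
    [SecondCountableTopology E] [MeasurableSpace E] [BorelSpace E]
    {ξ : Ω → ℝ} {R : Ω → E} {d : E} {V : ℝ≥0} (hV : V ≠ 0) (hR : AEMeasurable R P)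
    (hξ : HasLaw ξ (gaussianReal 0 V) P) (hind : IndepFun R ξ P) {O : Set E}
    (hO : MeasurableSet O) (h0 : P {ω | R ω + ξ ω • d ∈ O} = 0) (s : ℝ) :
    P {ω | R ω + ξ ω • d + s • d ∈ O} = 0 := by
  have hlaw := (indepFun_iff_map_prod_eq_prod_map_map hR hξ.aemeasurable).1 hind
  rw [hξ.map_eq] at hlaw
  have hms : ∀ u : ℝ, MeasurableSet {z : E × ℝ | z.1 + (z.2 + u) • d ∈ O} := fun u =>
    (by fun_prop : Measurable fun z : E × ℝ => z.1 + (z.2 + u) • d) hO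
  have hP : ∀ u : ℝ, P {ω | R ω + (ξ ω + u) • d ∈ O} =
      ((P.map R).prod (gaussianReal 0 V)) {z : E × ℝ | z.1 + (z.2 + u) • d ∈ O} := fun u => by
    rw [← hlaw, Measure.map_apply_of_aemeasurable (hR.prodMk hξ.aemeasurable) (hms u)]
    rfl
  have h1 := hP 0
  simp only [add_zero] at h1
  rw [h0] at h1
  have h2 := (Measure.measure_prod_null (by simpa using hms 0)).1 h1.symm
  have h3 := hP s
  simp only [add_smul, ← add_assoc] at h3
  rw [h3]
  have h4 := (Measure.measure_prod_null (μ := P.map R) (ν := gaussianReal 0 V) (hms s)).2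
  simp only [add_smul, ← add_assoc] at h4
  refine h4 ?_
  filter_upwards [h2] with r hr
  have h5 := gaussianReal_absolutelyContinuous' 0 hV hr
  refine gaussianReal_absolutelyContinuous 0 hV ?_
  have h6 : volume ((fun c : ℝ => c + s) ⁻¹' (Prod.mk r ⁻¹' {z : E × ℝ | z.1 + z.2 • d ∈ O})) = 0 := by
    rw [measure_preimage_add_right]
    exact h5
  convert! h6 using 2
  ext c
  simp [add_smul, add_assoc]

variable [NormedAddCommGroup H] [InnerProductSpace ℝ H] [CompleteSpace H]
  [SecondCountableTopology H] [MeasurableSpace H] [BorelSpace H] {v : HilbertBasis ℕ ℝ H}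

/-- A Gaussian law on `H` with non-degenerate diagonal covariance has full support. -/
lemma isOpenPosMeasure_of_expI {Q : H →L[ℝ] H} {q : ℕ → ℝ} (hQ : ∀ j, Q (v j) = q j • v j)
    (hq : ∀ j, 0 < q j) {W : Ω → H} (hW : Measurable W)
    (h : ∀ x, ∫ ω, expI (inner ℝ x (W ω)) ∂P = gaussExp 0 (inner ℝ x (Q x))) :
    (P.map W).IsOpenPosMeasure := by
  have := Measure.isProbabilityMeasure_map (μ := P) hW.aemeasurable
  set S := (P.map W).support with hS
  have hclosed : IsClosed S := Measure.isClosed_support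
  have hξ : ∀ j, HasLaw (fun ω => inner ℝ (v j) (W ω)) (gaussianReal 0 (q j).toNNReal) P := by
    intro j
    refine hasLaw_gaussianReal_of_expI (by fun_prop) fun c => ?_
    have := h (c • v j)
    simp only [inner_smul_left, map_smul, inner_smul_right, hQ, v.inner_eq_ite] at this
    simp only [conj_trivial] at this
    rw [this, Real.coe_toNNReal _ (hq j).le]
    simp
    ring_nf
  -- Removing its `j`-th coordinate leaves a vector uncorrelated with that coordinate, hence
  -- independent of it.
  have hind : ∀ j, IndepFun (fun ω => W ω - inner ℝ (v j) (W ω) • v j)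
      (fun ω => inner ℝ (v j) (W ω)) P := by
    intro j
    refine indepFun_of_expI (ℓ := fun x ω => inner ℝ x (W ω)) (fun _ _ _ => inner_add_left _ _ _)
      h (by fun_prop) (by fun_prop)
      (fun L => (InnerProductSpace.toDual ℝ H).symm L -
        inner ℝ (v j) ((InnerProductSpace.toDual ℝ H).symm L) • v j)
      (fun L => L 1 • v j) (fun L ω => ?_) (fun L ω => ?_) fun L L' => ?_
    · simp only [inner_sub_left, inner_smul_left, InnerProductSpace.toDual_symm_apply, map_sub,
        map_smul, smul_eq_mul, conj_trivial]
      rw [← InnerProductSpace.toDual_symm_apply (y := L) (x := v j),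
        real_inner_comm (v j) ((InnerProductSpace.toDual ℝ H).symm L)]
      ring
    · rw [inner_smul_left, ← smul_eq_mul (b := inner ℝ (v j) (W ω))]
      conv_lhs => rw [← mul_one (inner ℝ (v j) (W ω)), ← smul_eq_mul, map_smul]
      simp [mul_comm]
    · set x := (InnerProductSpace.toDual ℝ H).symm L
      have h0 : inner ℝ (v j) (Q (x - inner ℝ (v j) x • v j)) = 0 := by
        rw [inner_diagonal hQ, inner_sub_right, inner_smul_right, v.inner_eq_ite]
        simp
      have h0' := (inner_diagonal_comm hQ (x - inner ℝ (v j) x • v j) (v j)).trans h0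
      rw [map_add, inner_add_left, inner_add_right, inner_add_right, inner_smul_left (v j),
        h0, map_smul _ _ (v j), inner_smul_right, h0']
      simp
  -- A null neighbourhood of `x + s • v j` would pull back, by the shift, to a null neighbourhood of
  -- `x`.
  have hshift : ∀ (j : ℕ) (s : ℝ), ∀ x ∈ S, x + s • v j ∈ S := by
    intro j s x hx
    rw [hS, Measure.mem_support_iff_forall] at hx ⊢
    intro U hU
    by_contra hcon
    obtain ⟨O, hOU, hO, hxO⟩ := mem_nhds_iff.1 hU
    have hO0 : P.map W O = 0 := measure_mono_null hOU (by simpa using hcon)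
    rw [Measure.map_apply hW hO.measurableSet] at hO0
    have h1 := measure_shift_eq_zero (d := v j) (by simpa using hq j) (by fun_prop) (hξ j)
      (hind j) hO.measurableSet (by simpa using! hO0) s
    have h2 := hx ((fun z => z + s • v j) ⁻¹' O) ((hO.preimage (by fun_prop)).mem_nhds hxO)
    rw [Measure.map_apply hW (hO.preimage (by fun_prop)).measurableSet] at h2
    refine h2.ne' ?_
    simpa using! h1
  have hsum : ∀ (F : Finset ℕ) (c : ℕ → ℝ), ∀ x ∈ S, x + ∑ j ∈ F, c j • v j ∈ S := by
    intro F c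
    induction F using Finset.induction_on with
    | empty => simp
    | insert a F ha ih =>
      intro x hx
      rw [Finset.sum_insert ha, ← add_assoc]
      exact ih _ (hshift a _ x hx)
  obtain ⟨x₀, hx₀⟩ : S.Nonempty := Measure.nonempty_support (NeZero.ne _)
  -- The support is nonempty, closed and stable under translation by the dense span of the basis, so
  -- it is everything.
  have huniv : ∀ x, x ∈ S := fun x => by
    have h1 : Tendsto (fun F : Finset ℕ => x₀ + ∑ j ∈ F, inner ℝ (v j) (x - x₀) • v j) atTop
        (𝓝 (x₀ + (x - x₀))) := (v.hasSum_inner_smul (x - x₀)).const_add _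
    rw [add_sub_cancel] at h1
    exact hclosed.mem_of_tendsto h1 (Eventually.of_forall fun F => hsum F _ x₀ hx₀)
  refine ⟨fun U hU hne => ?_⟩
  obtain ⟨x, hx⟩ := hne
  exact ((Measure.mem_support_iff_forall x).1 (huniv x) U (hU.mem_nhds hx)).ne'

/-- Neighbourhoods of the mean only: this is all that survives when `V = 0`, the noiseless case. -/
lemma gaussianReal_pos_of_mem_nhds (V : ℝ≥0) {s : Set ℝ} (hs : s ∈ 𝓝 0) :
    0 < gaussianReal 0 V s := by
  by_cases hV : V = 0
  · subst hV
    rw [gaussianReal_zero_var, Measure.dirac_apply_of_mem (mem_of_mem_nhds hs)]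
    exact one_pos
  · refine pos_iff_ne_zero.2 fun h => ?_
    exact (Measure.measure_pos_of_mem_nhds volume hs).ne' (gaussianReal_absolutelyContinuous' 0 hV h)

end Support

/-! ### Posterior weights, means and variances of the modes. -/

open Classical in
/-- The weight of the observation in the posterior mean of mode `j`: `μ_j / (μ_j + σB²)` for an
observed mode, and `0` otherwise. -/
noncomputable def obsWeight {n : ℕ} (μ : ℕ → ℝ) (σB : ℝ) (η : Fin n → ℕ) (j : ℕ) : ℝ :=
  if j ∈ range η then μ j / (μ j + σB ^ 2) else 0

/-- The posterior variance of mode `j` of `X₀`. -/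
noncomputable def postVar {n : ℕ} (μ : ℕ → ℝ) (σB : ℝ) (η : Fin n → ℕ) (j : ℕ) : ℝ :=
  μ j * (1 - obsWeight μ σB η j)

/-- The posterior mean of `X₀`. -/
noncomputable def postMean {H : Type*} [NormedAddCommGroup H] [InnerProductSpace ℝ H] {n : ℕ}
    (v : HilbertBasis ℕ ℝ H) (μ : ℕ → ℝ) (σB : ℝ) (η : Fin n → ℕ) (y : Fin n → ℝ) : H :=
  ∑ k, (obsWeight μ σB η (η k) * y k) • v (η k)

/-- The variance at time `t` of a mode with initial variance `m` and diffusion coefficient `l`. -/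
noncomputable def fwdVar (m l t : ℝ) : ℝ := m * Real.exp (-t) + l * (1 - Real.exp (-t))

section Weights

variable {n : ℕ} {μ : ℕ → ℝ} {σB : ℝ} {η : Fin n → ℕ}

lemma obsWeight_apply (k : Fin n) :
    obsWeight μ σB η (η k) = μ (η k) / (μ (η k) + σB ^ 2) := by simp [obsWeight]

lemma obsWeight_of_notMem {j : ℕ} (hj : j ∉ range η) : obsWeight μ σB η j = 0 := by
  simp only [obsWeight, if_neg hj]

lemma postVar_nonneg (hμ : ∀ j, 0 < μ j) (j : ℕ) : 0 ≤ postVar μ σB η j := by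
  refine mul_nonneg (hμ j).le (sub_nonneg.2 ?_)
  unfold obsWeight
  split_ifs
  · exact div_le_one_of_le₀ (by nlinarith [sq_nonneg σB]) (by nlinarith [sq_nonneg σB, hμ j])
  · exact zero_le_one

lemma postVar_le (hμ : ∀ j, 0 < μ j) (j : ℕ) : postVar μ σB η j ≤ μ j := by
  refine mul_le_of_le_one_right (hμ j).le ?_
  unfold obsWeight
  have := hμ j
  split_ifs
  · have : 0 ≤ μ j / (μ j + σB ^ 2) := by positivity
    linarith
  · simp

/-- The normal equation characterizing the weights. -/
lemma obsWeight_mul_sq (hμ : ∀ j, 0 < μ j) (k : Fin n) :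
    obsWeight μ σB η (η k) * σB ^ 2 = postVar μ σB η (η k) := by
  have : 0 < μ (η k) + σB ^ 2 := by nlinarith [hμ (η k), sq_nonneg σB]
  rw [postVar, obsWeight_apply]
  field_simp
  ring

lemma modeObs_apply (hη : Function.Injective η) (y : Fin n → ℝ) (k : Fin n) :
    modeObs η y (η k) = y k := hη.extend_apply _ _ _

lemma modeObs_of_notMem {j : ℕ} (hj : j ∉ range η) (y : Fin n → ℝ) : modeObs η y j = 0 :=
  Function.extend_apply' _ _ _ (by simpa using hj)

lemma sum_modeObs {v : ℕ → ℝ} (hη : Function.Injective η) (y : Fin n → ℝ) {j : ℕ}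
    (hv : ∀ i, v i = if j = i then 1 else 0) : ∑ k, y k * v (η k) = modeObs η y j := by
  by_cases hj : j ∈ range η
  · obtain ⟨k, rfl⟩ := hj
    rw [Finset.sum_eq_single k]
    · rw [hv, if_pos rfl, mul_one, modeObs_apply hη]
    · intro i _ hi
      rw [hv, if_neg (fun h => hi (hη h).symm), mul_zero]
    · simp
  · rw [modeObs_of_notMem hj]
    refine Finset.sum_eq_zero fun k _ => ?_
    rw [hv, if_neg (fun h => hj ⟨k, h.symm⟩), mul_zero]

variable {H : Type*} [NormedAddCommGroup H] [InnerProductSpace ℝ H] {v : HilbertBasis ℕ ℝ H}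

lemma inner_postMean (hη : Function.Injective η) (y : Fin n → ℝ) (j : ℕ) :
    inner ℝ (v j) (postMean v μ σB η y) = obsWeight μ σB η j * modeObs η y j := by
  rw [← sum_modeObs hη y (fun i => v.inner_eq_ite j i), postMean, inner_sum, Finset.mul_sum]
  refine Finset.sum_congr rfl fun k _ => ?_
  rw [inner_smul_right, v.inner_eq_ite]
  split_ifs with h
  · rw [← h]; ring
  · simp

lemma continuous_postMean : Continuous (postMean v μ σB η) := by
  unfold postMean
  fun_prop

lemma fwdVar_pos {m l t : ℝ} (hm : 0 ≤ m) (hl : 0 < l) (ht : 0 < t) : 0 < fwdVar m l t := by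
  have h1 : Real.exp (-t) < 1 := by simpa using ht
  have h2 := Real.exp_pos (-t)
  unfold fwdVar
  nlinarith [mul_nonneg hm h2.le, mul_pos hl (sub_pos.2 h1)]

lemma fwdVar_nonneg {m l t : ℝ} (hm : 0 ≤ m) (hl : 0 < l) (ht : 0 ≤ t) : 0 ≤ fwdVar m l t := by
  rcases ht.eq_or_lt with rfl | ht
  · simpa [fwdVar] using hm
  · exact (fwdVar_pos hm hl ht).le

end Weights

/-! ### The forward process as a Gaussian family. -/

section Forward

variable {Ω H : Type*} [MeasurableSpace Ω] [NormedAddCommGroup H] [InnerProductSpace ℝ H]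
  [CompleteSpace H] [SecondCountableTopology H] [MeasurableSpace H] [BorelSpace H]
  {v : HilbertBasis ℕ ℝ H} {Cμ C : H →L[ℝ] H} {μ lam : ℕ → ℝ}
  {n : ℕ} {η : Fin n → ℕ} {σB : ℝ} {P : Measure Ω} [IsProbabilityMeasure P]
  {X : ℝ → Ω → H} {N : ℝ≥0 → Ω → H} {B : Ω → Fin n → ℝ}

/-- Duhamel's formula `X_t - e^{-t/2} X₀ = ∫₀ᵗ e^{(s-t)/2} dN_s`, tested against `h`. -/
lemma IsForwardModel.inner_eq (hX : IsForwardModel Cμ C σB X N B P) {t : ℝ} (ht : 0 ≤ t) (h : H) :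
    ∀ᵐ ω ∂P, inner ℝ h (X t ω - Real.exp (-t / 2) • X 0 ω) =
      wienerIntegral (fun s => Real.exp ((s - t) / 2) • h)
        (fun s => (Real.exp ((s - t) / 2) / 2) • h) t (fun s => N s ω) := by
  filter_upwards [hX.wiener.continuous, hX.continuous, hX.equation] with ω hN hXc heq
  have hw : ContinuousOn (fun s => inner ℝ h (X s ω)) (Ico 0 (t + 1)) :=
    continuousOn_const.inner (𝕜 := ℝ) (hXc.mono fun s hs => hs.1)
  -- The horizon `t + 1` only makes the half-open interval contain `t`.
  have key := variation_of_constants (w := fun s => inner ℝ h (X s ω))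
    (M := fun s => inner ℝ h (N s.toNNReal ω)) (a := fun _ => -(1 / 2)) (T := t + 1)
    (ψ := fun s => Real.exp (s / 2)) hw
    (continuous_const.inner (hN.comp continuous_real_toNNReal)) continuousOn_const
    (fun s _ => ?_) (fun s hs => ?_) (t := t) ⟨ht, by linarith⟩
  · simp only [wienerIntegral, inner_smul_left, inner_sub_right, inner_smul_right, conj_trivial,
      sub_self, zero_div, Real.exp_zero, one_mul]
    have hexp : ∀ s : ℝ, Real.exp ((s - t) / 2) = Real.exp (-t / 2) * Real.exp (s / 2) := fun s => by
      rw [← Real.exp_add]; ring_nf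
    have hint : ∫ s in (0 : ℝ)..t, Real.exp ((s - t) / 2) / 2 * inner ℝ h (N s.toNNReal ω) =
        -Real.exp (-t / 2) *
          ∫ s in (0 : ℝ)..t, -(1 / 2) * Real.exp (s / 2) * inner ℝ h (N s.toNNReal ω) := by
      rw [← intervalIntegral.integral_const_mul]
      refine intervalIntegral.integral_congr fun s _ => ?_
      simp only [hexp]
      ring
    rw [hint]
    have h1 : Real.exp (-t / 2) * Real.exp (t / 2) = 1 := by rw [← Real.exp_add]; ring_nf; simp
    simp only [zero_div, Real.exp_zero, one_mul] at key
    have h2 := congrArg (Real.exp (-t / 2) * ·) key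
    simp only [← mul_assoc, h1, one_mul] at h2
    linear_combination h2
  · exact ((hasDerivAt_id s).div_const 2).exp.congr_deriv (by simp; ring)
  · have hi : IntervalIntegrable (fun r => -((1 / 2 : ℝ) • X r ω)) volume 0 s := by
      refine ContinuousOn.intervalIntegrable ?_
      rw [uIcc_of_le hs.1]
      exact ((hXc.mono fun r hr => hr.1).const_smul _).neg
    have h1 := (innerSL ℝ h).intervalIntegral_comp_comm hi
    simp only [innerSL_apply_apply] at h1
    rw [heq s hs.1, inner_add_right, inner_add_right, ← h1]
    simp [inner_neg_right, inner_smul_right]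

lemma IsForwardModel.integral_expI_noise (hX : IsForwardModel Cμ C σB X N B P) (ξ : Fin n → ℝ) :
    ∫ ω, expI (∑ k, ξ k * B ω k) ∂P = gaussExp 0 (σB ^ 2 * ∑ k, ξ k ^ 2) := by
  have h1 := hX.noise.integral_comp (f := fun b => expI (∑ k, ξ k * b k))
    (Measurable.aestronglyMeasurable (by fun_prop))
  simp only [Function.comp_def] at h1
  rw [h1]
  simp only [expI_finset_sum]
  rw [integral_fintype_prod_eq_prod (fun k x => expI (ξ k * x)), Finset.mul_sum,
    gaussExp_finset_sum]
  refine Finset.prod_congr rfl fun k _ => ?_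
  have := integral_expI_of_hasLaw (HasLaw.id (μ := gaussianReal 0 (σB ^ 2).toNNReal)) (ξ k)
  simp only [id] at this
  rw [this, Real.coe_toNNReal _ (sq_nonneg _), mul_zero, mul_comm]

/-- A linear functional of the independent Gaussian variables `X₀`, `X_t - e^{-t/2} X₀` and `B`. -/
noncomputable def tripleForm (X : ℝ → Ω → H) (B : Ω → Fin n → ℝ) (t : ℝ)
    (p : H × H × (Fin n → ℝ)) (ω : Ω) : ℝ :=
  inner ℝ p.1 (X 0 ω) + inner ℝ p.2.1 (X t ω - Real.exp (-t / 2) • X 0 ω) + ∑ k, p.2.2 k * B ω k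

/-- The covariance form of the functionals `tripleForm`. -/
noncomputable def tripleCov (Cμ C : H →L[ℝ] H) (σB t : ℝ) (p p' : H × H × (Fin n → ℝ)) : ℝ :=
  inner ℝ p.1 (Cμ p'.1) + (1 - Real.exp (-t)) * inner ℝ p.2.1 (C p'.2.1) +
    σB ^ 2 * ∑ k, p.2.2 k * p'.2.2 k

lemma tripleForm_add (t : ℝ) (p p' : H × H × (Fin n → ℝ)) (ω : Ω) :
    tripleForm X B t (p + p') ω = tripleForm X B t p ω + tripleForm X B t p' ω := by
  simp only [tripleForm, Prod.fst_add, Prod.snd_add, Pi.add_apply, inner_add_left, add_mul,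
    Finset.sum_add_distrib]
  ring

lemma tripleCov_add (hCμ : ∀ j, Cμ (v j) = μ j • v j) (hC : ∀ j, C (v j) = lam j • v j) (t : ℝ)
    {p p' : H × H × (Fin n → ℝ)} (h : tripleCov Cμ C σB t p p' = 0) :
    tripleCov Cμ C σB t (p + p') (p + p') =
      tripleCov Cμ C σB t p p + tripleCov Cμ C σB t p' p' := by
  have h1 : tripleCov Cμ C σB t (p + p') (p + p') = tripleCov Cμ C σB t p p +
      tripleCov Cμ C σB t p' p' + 2 * tripleCov Cμ C σB t p p' := by
    simp only [tripleCov, Prod.fst_add, Prod.snd_add, Pi.add_apply, inner_add_left, map_add,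
      inner_add_right, add_mul, mul_add, Finset.sum_add_distrib]
    rw [inner_diagonal_comm hCμ p'.1 p.1, inner_diagonal_comm hC p'.2.1 p.2.1]
    simp only [mul_comm (p'.2.2 _) (p.2.2 _)]
    ring
  rw [h1, h]
  ring

/-- Joint Gaussianity of `X₀`, `X_t - e^{-t/2} X₀` and `B`. Afterwards every independence and every
law about `(X₀, X_t, Y)` reduces to bilinear algebra with `tripleCov`. -/
lemma IsForwardModel.integral_expI_tripleForm (hX : IsForwardModel Cμ C σB X N B P)
    (hCμ : ∀ h, 0 ≤ inner ℝ h (Cμ h)) (hC : ∀ h, 0 ≤ inner ℝ h (C h)) {t : ℝ} (ht : 0 ≤ t)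
    (p : H × H × (Fin n → ℝ)) :
    ∫ ω, expI (tripleForm X B t p ω) ∂P = gaussExp 0 (tripleCov Cμ C σB t p p) := by
  obtain ⟨a, b, ξ⟩ := p
  have hX0 := hX.measurable_state 0 le_rfl
  have hB := hX.measurable_noise
  have hNm := hX.wiener.measurable
  have hpath : Measurable fun ω => fun s => N s ω := measurable_pi_lambda _ hNm
  set F : Ω → ℂ := fun ω => expI (∑ k, ξ k * B ω k) * expI (inner ℝ a (X 0 ω)) with hF
  -- Two independence hypotheses are chained: `X 0` from the path, then `B` from the pair.
  have hBX : ∀ Ψ : (ℝ≥0 → H) → ℂ, Measurable Ψ →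
      ∫ ω, F ω * Ψ (fun s => N s ω) ∂P = (∫ ω, expI (∑ k, ξ k * B ω k) ∂P) *
        ((∫ ω, expI (inner ℝ a (X 0 ω)) ∂P) * ∫ ω, Ψ (fun s => N s ω) ∂P) := by
    intro Ψ hΨ
    rw [← hX.indep_wiener.integral_fun_comp_mul_comp (f := fun x => expI (inner ℝ a x)) (g := Ψ)
      hX0.aemeasurable hpath.aemeasurable (by fun_prop) hΨ.aestronglyMeasurable]
    rw [← hX.indep_noise.integral_fun_comp_mul_comp (f := fun b => expI (∑ k, ξ k * b k))
      (g := fun z => expI (inner ℝ a z.1) * Ψ z.2) hB.aemeasurable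
      (hX0.prodMk hpath).aemeasurable (Measurable.aestronglyMeasurable (by fun_prop)) ?_]
    · simp only [hF, mul_assoc]
    · exact ((by fun_prop : Measurable fun z : H × (ℝ≥0 → H) => expI (inner ℝ a z.1)).mul
        (hΨ.comp measurable_snd)).aestronglyMeasurable
  have hF1 : ∫ ω, F ω ∂P =
      (∫ ω, expI (∑ k, ξ k * B ω k) ∂P) * ∫ ω, expI (inner ℝ a (X 0 ω)) ∂P := by
    have := hBX (fun _ => 1) measurable_const
    simpa using this
  have hunc : UncorrelatedWithPath F N P := fun Ψ hΨ => by rw [hBX Ψ hΨ, hF1, mul_assoc]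
  have hder : ∀ s, HasDerivAt (fun s => Real.exp ((s - t) / 2) • b)
      ((Real.exp ((s - t) / 2) / 2) • b) s := fun s =>
    ((((hasDerivAt_id s).sub_const t).div_const 2).exp.smul_const b).congr_deriv (by
      simp; ring_nf)
  have key := integral_mul_expI_wienerIntegral hX.wiener hC ht (fun s _ => hder s)
    (Continuous.continuousOn (by fun_prop)) (F := F) (by fun_prop)
    (fun ω => by simp [hF, norm_expI]) hunc
  -- The variance factor is `∫₀ᵗ e^{s-t} ds = 1 - e^{-t}`.
  have hvar : ∫ s in (0 : ℝ)..t, inner ℝ (Real.exp ((s - t) / 2) • b)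
      (C (Real.exp ((s - t) / 2) • b)) = (1 - Real.exp (-t)) * inner ℝ b (C b) := by
    have hd : ∀ s ∈ uIcc 0 t, HasDerivAt (fun s => Real.exp (s - t)) (Real.exp (s - t)) s :=
      fun s _ => ((hasDerivAt_id s).sub_const t).exp.congr_deriv (by simp)
    have := intervalIntegral.integral_eq_sub_of_hasDerivAt hd
      (Continuous.intervalIntegrable (by fun_prop) _ _)
    rw [sub_self, Real.exp_zero, zero_sub] at this
    rw [← this, ← intervalIntegral.integral_mul_const]
    refine intervalIntegral.integral_congr fun s _ => ?_
    simp only [inner_smul_left, map_smul, inner_smul_right, conj_trivial]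
    rw [← mul_assoc, ← Real.exp_add]
    ring_nf
  rw [hvar, hF1, hX.integral_expI_noise, integral_expI_of_hasCenteredGaussianLaw hCμ hX.prior,
    ← gaussExp_add, ← gaussExp_add] at key
  have hae : ∀ᵐ ω ∂P, expI (tripleForm X B t (a, b, ξ) ω) =
      F ω * expI (wienerIntegral (fun s => Real.exp ((s - t) / 2) • b)
        (fun s => (Real.exp ((s - t) / 2) / 2) • b) t fun s => N s ω) := by
    filter_upwards [hX.inner_eq ht b] with ω hω
    simp only [tripleForm, hω, hF, ← expI_add]
    congr 1
    ring
  rw [integral_congr_ae hae, key]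
  congr 1
  · simp
  · simp only [tripleCov, sq]
    ring

end Forward

/-! ### Conditional laws given the observation. -/

section ConditionalLaw

variable {Ω H : Type*} [MeasurableSpace Ω] [NormedAddCommGroup H] [InnerProductSpace ℝ H]
  [CompleteSpace H] [SecondCountableTopology H] [MeasurableSpace H] [BorelSpace H]
  {v : HilbertBasis ℕ ℝ H} {Cμ C : H →L[ℝ] H} {μ lam : ℕ → ℝ}
  {n : ℕ} {η : Fin n → ℕ} {σB : ℝ} {P : Measure Ω} [IsProbabilityMeasure P]
  {X : ℝ → Ω → H} {N : ℝ≥0 → Ω → H} {B : Ω → Fin n → ℝ}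

/-- Freezing `Y = y` in `U + a(Y)` leaves the law of `U` untouched, so conditional laws are
translates of one law; weak continuity follows from that of `a` by dominated convergence. -/
lemma exists_kernel_of_indepFun {U : Ω → H} {Y : Ω → Fin n → ℝ} (hU : Measurable U)
    (hY : Measurable Y) (hUY : IndepFun Y U P) {a : (Fin n → ℝ) → H} (ha : Continuous a) :
    ∃ κ : Kernel (Fin n → ℝ) H, IsConditionalLaw (fun ω => U ω + a (Y ω)) Y P κ ∧
      ∀ y, κ y = P.map (fun ω => U ω + a y) := by
  have hν := Measure.isProbabilityMeasure_map (μ := P) hU.aemeasurable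
  have hm : Measurable fun z : (Fin n → ℝ) × H => z.2 + a z.1 :=
    measurable_snd.add (ha.measurable.comp measurable_fst)
  have hm' : ∀ y, Measurable fun u => u + a y := fun y => measurable_id.add_const _
  let κ : Kernel (Fin n → ℝ) H :=
    ⟨fun y => (P.map U).map (fun u => u + a y), by
      refine Measure.measurable_of_measurable_coe _ fun s hs => ?_
      simp only [Measure.map_apply (hm' _) hs]
      exact measurable_measure_prodMk_left (hm hs)⟩
  have hκ : ∀ y, κ y = (P.map U).map (fun u => u + a y) := fun _ => rfl
  have hmk : IsMarkovKernel κ :=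
    ⟨fun y => by rw [hκ]; exact Measure.isProbabilityMeasure_map (hm' y).aemeasurable⟩
  refine ⟨κ, ⟨hmk, ⟨by fun_prop, ?_⟩, fun f => ?_⟩, fun y => ?_⟩
  · refine Measure.ext_of_lintegral _ fun f hf => ?_
    rw [Measure.lintegral_compProd hf, lintegral_map hf (by fun_prop)]
    have h1 : ∀ y, ∫⁻ x, f (y, x) ∂(κ y) = ∫⁻ u, f (y, u + a y) ∂(P.map U) := fun y => by
      rw [hκ]
      exact lintegral_map (hf.comp measurable_prodMk_left) (hm' y)
    simp only [h1]
    have hf' : Measurable fun z : (Fin n → ℝ) × H => f (z.1, z.2 + a z.1) :=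
      hf.comp (measurable_fst.prodMk hm)
    rw [← lintegral_prod _ hf'.aemeasurable,
      ← (indepFun_iff_map_prod_eq_prod_map_map hY.aemeasurable hU.aemeasurable).1 hUY,
      lintegral_map hf' (by fun_prop)]
  · have h1 : ∀ y, ∫ x, f x ∂(κ y) = ∫ u, f (u + a y) ∂(P.map U) := fun y => by
      rw [hκ, integral_map (hm' y).aemeasurable (by fun_prop)]
    simp only [h1]
    refine continuous_of_dominated (bound := fun _ => ‖f‖) (fun y => ?_)
      (fun y => ae_of_all _ fun u => f.norm_coe_le_norm _) (integrable_const _)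
      (ae_of_all _ fun u => by fun_prop)
    exact (f.continuous.measurable.comp (hm' y)).aestronglyMeasurable
  · rw [hκ, Measure.map_map (hm' y) hU]
    rfl

lemma measurable_observation (hX : IsForwardModel Cμ C σB X N B P) :
    Measurable (observation v η X B) := by
  have h0 := hX.measurable_state 0 le_rfl
  have hB := hX.measurable_noise
  refine measurable_pi_lambda _ fun k => ?_
  unfold observation
  exact (by fun_prop : Measurable fun ω => inner ℝ (v (η k)) (X 0 ω)).add
    ((measurable_pi_apply k).comp hB)

/-- Coordinates of `h` along the observed modes. -/
noncomputable def obsCoord (v : HilbertBasis ℕ ℝ H) (η : Fin n → ℕ) (h : H) : Fin n → ℝ :=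
  fun k => inner ℝ (v (η k)) h

/-- Coefficients of `⟨h, X_t - e^{-t/2} E[X₀ | Y]⟩` as a `tripleForm`. -/
noncomputable def residualCoeff (v : HilbertBasis ℕ ℝ H) (μ : ℕ → ℝ) (σB : ℝ) (η : Fin n → ℕ)
    (t : ℝ) (h : H) : H × H × (Fin n → ℝ) :=
  (Real.exp (-t / 2) • (h - postMean v μ σB η (obsCoord v η h)), h,
    fun k => -(Real.exp (-t / 2) * (obsWeight μ σB η (η k) * obsCoord v η h k)))

/-- Coefficients of `∑ ξ_k Y_k` as a `tripleForm`. -/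
noncomputable def obsCoeff (v : HilbertBasis ℕ ℝ H) (η : Fin n → ℕ) (ξ : Fin n → ℝ) :
    H × H × (Fin n → ℝ) :=
  (∑ k, ξ k • v (η k), 0, ξ)

lemma tripleForm_obsCoeff (t : ℝ) (ξ : Fin n → ℝ) (ω : Ω) :
    tripleForm X B t (obsCoeff v η ξ) ω = ∑ k, ξ k * observation v η X B ω k := by
  simp only [tripleForm, obsCoeff, observation, sum_inner, inner_smul_left, inner_zero_left,
    conj_trivial, mul_add, Finset.sum_add_distrib, add_zero]

lemma tripleForm_residualCoeff (t : ℝ) (h : H) (ω : Ω) :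
    tripleForm X B t (residualCoeff v μ σB η t h) ω =
      inner ℝ h (X t ω - Real.exp (-t / 2) • postMean v μ σB η (observation v η X B ω)) := by
  simp only [tripleForm, residualCoeff, obsCoord, postMean, observation, inner_sub_right,
    inner_sub_left, inner_smul_left, inner_smul_right, inner_sum, sum_inner, conj_trivial, mul_sub,
    mul_add, add_mul, neg_mul, Finset.sum_neg_distrib, Finset.sum_add_distrib, Finset.mul_sum,
    real_inner_comm h]
  have e1 : ∀ k : Fin n, Real.exp (-t / 2) * (obsWeight μ σB η (η k) * B ω k *
      inner ℝ h (v (η k))) = Real.exp (-t / 2) * (obsWeight μ σB η (η k) *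
      inner ℝ h (v (η k))) * B ω k := fun k => by ring
  have e2 : ∀ k : Fin n, Real.exp (-t / 2) * (obsWeight μ σB η (η k) *
      inner ℝ (v (η k)) (X 0 ω) * inner ℝ h (v (η k))) = Real.exp (-t / 2) *
      (obsWeight μ σB η (η k) * inner ℝ h (v (η k)) * inner ℝ (v (η k)) (X 0 ω)) :=
    fun k => by ring
  simp only [e1, e2]
  ring

lemma inner_sub_postMean_obsCoord (hη : Function.Injective η) (h : H) (j : ℕ) :
    inner ℝ (v j) (h - postMean v μ σB η (obsCoord v η h)) =
      (1 - obsWeight μ σB η j) * inner ℝ (v j) h := by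
  rw [inner_sub_right, inner_postMean hη]
  by_cases hj : j ∈ range η
  · obtain ⟨k, rfl⟩ := hj
    rw [modeObs_apply hη, obsCoord]
    ring
  · rw [obsWeight_of_notMem hj]
    ring

/-- Mode by mode this is the normal equation `w σB² = μ (1 - w)`: the prior and noise contributions
cancel. -/
lemma tripleCov_residualCoeff_obsCoeff (hη : Function.Injective η) (hμ : ∀ j, 0 < μ j)
    (hCμ : ∀ j, Cμ (v j) = μ j • v j) (t : ℝ) (h : H) (ξ : Fin n → ℝ) :
    tripleCov Cμ C σB t (residualCoeff v μ σB η t h) (obsCoeff v η ξ) = 0 := by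
  have h1 : ∀ k, inner ℝ (h - postMean v μ σB η (obsCoord v η h)) (v (η k)) =
      (1 - obsWeight μ σB η (η k)) * obsCoord v η h k := fun k => by
    rw [real_inner_comm, inner_sub_postMean_obsCoord hη, obsCoord]
  simp only [tripleCov, residualCoeff, obsCoeff, map_sum, map_smul, hCμ, inner_sum,
    inner_smul_left, inner_smul_right, map_zero, inner_zero_right, mul_zero, add_zero,
    conj_trivial, h1, Finset.mul_sum, ← Finset.sum_add_distrib]
  refine Finset.sum_eq_zero fun k _ => ?_
  have := obsWeight_mul_sq (σB := σB) (η := η) hμ k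
  rw [postVar] at this
  linear_combination (-Real.exp (-t / 2) * obsCoord v η h k * ξ k) * this

/-- By the normal equation `μ (1 - w) w = w² σB²`. In the residual covariance this term cancels the
noise term, leaving a single factor `1 - w`. -/
lemma inner_residual_postMean (hη : Function.Injective η) (hμ : ∀ j, 0 < μ j)
    (hCμ : ∀ j, Cμ (v j) = μ j • v j) (h h' : H) :
    inner ℝ (h - postMean v μ σB η (obsCoord v η h))
        (Cμ (postMean v μ σB η (obsCoord v η h'))) =
      σB ^ 2 * ∑ k, (obsWeight μ σB η (η k) * obsCoord v η h k) *
        (obsWeight μ σB η (η k) * obsCoord v η h' k) := by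
  simp only [postMean.eq_def v μ σB η (obsCoord v η h'), map_sum, map_smul, hCμ, inner_sum,
    inner_smul_right, Finset.mul_sum]
  refine Finset.sum_congr rfl fun k _ => ?_
  rw [real_inner_comm, inner_sub_postMean_obsCoord hη, ← obsCoord.eq_def v η h k]
  have := obsWeight_mul_sq (σB := σB) (η := η) hμ k
  rw [postVar] at this
  linear_combination -(obsWeight μ σB η (η k) * obsCoord v η h k * obsCoord v η h' k) * this

lemma tripleCov_residualCoeff (hη : Function.Injective η) (hμ : ∀ j, 0 < μ j)
    (hCμ : ∀ j, Cμ (v j) = μ j • v j) (t : ℝ) (h h' : H) :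
    tripleCov Cμ C σB t (residualCoeff v μ σB η t h) (residualCoeff v μ σB η t h') =
      Real.exp (-t) * inner ℝ (h - postMean v μ σB η (obsCoord v η h)) (Cμ h') +
        (1 - Real.exp (-t)) * inner ℝ h (C h') := by
  have hexp : Real.exp (-t) = Real.exp (-t / 2) * Real.exp (-t / 2) := by
    rw [← Real.exp_add]; ring_nf
  have h2 := inner_residual_postMean (σB := σB) hη hμ hCμ h h'
  simp only [tripleCov, residualCoeff, map_smul, inner_smul_left, inner_smul_right,
    conj_trivial, map_sub, hexp]
  simp only [inner_sub_right, h2]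
  have h3 : ∑ k, -(Real.exp (-t / 2) * (obsWeight μ σB η (η k) * obsCoord v η h k)) *
      -(Real.exp (-t / 2) * (obsWeight μ σB η (η k) * obsCoord v η h' k)) =
      Real.exp (-t / 2) * Real.exp (-t / 2) *
        ∑ k, (obsWeight μ σB η (η k) * obsCoord v η h k) *
          (obsWeight μ σB η (η k) * obsCoord v η h' k) := by
    rw [Finset.mul_sum]
    exact Finset.sum_congr rfl fun k _ => by ring
  rw [h3]
  ring

lemma hasSum_tripleCov_residualCoeff (hη : Function.Injective η) (hμ : ∀ j, 0 < μ j)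
    (hCμ : ∀ j, Cμ (v j) = μ j • v j) (hC : ∀ j, C (v j) = lam j • v j) (t : ℝ) (h : H) :
    HasSum (fun j => fwdVar (postVar μ σB η j) (lam j) t * inner ℝ (v j) h ^ 2)
      (tripleCov Cμ C σB t (residualCoeff v μ σB η t h) (residualCoeff v μ σB η t h)) := by
  rw [tripleCov_residualCoeff hη hμ hCμ]
  refine (((hasSum_inner_diagonal hCμ _ h).mul_left _).add
    ((hasSum_inner_diagonal hC h h).mul_left _)).congr_fun fun j => ?_
  rw [inner_sub_postMean_obsCoord hη, fwdVar, postVar]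
  ring

lemma dual_apply_pi (L : StrongDual ℝ (Fin n → ℝ)) (x : Fin n → ℝ) :
    L x = ∑ k, L (Pi.single k 1) * x k := by
  conv_lhs => rw [← Finset.univ_sum_single x]
  rw [map_sum]
  refine Finset.sum_congr rfl fun k _ => ?_
  rw [mul_comm, ← smul_eq_mul, ← map_smul, ← Pi.single_smul, smul_eq_mul, mul_one]

/-- Conditional laws of the forward process given the observation: existence, weak continuity in
the data, and characteristic function. -/
lemma IsForwardModel.exists_conditionalLaw (hX : IsForwardModel Cμ C σB X N B P)
    (hη : Function.Injective η) (hμ : ∀ j, 0 < μ j) (hlam : ∀ j, 0 < lam j)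
    (hCμ : ∀ j, Cμ (v j) = μ j • v j) (hC : ∀ j, C (v j) = lam j • v j) {t : ℝ} (ht : 0 ≤ t) :
    ∃ κ : Kernel (Fin n → ℝ) H, IsConditionalLaw (X t) (observation v η X B) P κ ∧
      ∀ y h, charFun (κ y) h =
        gaussExp (Real.exp (-t / 2) * inner ℝ h (postMean v μ σB η y))
          (∑' j, fwdVar (postVar μ σB η j) (lam j) t * inner ℝ (v j) h ^ 2) := by
  have hY := measurable_observation (v := v) (η := η) hX
  have hXt := hX.measurable_state t ht
  have hpm := continuous_postMean (v := v) (μ := μ) (σB := σB) (η := η)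
  have hJ := hX.integral_expI_tripleForm (inner_diagonal_nonneg hCμ hμ)
    (inner_diagonal_nonneg hC hlam) ht
  set U : Ω → H := fun ω => X t ω - Real.exp (-t / 2) • postMean v μ σB η (observation v η X B ω)
    with hUdef
  have hU : Measurable U := hXt.sub ((hpm.measurable.comp hY).const_smul _)
  -- Jointly Gaussian and orthogonal, hence independent.
  have hind : IndepFun (observation v η X B) U P := by
    refine IndepFun.symm (indepFun_of_expI (tripleForm_add t) hJ hU.aemeasurable hY.aemeasurable
      (fun L => residualCoeff v μ σB η t ((InnerProductSpace.toDual ℝ H).symm L))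
      (fun L => obsCoeff v η fun k => L (Pi.single k 1)) (fun L ω => ?_) (fun L ω => ?_)
      fun L L' => ?_)
    · rw [tripleForm_residualCoeff, InnerProductSpace.toDual_symm_apply]
    · rw [tripleForm_obsCoeff, dual_apply_pi]
    · exact tripleCov_add hCμ hC t (tripleCov_residualCoeff_obsCoeff hη hμ hCμ t _ _)
  obtain ⟨κ, h1, h2⟩ := exists_kernel_of_indepFun hU hY hind
    (a := fun y => Real.exp (-t / 2) • postMean v μ σB η y) (hpm.const_smul _)
  refine ⟨κ, by simpa [hUdef] using h1, fun y h => ?_⟩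
  rw [h2, charFun_eq_integral_expI (hU.add_const _).aemeasurable]
  simp only [inner_add_right, expI_add, inner_smul_right]
  rw [integral_mul_const, gaussExp_eq, mul_comm,
    (hasSum_tripleCov_residualCoeff hη hμ hCμ hC t h).tsum_eq, ← hJ]
  simp only [tripleForm_residualCoeff, hUdef]

end ConditionalLaw

/-! ### The conditional score. -/

section Score

variable {Ω H : Type*} [MeasurableSpace Ω] [NormedAddCommGroup H] [InnerProductSpace ℝ H]
  [CompleteSpace H] [SecondCountableTopology H] [MeasurableSpace H] [BorelSpace H]
  {v : HilbertBasis ℕ ℝ H} {Cμ C : H →L[ℝ] H} {μ lam : ℕ → ℝ}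
  {n : ℕ} {η : Fin n → ℕ} {σB : ℝ} {P : Measure Ω} [IsProbabilityMeasure P]
  {X : ℝ → Ω → H} {N : ℝ≥0 → Ω → H} {B : Ω → Fin n → ℝ}

/-- Continuous functions of `(X_t, Y)` that agree almost surely agree everywhere. -/
lemma IsForwardModel.eq_of_ae_eq (hX : IsForwardModel Cμ C σB X N B P)
    (hη : Function.Injective η) (hμ : ∀ j, 0 < μ j) (hlam : ∀ j, 0 < lam j)
    (hCμ : ∀ j, Cμ (v j) = μ j • v j) (hC : ∀ j, C (v j) = lam j • v j) {t : ℝ} (ht : 0 < t)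
    {f g : H × (Fin n → ℝ) → ℝ} (hf : Continuous f) (hg : Continuous g)
    (h : ∀ᵐ ω ∂P, f (X t ω, observation v η X B ω) = g (X t ω, observation v η X B ω)) :
    f = g := by
  have hX0 := hX.measurable_state 0 le_rfl
  have hXt := hX.measurable_state t ht.le
  have hB := hX.measurable_noise
  have hJ := hX.integral_expI_tripleForm (inner_diagonal_nonneg hCμ hμ)
    (inner_diagonal_nonneg hC hlam) ht.le
  set G : Ω → H := fun ω => X t ω - Real.exp (-t / 2) • X 0 ω with hGdef
  have hG : Measurable G := hXt.sub (hX0.const_smul _)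
  have hadd := tripleForm_add (X := X) (B := B) t
  have hXG : IndepFun (X 0) G P := by
    refine indepFun_of_expI hadd hJ hX0.aemeasurable hG.aemeasurable
      (fun L => ((InnerProductSpace.toDual ℝ H).symm L, 0, 0))
      (fun L => (0, (InnerProductSpace.toDual ℝ H).symm L, 0)) (fun L ω => ?_) (fun L ω => ?_)
      fun L L' => tripleCov_add hCμ hC t ?_
    · simp [tripleForm]
    · simp only [tripleForm, inner_zero_left, InnerProductSpace.toDual_symm_apply, Pi.zero_apply,
        zero_mul, Finset.sum_const_zero, add_zero, zero_add, hGdef]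
    · simp [tripleCov]
  have hXGB : IndepFun (fun ω => (X 0 ω, G ω)) B P := by
    refine indepFun_of_expI hadd hJ (hX0.prodMk hG).aemeasurable hB.aemeasurable
      (fun L => ((InnerProductSpace.toDual ℝ H).symm (L.comp (.inl ℝ H H)),
        (InnerProductSpace.toDual ℝ H).symm (L.comp (.inr ℝ H H)), 0))
      (fun L => (0, 0, fun k => L (Pi.single k 1))) (fun L ω => ?_) (fun L ω => ?_)
      fun L L' => tripleCov_add hCμ hC t ?_
    · simp only [tripleForm, InnerProductSpace.toDual_symm_apply, Pi.zero_apply, zero_mul,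
        Finset.sum_const_zero, add_zero, ContinuousLinearMap.comp_apply, ← map_add, hGdef]
      simp
    · rw [dual_apply_pi]
      simp [tripleForm]
    · simp [tripleCov]
  have hpX : (P.map (X 0)).IsOpenPosMeasure := isOpenPosMeasure_of_expI hCμ hμ hX0 fun x =>
    integral_expI_of_hasCenteredGaussianLaw (inner_diagonal_nonneg hCμ hμ) hX.prior x
  have he : 0 < 1 - Real.exp (-t) := by simpa using ht
  have hpG : (P.map G).IsOpenPosMeasure := by
    refine isOpenPosMeasure_of_expI (v := v) (Q := (1 - Real.exp (-t)) • C)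
      (q := fun j => (1 - Real.exp (-t)) * lam j) (fun j => ?_) (fun j => mul_pos he (hlam j)) hG
      fun x => ?_
    · simp [hC, mul_smul]
    · have := hJ (0, x, 0)
      simpa [tripleForm, tripleCov, inner_smul_right, hGdef] using this
  by_contra hne
  obtain ⟨⟨x, y⟩, hxy⟩ : ∃ z, f z ≠ g z := by
    by_contra! hcon
    exact hne (funext hcon)
  set T : (H × H) × (Fin n → ℝ) → H × (Fin n → ℝ) := fun z =>
    (Real.exp (-t / 2) • z.1.1 + z.1.2, fun k => inner ℝ (v (η k)) z.1.1 + z.2 k) with hT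
  have hTc : Continuous T := by fun_prop
  have hO : IsOpen {z | f (T z) ≠ g (T z)} := isOpen_ne_fun (hf.comp hTc) (hg.comp hTc)
  -- A preimage of `(x, y)` with zero noise: the observed coordinates of `x₀` produce `y`, and the
  -- increment `G` corrects the rest. Hence the argument works when `B` is degenerate at `0`.
  set x₀ : H := ∑ k, y k • v (η k)
  have hx₀ : ∀ k, inner ℝ (v (η k)) x₀ = y k := fun k => by
    rw [← modeObs_apply hη y k, ← sum_modeObs hη y (fun i => v.inner_eq_ite (η k) i), inner_sum]
    simp [inner_smul_right]
  have hz : T ((x₀, x - Real.exp (-t / 2) • x₀), 0) = (x, y) := by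
    simp [hT, hx₀]
  have hmem : {z | f (T z) ≠ g (T z)} ∈ 𝓝 ((x₀, x - Real.exp (-t / 2) • x₀), (0 : Fin n → ℝ)) :=
    hO.mem_nhds (by rw [mem_ofPred_eq, hz]; exact hxy)
  obtain ⟨O₁, hO₁, O₂, hO₂, hsub⟩ := mem_nhds_prod_iff.1 hmem
  obtain ⟨ε, hε, hε₂⟩ := Metric.mem_nhds_iff.1 hO₂
  have hW : Measurable fun ω => ((X 0 ω, G ω), B ω) := (hX0.prodMk hG).prodMk hB
  have h0 : P.map (fun ω => ((X 0 ω, G ω), B ω)) {z | f (T z) ≠ g (T z)} = 0 := by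
    rw [Measure.map_apply hW hO.measurableSet]
    refine measure_mono_null (fun ω hω => ?_) (ae_iff.1 h)
    simpa [hT, hGdef, observation] using! hω
  rw [(indepFun_iff_map_prod_eq_prod_map_map (hX0.prodMk hG).aemeasurable hB.aemeasurable).1 hXGB,
    (indepFun_iff_map_prod_eq_prod_map_map hX0.aemeasurable hG.aemeasurable).1 hXG,
    hX.noise.map_eq] at h0
  have h1 := measure_mono_null (hsub.trans' (prod_mono_right hε₂)) h0
  have := Measure.isProbabilityMeasure_map (μ := P) hX0.aemeasurable
  have := Measure.isProbabilityMeasure_map (μ := P) hG.aemeasurable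
  rw [Measure.prod_prod, mul_eq_zero] at h1
  rcases h1 with h1 | h1
  · exact (Measure.measure_pos_of_mem_nhds _ hO₁).ne' h1
  · rw [ball_pi _ hε, Measure.pi_pi, Finset.prod_eq_zero_iff] at h1
    obtain ⟨k, -, hk⟩ := h1
    exact (gaussianReal_pos_of_mem_nhds _ (Metric.ball_mem_nhds _ hε)).ne' hk

/-- Coefficients of `⟨h, X₀ - E[X₀ | Y]⟩` as a `tripleForm`. -/
noncomputable def priorResidualCoeff (v : HilbertBasis ℕ ℝ H) (μ : ℕ → ℝ) (σB : ℝ)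
    (η : Fin n → ℕ) (h : H) : H × H × (Fin n → ℝ) :=
  (h - postMean v μ σB η (obsCoord v η h), 0, fun k => -(obsWeight μ σB η (η k) * obsCoord v η h k))

lemma residualCoeff_eq (t : ℝ) (h : H) :
    residualCoeff v μ σB η t h =
      Real.exp (-t / 2) • priorResidualCoeff v μ σB η h + (0, h, 0) := by
  simp only [residualCoeff, priorResidualCoeff, Prod.smul_mk, Prod.mk_add_mk, add_zero, smul_zero,
    zero_add]
  congr 2
  ext k
  simp

lemma tripleForm_smul (t c : ℝ) (p : H × H × (Fin n → ℝ)) (ω : Ω) :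
    tripleForm X B t (c • p) ω = c * tripleForm X B t p ω := by
  simp only [tripleForm, Prod.smul_fst, Prod.smul_snd, inner_smul_left, conj_trivial, Pi.smul_apply,
    smul_eq_mul, mul_add, Finset.mul_sum, mul_assoc]

lemma tripleCov_add_left (t : ℝ) (p p' r : H × H × (Fin n → ℝ)) :
    tripleCov Cμ C σB t (p + p') r = tripleCov Cμ C σB t p r + tripleCov Cμ C σB t p' r := by
  simp only [tripleCov, Prod.fst_add, Prod.snd_add, inner_add_left, Pi.add_apply, add_mul,
    Finset.sum_add_distrib]
  ring

lemma tripleCov_add_right (t : ℝ) (p r r' : H × H × (Fin n → ℝ)) :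
    tripleCov Cμ C σB t p (r + r') = tripleCov Cμ C σB t p r + tripleCov Cμ C σB t p r' := by
  simp only [tripleCov, Prod.fst_add, Prod.snd_add, map_add, inner_add_right, Pi.add_apply, mul_add,
    Finset.sum_add_distrib]
  ring

lemma tripleCov_smul_left (t c : ℝ) (p r : H × H × (Fin n → ℝ)) :
    tripleCov Cμ C σB t (c • p) r = c * tripleCov Cμ C σB t p r := by
  simp only [tripleCov, Prod.smul_fst, Prod.smul_snd, inner_smul_left, conj_trivial,
    Pi.smul_apply, smul_eq_mul, mul_add, Finset.mul_sum]
  congr 1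
  · ring
  · exact Finset.sum_congr rfl fun k _ => by ring

lemma tripleForm_priorResidualCoeff (t : ℝ) (h : H) (ω : Ω) :
    tripleForm X B t (priorResidualCoeff v μ σB η h) ω =
      inner ℝ h (X 0 ω - postMean v μ σB η (observation v η X B ω)) := by
  have h1 := tripleForm_residualCoeff (X := X) (B := B) (v := v) (μ := μ) (σB := σB) (η := η) t h ω
  rw [residualCoeff_eq, tripleForm_add, tripleForm_smul] at h1
  have h2 : tripleForm X B t ((0, h, 0) : H × H × (Fin n → ℝ)) ω =
      inner ℝ h (X t ω - Real.exp (-t / 2) • X 0 ω) := by simp [tripleForm]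
  rw [h2] at h1
  refine mul_left_cancel₀ (Real.exp_pos (-t / 2)).ne' ?_
  simp only [inner_sub_right, inner_smul_right] at h1 ⊢
  linarith

/-- The posterior mean of a mode of `X₀` given `X_t` and `Y`. -/
lemma IsForwardModel.condExp_mode (hX : IsForwardModel Cμ C σB X N B P)
    (hη : Function.Injective η) (hμ : ∀ j, 0 < μ j) (hlam : ∀ j, 0 < lam j)
    (hCμ : ∀ j, Cμ (v j) = μ j • v j) (hC : ∀ j, C (v j) = lam j • v j) {t : ℝ} (ht : 0 < t)
    (j : ℕ) :
    P[fun ω => inner ℝ (v j) (X 0 ω) | MeasurableSpace.comap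
        (fun ω => (X t ω, observation v η X B ω)) inferInstance] =ᵐ[P]
      fun ω => inner ℝ (v j) (postMean v μ σB η (observation v η X B ω)) +
        Real.exp (-t / 2) * postVar μ σB η j / fwdVar (postVar μ σB η j) (lam j) t *
          inner ℝ (v j) (X t ω - Real.exp (-t / 2) • postMean v μ σB η (observation v η X B ω)) := by
  have hX0 := hX.measurable_state 0 le_rfl
  have hXt := hX.measurable_state t ht.le
  have hY := measurable_observation (v := v) (η := η) hX
  have hpm := (continuous_postMean (v := v) (μ := μ) (σB := σB) (η := η)).measurable
  have hJ := hX.integral_expI_tripleForm (inner_diagonal_nonneg hCμ hμ)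
    (inner_diagonal_nonneg hC hlam) ht.le
  have hVpos := fwdVar_pos (postVar_nonneg (σB := σB) (η := η) hμ j) (hlam j) ht
  -- The regression coefficient: covariance of mode `j` of `X₀` and `X_t` given `Y`, divided by the
  -- conditional variance of the latter.
  set γ := Real.exp (-t / 2) * postVar μ σB η j / fwdVar (postVar μ σB η j) (lam j) t with hγ
  set a : H × (Fin n → ℝ) → ℝ := fun z => inner ℝ (v j) (postMean v μ σB η z.2) +
    γ * inner ℝ (v j) (z.1 - Real.exp (-t / 2) • postMean v μ σB η z.2) with ha
  have ham : Measurable a := by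
    have : Measurable fun z : H × (Fin n → ℝ) => postMean v μ σB η z.2 := hpm.comp measurable_snd
    fun_prop
  have hXY : Measurable fun ω => (X t ω, observation v η X B ω) := hXt.prodMk hY
  set R : Ω → ℝ := fun ω => inner ℝ (v j) (X 0 ω) - a (X t ω, observation v η X B ω) with hRdef
  have hR : Measurable R :=
    (by fun_prop : Measurable fun ω => inner ℝ (v j) (X 0 ω)).sub (ham.comp hXY)
  set r : H × H × (Fin n → ℝ) := priorResidualCoeff v μ σB η (v j) +
    (-γ) • residualCoeff v μ σB η t (v j) with hr
  have hRr : ∀ ω, R ω = tripleForm X B t r ω := fun ω => by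
    rw [hr, tripleForm_add, tripleForm_smul, tripleForm_priorResidualCoeff,
      tripleForm_residualCoeff, hRdef]
    simp only [ha, inner_sub_right]
    ring
  have hprior : ∀ p : H × H × (Fin n → ℝ), p.2.1 = 0 →
      tripleCov Cμ C σB t (residualCoeff v μ σB η t (v j)) p =
        Real.exp (-t / 2) * tripleCov Cμ C σB t (priorResidualCoeff v μ σB η (v j)) p := by
    intro p hp
    rw [residualCoeff_eq, tripleCov_add_left, tripleCov_smul_left]
    simp [tripleCov, hp]
  have hobs : ∀ ξ, tripleCov Cμ C σB t r (obsCoeff v η ξ) = 0 := fun ξ => by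
    have h1 := tripleCov_residualCoeff_obsCoeff (C := C) (σB := σB) hη hμ hCμ t (v j) ξ
    have h2 := hprior (obsCoeff v η ξ) rfl
    rw [h1] at h2
    have h3 := (mul_eq_zero.1 h2.symm).resolve_left (Real.exp_pos _).ne'
    rw [hr, tripleCov_add_left, tripleCov_smul_left, h1, h3]
    ring
  -- The choice of `γ` is exactly what makes this vanish.
  have hres : ∀ h, tripleCov Cμ C σB t r (residualCoeff v μ σB η t h) = 0 := fun h => by
    have h1 := tripleCov_residualCoeff (C := C) (σB := σB) hη hμ hCμ t (v j) h
    have h4 : inner ℝ (v j - postMean v μ σB η (obsCoord v η (v j))) (Cμ h) =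
        postVar μ σB η j * inner ℝ (v j) h := by
      rw [inner_diagonal_comm hCμ]
      have h5 : v j - postMean v μ σB η (obsCoord v η (v j)) =
          (1 - obsWeight μ σB η j) • v j := by
        refine v.repr.injective (lp.ext (funext fun i => ?_))
        rw [v.repr_apply_apply, v.repr_apply_apply, inner_sub_postMean_obsCoord hη,
          inner_smul_right, v.inner_eq_ite]
        split_ifs with hij
        · rw [hij]
        · simp
      rw [h5, map_smul, hCμ, inner_smul_right, inner_smul_right, real_inner_comm, postVar]
      ring
    rw [h4, inner_diagonal hC] at h1
    have h6 : tripleCov Cμ C σB t (priorResidualCoeff v μ σB η (v j))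
        (residualCoeff v μ σB η t h) =
          Real.exp (-t / 2) * (postVar μ σB η j * inner ℝ (v j) h) := by
      have h7 := inner_residual_postMean (σB := σB) hη hμ hCμ (v j) h
      rw [← h4]
      simp only [tripleCov, priorResidualCoeff, residualCoeff, map_smul, inner_smul_right, map_sub,
        inner_zero_left, mul_zero, add_zero]
      rw [inner_sub_right, h7, Finset.mul_sum, Finset.mul_sum, mul_sub, Finset.mul_sum,
        sub_add, sub_eq_self, sub_eq_zero]
      exact Finset.sum_congr rfl fun k _ => by ring
    rw [hr, tripleCov_add_left, tripleCov_smul_left, h1, h6, hγ]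
    have hV : fwdVar (postVar μ σB η j) (lam j) t * inner ℝ (v j) h =
        Real.exp (-t) * (postVar μ σB η j * inner ℝ (v j) h) +
          (1 - Real.exp (-t)) * (lam j * inner ℝ (v j) h) := by rw [fwdVar]; ring
    rw [← hV]
    field_simp
    ring
  -- A functional of `(X_t, Y)` is rewritten through the residual of `X_t` and `Y`; the extra
  -- observation coefficient restores the conditional mean that the residual subtracts.
  have hind : IndepFun R (fun ω => (X t ω, observation v η X B ω)) P := by
    refine indepFun_of_expI (tripleForm_add (X := X) (B := B) t) hJ hR.aemeasurable
      hXY.aemeasurable (fun L => L 1 • r)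
      (fun L => residualCoeff v μ σB η t
          ((InnerProductSpace.toDual ℝ H).symm (L.comp (.inl ℝ H (Fin n → ℝ)))) +
        obsCoeff v η (fun k => L (0, Pi.single k 1) + Real.exp (-t / 2) *
          (obsWeight μ σB η (η k) * L (v (η k), 0))))
      (fun L ω => ?_) (fun L ω => ?_) fun L L' => tripleCov_add hCμ hC t ?_
    · rw [tripleForm_smul, ← hRr]
      conv_lhs => rw [← mul_one (R ω), ← smul_eq_mul, map_smul, smul_eq_mul, mul_comm]
    · rw [tripleForm_add, tripleForm_residualCoeff, tripleForm_obsCoeff,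
        InnerProductSpace.toDual_symm_apply]
      have h1 : L (X t ω, observation v η X B ω) =
          L.comp (.inl ℝ H (Fin n → ℝ)) (X t ω) +
            L.comp (.inr ℝ H (Fin n → ℝ)) (observation v η X B ω) := by
        simp only [ContinuousLinearMap.comp_apply, ← map_add]
        simp
      rw [h1, dual_apply_pi (L.comp (.inr ℝ H (Fin n → ℝ))), map_sub, map_smul, postMean, map_sum]
      simp only [map_smul, smul_eq_mul, ContinuousLinearMap.comp_apply,
        ContinuousLinearMap.inl_apply, ContinuousLinearMap.inr_apply, add_mul,
        Finset.sum_add_distrib, Finset.mul_sum]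
      have h2 : ∀ k, Real.exp (-t / 2) * (obsWeight μ σB η (η k) * observation v η X B ω k *
          L (v (η k), 0)) = Real.exp (-t / 2) * (obsWeight μ σB η (η k) * L (v (η k), 0)) *
          observation v η X B ω k := fun k => by ring
      simp only [h2]
      ring
    · rw [tripleCov_smul_left, tripleCov_add_right, hres, hobs]
      ring
  -- The Gaussian law of `R` supplies its integrability and its zero mean.
  have hlaw := hasLaw_gaussianReal_of_expI (P := P) (m := 0)
    (V := (tripleCov Cμ C σB t r r).toNNReal) hR.aemeasurable fun c => by
      have hnn : 0 ≤ tripleCov Cμ C σB t r r := by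
        have he : 0 ≤ 1 - Real.exp (-t) := by simpa using ht.le
        have := inner_diagonal_nonneg hCμ hμ r.1
        have := inner_diagonal_nonneg hC hlam r.2.1
        have : 0 ≤ ∑ k, r.2.2 k * r.2.2 k := Finset.sum_nonneg fun k _ => mul_self_nonneg _
        unfold tripleCov
        positivity
      have h1 := hJ (c • r)
      simp only [tripleForm_smul, ← hRr] at h1
      rw [h1, Real.coe_toNNReal _ hnn, tripleCov_smul_left]
      simp only [tripleCov, Prod.smul_fst, Prod.smul_snd, map_smul, inner_smul_right,
        Pi.smul_apply, smul_eq_mul, mul_zero]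
      congr 1
      have : ∑ k, r.2.2 k * (c * r.2.2 k) = c * ∑ k, r.2.2 k * r.2.2 k := by
        rw [Finset.mul_sum]; exact Finset.sum_congr rfl fun k _ => by ring
      rw [this]
      ring
  have hRint : Integrable R P := hlaw.hasGaussianLaw.integrable
  have hXint : Integrable (fun ω => inner ℝ (v j) (X 0 ω)) P :=
    (hX.prior (v j)).hasGaussianLaw.integrable
  have haint : Integrable (fun ω => a (X t ω, observation v η X B ω)) P := by
    refine (hXint.sub hRint).congr (ae_of_all _ fun ω => ?_)
    simp [hRdef]
  have hle : MeasurableSpace.comap (fun ω => (X t ω, observation v η X B ω)) inferInstance ≤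
      ‹MeasurableSpace Ω› := hXY.comap_le
  have hRce : P[R | MeasurableSpace.comap (fun ω => (X t ω, observation v η X B ω))
      inferInstance] =ᵐ[P] fun _ => P[R] :=
    condExp_indep_eq hR.comap_le hle (comap_measurable R).stronglyMeasurable hind
  have hR0 : P[R] = 0 := by
    rw [hlaw.integral_eq, integral_id_gaussianReal]
  have hace := condExp_of_stronglyMeasurable hle
    (ham.comp (comap_measurable fun ω => (X t ω, observation v η X B ω))).stronglyMeasurable haint
  have hsum := condExp_add hRint haint
    (MeasurableSpace.comap (fun ω => (X t ω, observation v η X B ω)) inferInstance)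
  have heq : (fun ω => inner ℝ (v j) (X 0 ω)) =
      R + fun ω => a (X t ω, observation v η X B ω) := by
    ext ω
    simp [hRdef]
  rw [heq]
  filter_upwards [hsum, hRce] with ω h1 h2
  rw [h1, Pi.add_apply, h2, hR0, zero_add]
  exact congrFun hace ω

/-- Every mode of the conditional score. -/
lemma IsForwardModel.inner_score (hX : IsForwardModel Cμ C σB X N B P)
    (hη : Function.Injective η) (hμ : ∀ j, 0 < μ j) (hlam : ∀ j, 0 < lam j)
    (hCμ : ∀ j, Cμ (v j) = μ j • v j) (hC : ∀ j, C (v j) = lam j • v j)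
    (hXint : Integrable (X 0) P) {S : ℝ → H → (Fin n → ℝ) → H}
    (hS : IsConditionalScore X (observation v η X B) P S) {t : ℝ} (ht : 0 < t)
    (x : H) (y : Fin n → ℝ) (j : ℕ) :
    inner ℝ (v j) (S t x y) = -(lam j / fwdVar (postVar μ σB η j) (lam j) t) *
      inner ℝ (v j) (x - Real.exp (-t / 2) • postMean v μ σB η y) := by
  obtain ⟨hSc, hSe⟩ := hS t ht
  have hpm := continuous_postMean (v := v) (μ := μ) (σB := σB) (η := η)
  have hce := (innerSL ℝ (v j)).comp_condExp_comm hXint (m := MeasurableSpace.comap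
    (fun ω => (X t ω, observation v η X B ω)) inferInstance)
  -- Both sides are continuous, so the identity spreads from almost every `(X_t, Y)` to all `(x,
  -- y)`. This is needed because the reverse process is unrelated to the law of `X`.
  have key := hX.eq_of_ae_eq hη hμ hlam hCμ hC ht
    (f := fun z => inner ℝ (v j) (S t z.1 z.2))
    (g := fun z => -(lam j / fwdVar (postVar μ σB η j) (lam j) t) *
      inner ℝ (v j) (z.1 - Real.exp (-t / 2) • postMean v μ σB η z.2))
    (continuous_const.inner hSc) (by fun_prop) ?_
  · exact congrFun key (x, y)
  filter_upwards [hSe, hce, hX.condExp_mode hη hμ hlam hCμ hC ht j] with ω h1 h2 h3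
  simp only [Function.comp_def, innerSL_apply_apply] at h2
  rw [h1, inner_neg_right, inner_smul_right, inner_sub_right, inner_smul_right, h2, h3]
  have hVpos := fwdVar_pos (postVar_nonneg (σB := σB) (η := η) hμ j) (hlam j) ht
  have he : 0 < 1 - Real.exp (-t) := by simpa using ht
  have hexp : Real.exp (-t / 2) ^ 2 = Real.exp (-t) := by
    rw [← Real.exp_nat_mul]; congr 1; push_cast; ring
  simp only [inner_sub_right, inner_smul_right]
  -- With `V = m E² + l D` one has `1 - E² m / V = l D / V`, so the prefactor `D⁻¹ = (1 - e^{-t})⁻¹`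
  -- cancels.
  have hVdef : fwdVar (postVar μ σB η j) (lam j) t =
      postVar μ σB η j * Real.exp (-t / 2) ^ 2 + lam j * (1 - Real.exp (-t)) := by
    rw [fwdVar, hexp]
  have hV0 := hVpos.ne'
  have he0 := he.ne'
  generalize fwdVar (postVar μ σB η j) (lam j) t = V at hVdef hV0 ⊢
  generalize 1 - Real.exp (-t) = D at hVdef he0 ⊢
  generalize Real.exp (-t / 2) = E at hVdef ⊢
  field_simp
  rw [hVdef]
  ring

/-- Gaussian one-dimensional marginals make the law Gaussian on `H`, hence with finite first moment.
-/
lemma IsForwardModel.integrable_prior (hX : IsForwardModel Cμ C σB X N B P) :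
    Integrable (X 0) P := by
  have hX0 := hX.measurable_state 0 le_rfl
  have : IsGaussian (P.map (X 0)) := isGaussian_of_map_eq_gaussianReal fun L => by
    have h := (hX.prior ((InnerProductSpace.toDual ℝ H).symm L)).map_eq
    simp only [InnerProductSpace.toDual_symm_apply] at h
    exact ⟨0, _, (Measure.map_map L.continuous.measurable hX0).trans h⟩
  exact (IsGaussian.hasGaussianLaw (X := X 0)).integrable

end Score

/-! ### The scalar equation of a reverse mode. -/

section ReverseMode

variable {m l T : ℝ}

/-- Rate of the mode equation of the reverse-time process. -/
noncomputable def revRate (m l T s : ℝ) : ℝ := 1 / 2 - l / fwdVar m l (T - s)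

/-- Integrating factor of the mode equation of the reverse-time process. -/
noncomputable def revFactor (m l T s : ℝ) : ℝ :=
  Real.exp (s / 2) * fwdVar m l T / fwdVar m l (T - s)

/-- Inverse of the integrating factor `revFactor`. -/
noncomputable def revContraction (m l T t : ℝ) : ℝ :=
  Real.exp (-t / 2) * fwdVar m l (T - t) / fwdVar m l T

@[fun_prop]
lemma continuous_fwdVar : Continuous (fwdVar m l) := by
  unfold fwdVar
  fun_prop

lemma continuous_revContraction : Continuous (revContraction m l T) := by
  unfold revContraction
  fun_prop

lemma fwdVar_zero : fwdVar m l 0 = m := by simp [fwdVar]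

lemma hasDerivAt_fwdVar (t : ℝ) : HasDerivAt (fwdVar m l) (l - fwdVar m l t) t := by
  unfold fwdVar
  have h : HasDerivAt (fun t => Real.exp (-t)) (-Real.exp (-t)) t :=
    (hasDerivAt_neg t).exp.congr_deriv (by ring)
  refine ((h.const_mul m).add ((h.const_sub 1).const_mul l)).congr_deriv ?_
  ring

lemma hasDerivAt_fwdVar_sub (s : ℝ) :
    HasDerivAt (fun s => fwdVar m l (T - s)) (fwdVar m l (T - s) - l) s :=
  ((hasDerivAt_fwdVar (T - s)).comp s ((hasDerivAt_id s).const_sub T)).congr_deriv (by ring)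

/-- As `V' = l - V`, the rate equals `(log V(T - s))' - 1/2`, so the exponential of minus its
integral is explicit. -/
lemma hasDerivAt_revFactor {s : ℝ} (h : fwdVar m l (T - s) ≠ 0) :
    HasDerivAt (revFactor m l T) (-(revRate m l T s * revFactor m l T s)) s := by
  unfold revFactor
  have h1 : HasDerivAt (fun s => Real.exp (s / 2)) (Real.exp (s / 2) / 2) s :=
    ((hasDerivAt_id s).div_const 2).exp.congr_deriv (by simp; ring)
  refine ((h1.mul_const _).div (hasDerivAt_fwdVar_sub s) h).congr_deriv ?_
  rw [revRate]
  field_simp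
  ring

lemma revFactor_zero (h : fwdVar m l T ≠ 0) : revFactor m l T 0 = 1 := by
  simp [revFactor, h]

lemma revContraction_mul_revFactor {t : ℝ} (hT : fwdVar m l T ≠ 0) (ht : fwdVar m l (T - t) ≠ 0) :
    revContraction m l T t * revFactor m l T t = 1 := by
  rw [revContraction, revFactor]
  field_simp
  rw [← Real.exp_add]
  ring_nf
  simp

/-- `V(T - s)` solves the variance equation of the mode, so `V(T - s) ψ(s)²` is a primitive of `l
ψ(s)²`. This identity is the source of exactness. -/
lemma integral_revFactor_sq {t : ℝ} (hm : 0 ≤ m) (hl : 0 < l) (ht : t ∈ Ico 0 T) :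
    ∫ s in (0 : ℝ)..t, l * (revContraction m l T t * revFactor m l T s) ^ 2 =
      fwdVar m l (T - t) - revContraction m l T t ^ 2 * fwdVar m l T := by
  have hpos : ∀ s ∈ Icc 0 t, fwdVar m l (T - s) ≠ 0 := fun s hs =>
    (fwdVar_pos hm hl (by linarith [hs.2, ht.2])).ne'
  have hT : fwdVar m l T ≠ 0 := (fwdVar_pos hm hl (ht.1.trans_lt ht.2)).ne'
  have hd : ∀ s ∈ uIcc 0 t, HasDerivAt
      (fun s => fwdVar m l (T - s) * (revContraction m l T t * revFactor m l T s) ^ 2)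
      (l * (revContraction m l T t * revFactor m l T s) ^ 2) s := by
    intro s hs
    rw [uIcc_of_le ht.1] at hs
    refine ((hasDerivAt_fwdVar_sub s).mul
      (((hasDerivAt_revFactor (hpos s hs)).const_mul _).pow 2)).congr_deriv ?_
    have := hpos s hs
    simp only [revRate, Pi.pow_apply]
    field_simp
    push_cast
    ring
  rw [intervalIntegral.integral_eq_sub_of_hasDerivAt hd, revFactor_zero hT,
    revContraction_mul_revFactor hT (hpos t ⟨ht.1, le_rfl⟩)]
  · simp
    ring
  · refine ContinuousOn.intervalIntegrable ?_
    rw [uIcc_of_le ht.1]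
    have : ContinuousOn (revFactor m l T) (Icc 0 t) := fun s hs =>
      (hasDerivAt_revFactor (hpos s hs)).continuousAt.continuousWithinAt
    exact continuousOn_const.mul ((continuousOn_const.mul this).pow 2)

lemma continuousOn_revRate {s : Set ℝ} (h : ∀ r ∈ s, fwdVar m l (T - r) ≠ 0) :
    ContinuousOn (revRate m l T) s := by
  unfold revRate
  exact continuousOn_const.sub (continuousOn_const.div (Continuous.continuousOn (by fun_prop)) h)

lemma continuousOn_revFactor {s : Set ℝ} (h : ∀ r ∈ s, fwdVar m l (T - r) ≠ 0) :
    ContinuousOn (revFactor m l T) s := fun r hr =>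
  (hasDerivAt_revFactor (h r hr)).continuousAt.continuousWithinAt

/-- Weighted averages of a continuous function against a density that blows up at `T` converge to
the value at `T`. -/
lemma tendsto_mul_integral_deriv_zero {Φ ψ ψ' k : ℝ → ℝ} (hT : 0 < T)
    (hψ : ∀ s ∈ Ico 0 T, HasDerivAt ψ (ψ' s) s) (hψ' : ContinuousOn ψ' (Ico 0 T))
    (hnn : ∀ s ∈ Ico 0 T, 0 ≤ ψ' s) (hψ0 : ∀ s ∈ Ico 0 T, 0 ≤ ψ s)
    (hΦψ : ∀ s ∈ Ico 0 T, Φ s * ψ s = 1) (hΦ : Tendsto Φ (𝓝[<] T) (𝓝 0))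
    (hk : Continuous k) (hk0 : k T = 0) :
    Tendsto (fun t => Φ t * ∫ s in (0 : ℝ)..t, ψ' s * k s) (𝓝[<] T) (𝓝 0) := by
  rw [Metric.tendsto_nhds]
  intro ε hε
  have h1 : ∀ᶠ s in 𝓝 T, |k s| < ε / 2 := by
    have := hk.tendsto T
    rw [hk0, Metric.tendsto_nhds] at this
    simpa using this (ε / 2) (by positivity)
  obtain ⟨δ, hδ, hkδ⟩ := Metric.eventually_nhds_iff.1 h1
  -- Before `t₀` the integral is a fixed number killed by `Φ`; after it `k` is small and the total
  -- weight is controlled by `Φ ψ = 1`.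
  set t₀ := max 0 (T - δ / 2)
  have ht₀ : t₀ ∈ Ico 0 T := ⟨le_max_left _ _, max_lt hT (by linarith)⟩
  set K := |∫ s in (0 : ℝ)..t₀, ψ' s * k s|
  have h2 : ∀ᶠ t in 𝓝[<] T, |Φ t| < ε / 2 / (K + 1) := by
    rw [Metric.tendsto_nhds] at hΦ
    simpa using hΦ (ε / 2 / (K + 1)) (by positivity)
  filter_upwards [h2, Ioo_mem_nhdsLT ht₀.2] with t ht htI
  have htm : t ∈ Ico 0 T := ⟨ht₀.1.trans htI.1.le, htI.2⟩
  have hcont : ∀ a b, 0 ≤ a → a ≤ b → b ≤ t → ∀ f : ℝ → ℝ, ContinuousOn f (Ico 0 T) →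
      IntervalIntegrable f volume a b := fun a b ha hab hb f hf => by
    refine ContinuousOn.intervalIntegrable (hf.mono ?_)
    rw [uIcc_of_le hab]
    exact fun s hs => ⟨ha.trans hs.1, (hs.2.trans hb).trans_lt htI.2⟩
  have hψk : ContinuousOn (fun s => ψ' s * k s) (Ico 0 T) := hψ'.mul hk.continuousOn
  rw [← intervalIntegral.integral_add_adjacent_intervals
    (hcont 0 t₀ le_rfl ht₀.1 htI.1.le _ hψk) (hcont t₀ t ht₀.1 htI.1.le le_rfl _ hψk)]
  have h3 : |∫ s in t₀..t, ψ' s * k s| ≤ ε / 2 * ψ t := by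
    have h4 : |∫ s in t₀..t, ψ' s * k s| ≤ ∫ s in t₀..t, ψ' s * (ε / 2) := by
      rw [← Real.norm_eq_abs]
      refine intervalIntegral.norm_integral_le_of_norm_le htI.1.le (ae_of_all _ fun s hs => ?_)
        (hcont t₀ t ht₀.1 htI.1.le le_rfl _ (hψ'.mul continuousOn_const))
      have hsm : s ∈ Ico 0 T := ⟨ht₀.1.trans hs.1.le, hs.2.trans_lt htI.2⟩
      rw [norm_mul, Real.norm_eq_abs, Real.norm_eq_abs, abs_of_nonneg (hnn s hsm)]
      refine mul_le_mul_of_nonneg_left (hkδ ?_).le (hnn s hsm)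
      have := (le_max_right 0 (T - δ / 2)).trans_lt hs.1
      rw [Real.dist_eq, abs_lt]
      constructor <;> linarith [hsm.2]
    refine h4.trans ?_
    rw [intervalIntegral.integral_mul_const, intervalIntegral.integral_eq_sub_of_hasDerivAt
      (f := ψ) (fun s hs => ?_) (hcont t₀ t ht₀.1 htI.1.le le_rfl _ hψ')]
    · nlinarith [hψ0 t₀ ht₀]
    · rw [uIcc_of_le htI.1.le] at hs
      exact hψ s ⟨ht₀.1.trans hs.1, hs.2.trans_lt htI.2⟩
  have h5 : |Φ t| * ψ t = 1 := by
    rw [← abs_of_nonneg (hψ0 t htm), ← abs_mul, hΦψ t htm, abs_one]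
  rw [dist_zero_right, Real.norm_eq_abs, abs_mul]
  calc |Φ t| * |(∫ s in (0 : ℝ)..t₀, ψ' s * k s) + ∫ s in t₀..t, ψ' s * k s|
      ≤ |Φ t| * (K + ε / 2 * ψ t) := by
        gcongr
        exact (abs_add_le _ _).trans (add_le_add_right h3 _)
    _ = |Φ t| * K + ε / 2 * (|Φ t| * ψ t) := by ring
    _ < ε / 2 + ε / 2 * 1 := by
        rw [h5]
        have : |Φ t| * (K + 1) < ε / 2 := by
          rwa [lt_div_iff₀ (by positivity)] at ht
        nlinarith [abs_nonneg (Φ t)]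
    _ = ε := by ring

/-- Solutions of the mode equation of the reverse-time process have a limit at the terminal time;
it is zero if the terminal variance `m` vanishes. -/
lemma exists_tendsto_revMode (hm : 0 ≤ m) (hl : 0 < l) (hT : 0 < T) {w M : ℝ → ℝ}
    (hM : Continuous M)
    (hw : ∀ t ∈ Ico 0 T, revFactor m l T t * (w t - M t) =
      revFactor m l T 0 * w 0 + ∫ s in (0 : ℝ)..t, revRate m l T s * revFactor m l T s * M s) :
    ∃ wT, Tendsto w (𝓝[<] T) (𝓝 wT) ∧ (m = 0 → wT = 0) := by
  have hVT : fwdVar m l T ≠ 0 := (fwdVar_pos hm hl hT).ne'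
  have hpos : ∀ s ∈ Ico 0 T, fwdVar m l (T - s) ≠ 0 := fun s hs =>
    (fwdVar_pos hm hl (by linarith [hs.2])).ne'
  have hI : ∀ᶠ t in 𝓝[<] T, t ∈ Ico 0 T := by
    filter_upwards [Ioo_mem_nhdsLT hT] with t ht using ⟨ht.1.le, ht.2⟩
  have hΦ : Tendsto (revContraction m l T) (𝓝[<] T) (𝓝 (revContraction m l T T)) :=
    (continuous_revContraction.tendsto T).mono_left nhdsWithin_le_nhds
  have hMT : Tendsto M (𝓝[<] T) (𝓝 (M T)) := (hM.tendsto T).mono_left nhdsWithin_le_nhds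
  have hsol : ∀ t ∈ Ico 0 T, w t = M t + revContraction m l T t * (w 0 +
      ∫ s in (0 : ℝ)..t, revRate m l T s * revFactor m l T s * M s) := fun t ht => by
    have h1 := hw t ht
    have h2 := revContraction_mul_revFactor hVT (hpos t ht)
    rw [revFactor_zero hVT, one_mul] at h1
    rw [← h1, ← mul_assoc, h2]
    ring
  rcases hm.eq_or_lt with rfl | hm'
  · refine ⟨0, ?_, fun _ => rfl⟩
    have hΦT : revContraction 0 l T T = 0 := by simp [revContraction, fwdVar_zero]
    rw [hΦT] at hΦ
    have hrate : ContinuousOn (fun s => -(revRate 0 l T s * revFactor 0 l T s)) (Ico 0 T) :=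
      ((continuousOn_revRate hpos).mul (continuousOn_revFactor hpos)).neg
    have hfac : ∀ s ∈ Ico 0 T, 0 ≤ revFactor 0 l T s := fun s hs => by
      have h1 := fwdVar_pos hm hl (sub_pos.2 hs.2)
      have h2 := fwdVar_pos hm hl hT
      rw [revFactor]
      positivity
    -- For `m = 0` the factor `ψ` blows up at `T`, and integrating `M` against `Φ(t) ψ'` averages it
    -- near `T`. Thus `w` is `M(t)` minus an average of `M`, up to `o(1)`, and both tend to `M T`.
    have key := tendsto_mul_integral_deriv_zero (Φ := revContraction 0 l T)
      (ψ := revFactor 0 l T) (k := fun s => M s - M T) hT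
      (fun s hs => hasDerivAt_revFactor (hpos s hs)) hrate (fun s hs => ?_) hfac
      (fun s hs => revContraction_mul_revFactor hVT (hpos s hs)) hΦ (by fun_prop) (sub_self _)
    · have h1 := ((hMT.sub_const (M T)).add (hΦ.mul_const (w 0 + M T))).sub key
      rw [sub_self, zero_mul, add_zero, sub_zero] at h1
      refine h1.congr' ?_
      filter_upwards [hI] with t ht
      have hsub : uIcc 0 t ⊆ Ico 0 T := by
        rw [uIcc_of_le ht.1]
        exact fun s hs => ⟨hs.1, hs.2.trans_lt ht.2⟩
      have h2 := intervalIntegral.integral_eq_sub_of_hasDerivAt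
        (fun s hs => hasDerivAt_revFactor (hpos s (hsub hs)))
        (hrate.mono hsub).intervalIntegrable
      have h3 : ∫ s in (0 : ℝ)..t, -(revRate 0 l T s * revFactor 0 l T s) * (M s - M T) =
          -(∫ s in (0 : ℝ)..t, revRate 0 l T s * revFactor 0 l T s * M s) -
            (revFactor 0 l T t - 1) * M T := by
        rw [← revFactor_zero hVT, ← h2, ← intervalIntegral.integral_neg,
          ← intervalIntegral.integral_mul_const, ← intervalIntegral.integral_sub]
        · exact intervalIntegral.integral_congr fun s _ => by ring
        · exact ((((continuousOn_revRate hpos).mul (continuousOn_revFactor hpos)).mul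
            hM.continuousOn).neg.mono hsub).intervalIntegrable
        · exact ((hrate.mul continuousOn_const).mono hsub).intervalIntegrable
      have h4 := revContraction_mul_revFactor hVT (hpos t ht)
      rw [hsol t ht, h3]
      linear_combination (M T) * h4
    -- The weight is nonnegative: `V ≤ l` when `m = 0`, so the rate is at most `-1/2`.
    · have h1 := fwdVar_pos hm hl (sub_pos.2 hs.2)
      have h2 : fwdVar 0 l (T - s) ≤ l := by
        rw [fwdVar]
        nlinarith [Real.exp_pos (-(T - s))]
      have h3 : 1 ≤ l / fwdVar 0 l (T - s) := (one_le_div h1).2 h2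
      rw [← neg_mul, revRate]
      exact mul_nonneg (by linarith) (hfac s hs)
  -- For `m > 0` the variance stays positive up to and including `T`, so nothing is singular there.
  · have hpos' : ∀ s ∈ uIcc 0 T, fwdVar m l (T - s) ≠ 0 := fun s hs => by
      rw [uIcc_of_le hT.le] at hs
      rcases hs.2.eq_or_lt with rfl | h
      · rw [sub_self, fwdVar_zero]; exact hm'.ne'
      · exact (fwdVar_pos hm hl (sub_pos.2 h)).ne'
    have hc : ContinuousOn (fun s => revRate m l T s * revFactor m l T s * M s) (uIcc 0 T) :=
      ((continuousOn_revRate hpos').mul (continuousOn_revFactor hpos')).mul hM.continuousOn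
    have hprim := intervalIntegral.continuousOn_primitive_interval (μ := volume) (a := 0) (b := T)
      (hc.integrableOn_compact isCompact_uIcc)
    have hlim : Tendsto (fun t => ∫ s in (0 : ℝ)..t, revRate m l T s * revFactor m l T s * M s)
        (𝓝[<] T) (𝓝 (∫ s in (0 : ℝ)..T, revRate m l T s * revFactor m l T s * M s)) := by
      refine (hprim T right_mem_uIcc).mono_left ?_
      rw [uIcc_of_le hT.le]
      exact nhdsWithin_le_of_mem (by
        filter_upwards [Ioo_mem_nhdsLT hT] with t ht using ⟨ht.1.le, ht.2.le⟩)
    refine ⟨_, (hMT.add (hΦ.mul (hlim.const_add (w 0)))).congr' ?_, fun h => absurd h hm'.ne'⟩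
    filter_upwards [hI] with t ht
    exact (hsol t ht).symm

end ReverseMode

/-! ### Solutions of the reverse-time equation, mode by mode. -/

section Reverse

variable {Ω H : Type*} [MeasurableSpace Ω] [NormedAddCommGroup H] [InnerProductSpace ℝ H]
  [CompleteSpace H] [SecondCountableTopology H] [MeasurableSpace H] [BorelSpace H]
  {v : HilbertBasis ℕ ℝ H} {C : H →L[ℝ] H} {m lam : ℕ → ℝ} {n : ℕ} {P : Measure Ω}
  {S : ℝ → H → (Fin n → ℝ) → H} {y : Fin n → ℝ} {T : ℝ} {Z : ℝ → Ω → H} {N : ℝ≥0 → Ω → H} {a : H}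

/-- The definition of the score imposes no regularity in time on `S`; measurability of the drift is
recovered from its coordinates through partial basis sums. -/
lemma intervalIntegrable_of_inner (v : HilbertBasis ℕ ℝ H) {f : ℝ → H} {t K : ℝ} (ht : 0 ≤ t)
    (hf : ∀ j, ContinuousOn (fun s => inner ℝ (v j) (f s)) (Icc 0 t))
    (hK : ∀ s ∈ Icc 0 t, ‖f s‖ ≤ K) : IntervalIntegrable f volume 0 t := by
  rw [intervalIntegrable_iff_integrableOn_Icc_of_le ht]
  refine ⟨?_, HasFiniteIntegral.of_bounded (C := K) ?_⟩
  · refine aestronglyMeasurable_of_tendsto_ae atTop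
      (f := fun (k : ℕ) s => ∑ j ∈ Finset.range k, inner ℝ (v j) (f s) • v j) (fun k => ?_)
      (ae_of_all _ fun s => (v.hasSum_inner_smul (f s)).tendsto_sum_nat)
    exact ContinuousOn.aestronglyMeasurable
      (continuousOn_finsetSum _ fun j _ => (hf j).smul continuousOn_const) measurableSet_Icc
  · filter_upwards [ae_restrict_mem measurableSet_Icc] with s hs using hK s hs

/-- The modes of the score at data `y` are affine, with posterior mean `a`, posterior variances `m`
and diffusion coefficients `lam`. -/
def HasAffineScore (v : HilbertBasis ℕ ℝ H) (S : ℝ → H → (Fin n → ℝ) → H) (y : Fin n → ℝ)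
    (a : H) (m lam : ℕ → ℝ) : Prop :=
  ∀ u, 0 < u → ∀ x j, inner ℝ (v j) (S u x y) =
    -(lam j / fwdVar (m j) (lam j) u) * inner ℝ (v j) (x - Real.exp (-u / 2) • a)

/-- Mode `j` of the reverse-time process, centred at the conditional mean. -/
noncomputable def revMode (v : HilbertBasis ℕ ℝ H) (a : H) (T : ℝ) (Z : ℝ → Ω → H) (j : ℕ) (t : ℝ)
    (ω : Ω) : ℝ :=
  inner ℝ (v j) (Z t ω - Real.exp (-(T - t) / 2) • a)

/-- The mean `e^{-(T-s)/2} a` solves `z' = z / 2`, so centring removes the affine part of the score.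
-/
lemma revMode_equation (hS : HasAffineScore v S y a m lam) (hm : ∀ j, 0 ≤ m j)
    (hlam : ∀ j, 0 < lam j) (hZ : IsReverseSolution C S y T Z N P) :
    ∀ᵐ ω ∂P, ∀ j, ∀ t ∈ Ico 0 T, revMode v a T Z j t ω = revMode v a T Z j 0 ω +
      (∫ s in (0 : ℝ)..t, revRate (m j) (lam j) T s * revMode v a T Z j s ω) +
      inner ℝ (v j) (N t.toNNReal ω) := by
  filter_upwards [hZ.continuous, hZ.equation] with ω hZc heq j t ht
  have hsub : Icc 0 t ⊆ Ico 0 T := fun s hs => ⟨hs.1, hs.2.trans_lt ht.2⟩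
  have hWc : ContinuousOn (fun s => Z s ω - Real.exp (-(T - s) / 2) • a) (Icc 0 t) :=
    (hZc.mono hsub).sub (Continuous.continuousOn (by fun_prop))
  have hpos : ∀ i, ∀ s ∈ Icc 0 t, fwdVar (m i) (lam i) (T - s) ≠ 0 := fun i s hs =>
    (fwdVar_pos (hm i) (hlam i) (sub_pos.2 (hsub hs).2)).ne'
  have hinner : ∀ i, ∀ s ∈ Icc 0 t,
      inner ℝ (v i) ((1 / 2 : ℝ) • Z s ω + S (T - s) (Z s ω) y) =
        revRate (m i) (lam i) T s * revMode v a T Z i s ω +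
          Real.exp (-(T - s) / 2) / 2 * inner ℝ (v i) a := fun i s hs => by
    rw [inner_add_right, hS _ (sub_pos.2 (hsub hs).2), revRate, revMode, inner_smul_right,
      inner_sub_right, inner_smul_right]
    ring
  have hmode : ∀ i, ContinuousOn
      (fun s => revRate (m i) (lam i) T s * revMode v a T Z i s ω) (Icc 0 t) := fun i =>
    (continuousOn_revRate (hpos i)).mul (continuousOn_const.inner (𝕜 := ℝ) hWc)
  -- Pairing with `v j` commutes with the Bochner integral only if the drift is integrable. The
  -- bound is uniform over modes: `lam i / V_i(T - s) ≤ (1 - e^{-(T-t)})⁻¹` for `s ≤ t`.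
  have hint : IntervalIntegrable (fun s => (1 / 2 : ℝ) • Z s ω + S (T - s) (Z s ω) y)
      volume 0 t := by
    obtain ⟨K₁, hK₁⟩ := isCompact_Icc.exists_bound_of_continuousOn (hZc.mono hsub)
    obtain ⟨K₂, hK₂⟩ := isCompact_Icc.exists_bound_of_continuousOn hWc
    have he : 0 < 1 - Real.exp (-(T - t)) := by
      have := ht.2
      simpa using this
    refine intervalIntegrable_of_inner v ht.1
      (K := 1 / 2 * K₁ + (1 - Real.exp (-(T - t)))⁻¹ * K₂) (fun i => ?_) fun s hs => ?_
    · exact ((hmode i).add (Continuous.continuousOn (by fun_prop))).congr (hinner i)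
    · have hTs := sub_pos.2 (hsub hs).2
      have h1 : ‖S (T - s) (Z s ω) y‖ ≤
          (1 - Real.exp (-(T - t)))⁻¹ * ‖Z s ω - Real.exp (-(T - s) / 2) • a‖ := by
        refine norm_le_of_inner_basis_le v (inv_nonneg.2 he.le) fun i => ?_
        have hV := fwdVar_pos (hm i) (hlam i) hTs
        rw [hS _ hTs, abs_mul, abs_neg, abs_of_pos (div_pos (hlam i) hV)]
        refine mul_le_mul_of_nonneg_right ?_ (abs_nonneg _)
        rw [div_le_iff₀ hV, ← div_eq_inv_mul, le_div_iff₀ he, fwdVar]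
        have h2 : Real.exp (-(T - s)) ≤ Real.exp (-(T - t)) :=
          Real.exp_le_exp.2 (by linarith [hs.2])
        have h3 := mul_nonneg (hm i) (Real.exp_pos (-(T - s))).le
        nlinarith [hlam i]
      refine (norm_add_le _ _).trans (add_le_add ?_ (h1.trans ?_))
      · rw [norm_smul]
        have := hK₁ s hs
        norm_num
        linarith
      · exact mul_le_mul_of_nonneg_left (hK₂ s hs) (inv_nonneg.2 he.le)
  have h1 := (innerSL ℝ (v j)).intervalIntegral_comp_comm hint
  simp only [innerSL_apply_apply] at h1
  have h2 : ∫ s in (0 : ℝ)..t, inner ℝ (v j) ((1 / 2 : ℝ) • Z s ω + S (T - s) (Z s ω) y) =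
      (∫ s in (0 : ℝ)..t, revRate (m j) (lam j) T s * revMode v a T Z j s ω) +
        (Real.exp (-(T - t) / 2) - Real.exp (-(T - 0) / 2)) * inner ℝ (v j) a := by
    have hd : ∀ s ∈ uIcc 0 t, HasDerivAt (fun s => Real.exp (-(T - s) / 2))
        (Real.exp (-(T - s) / 2) / 2) s := fun s _ =>
      (((hasDerivAt_id s).const_sub T).neg.div_const 2).exp.congr_deriv (by simp; ring)
    rw [← intervalIntegral.integral_eq_sub_of_hasDerivAt hd
      (Continuous.intervalIntegrable (by fun_prop) _ _), ← intervalIntegral.integral_mul_const,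
      ← intervalIntegral.integral_add]
    · refine intervalIntegral.integral_congr fun s hs => ?_
      rw [uIcc_of_le ht.1] at hs
      exact hinner j s hs
    · refine ContinuousOn.intervalIntegrable ?_
      rw [uIcc_of_le ht.1]
      exact hmode j
    · exact Continuous.intervalIntegrable (by fun_prop) _ _
  rw [revMode, heq t ht, inner_sub_right, inner_add_right, inner_add_right, ← h1, h2, revMode,
    inner_sub_right, inner_smul_right, inner_smul_right]
  ring

lemma continuousOn_revMode {ω : Ω} (h : ContinuousOn (fun t => Z t ω) (Ico 0 T)) (j : ℕ) :
    ContinuousOn (fun t => revMode v a T Z j t ω) (Ico 0 T) := by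
  unfold revMode
  exact continuousOn_const.inner (𝕜 := ℝ) (h.sub (Continuous.continuousOn (by fun_prop)))

lemma measurable_revMode (hZ : IsReverseSolution C S y T Z N P) {t : ℝ} (ht : t ∈ Ico 0 T) (j : ℕ) :
    Measurable (revMode v a T Z j t) := by
  have := hZ.measurable t ht
  unfold revMode
  fun_prop

lemma revMode_solution (hS : HasAffineScore v S y a m lam) (hm : ∀ j, 0 ≤ m j)
    (hlam : ∀ j, 0 < lam j) (hZ : IsReverseSolution C S y T Z N P) :
    ∀ᵐ ω ∂P, ∀ j, ∀ t ∈ Ico 0 T, revFactor (m j) (lam j) T t *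
        (revMode v a T Z j t ω - inner ℝ (v j) (N t.toNNReal ω)) =
      revFactor (m j) (lam j) T 0 * revMode v a T Z j 0 ω +
        ∫ s in (0 : ℝ)..t, revRate (m j) (lam j) T s * revFactor (m j) (lam j) T s *
          inner ℝ (v j) (N s.toNNReal ω) := by
  filter_upwards [revMode_equation hS hm hlam hZ, hZ.continuous, hZ.wiener.continuous]
    with ω heq hZc hN j t ht
  have hpos : ∀ s ∈ Ico 0 T, fwdVar (m j) (lam j) (T - s) ≠ 0 := fun s hs =>
    (fwdVar_pos (hm j) (hlam j) (sub_pos.2 hs.2)).ne'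
  exact variation_of_constants (continuousOn_revMode hZc j)
    (continuous_const.inner (hN.comp continuous_real_toNNReal)) (continuousOn_revRate hpos)
    (fun s hs => hasDerivAt_revFactor (hpos s hs)) (heq j) ht

variable [IsProbabilityMeasure P]

/-- Joint characteristic function of finitely many modes before the terminal time. -/
lemma integral_expI_revMode (hS : HasAffineScore v S y a m lam) (hm : ∀ j, 0 ≤ m j)
    (hlam : ∀ j, 0 < lam j) (hC : ∀ j, C (v j) = lam j • v j)
    (hZ : IsReverseSolution C S y T Z N P) {t : ℝ} (ht : t ∈ Ico 0 T) (F : Finset ℕ) (c : ℕ → ℝ) :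
    ∫ ω, expI (∑ j ∈ F, c j * revMode v a T Z j t ω) ∂P =
      (∫ ω, expI (∑ j ∈ F, c j * revContraction (m j) (lam j) T t * revMode v a T Z j 0 ω) ∂P) *
        gaussExp 0 (∑ j ∈ F, c j ^ 2 * (fwdVar (m j) (lam j) (T - t) -
          revContraction (m j) (lam j) T t ^ 2 * fwdVar (m j) (lam j) T)) := by
  have hT : 0 < T := ht.1.trans_lt ht.2
  have hVT : ∀ j, fwdVar (m j) (lam j) T ≠ 0 := fun j => (fwdVar_pos (hm j) (hlam j) hT).ne'
  have hpos : ∀ j, ∀ s ∈ Icc 0 t, fwdVar (m j) (lam j) (T - s) ≠ 0 := fun j s hs =>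
    (fwdVar_pos (hm j) (hlam j) (by linarith [hs.2, ht.2])).ne'
  -- The kernel `ψ(s) / ψ(t)`, equal to `1` at `s = t`, so that the boundary term of the Wiener
  -- integral is the value of the noise at `t`.
  set b : ℕ → ℝ → ℝ := fun j s => revContraction (m j) (lam j) T t * revFactor (m j) (lam j) T s
    with hb
  set b' : ℕ → ℝ → ℝ := fun j s => revContraction (m j) (lam j) T t *
    -(revRate (m j) (lam j) T s * revFactor (m j) (lam j) T s) with hb'
  set g : ℝ → H := fun s => ∑ j ∈ F, (c j * b j s) • v j with hg
  set g' : ℝ → H := fun s => ∑ j ∈ F, (c j * b' j s) • v j with hg'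
  have hbt : ∀ j, b j t = 1 := fun j =>
    revContraction_mul_revFactor (hVT j) (hpos j t ⟨ht.1, le_rfl⟩)
  have hbd : ∀ j, ∀ s ∈ Icc 0 t, HasDerivAt (b j) (b' j s) s := fun j s hs =>
    (hasDerivAt_revFactor (hpos j s hs)).const_mul _
  have hb'c : ∀ j, ContinuousOn (b' j) (Icc 0 t) := fun j => continuousOn_const.mul
    ((continuousOn_revRate (hpos j)).mul (continuousOn_revFactor (hpos j))).neg
  have hbc : ∀ j, ContinuousOn (b j) (Icc 0 t) := fun j s hs =>
    (hbd j s hs).continuousAt.continuousWithinAt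
  have hder : ∀ s ∈ Icc 0 t, HasDerivAt g (g' s) s := fun s hs =>
    HasDerivAt.fun_sum fun j _ => ((hbd j s hs).const_mul _).smul_const _
  have hg'c : ContinuousOn g' (Icc 0 t) := continuousOn_finsetSum _ fun j _ =>
    (continuousOn_const.mul (hb'c j)).smul continuousOn_const
  have hvar : ∫ s in (0 : ℝ)..t, inner ℝ (g s) (C (g s)) =
      ∑ j ∈ F, c j ^ 2 * (fwdVar (m j) (lam j) (T - t) -
        revContraction (m j) (lam j) T t ^ 2 * fwdVar (m j) (lam j) T) := by
    -- Since `C` is diagonal, no cross terms between modes appear.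
    have h1 : ∀ s, inner ℝ (g s) (C (g s)) = ∑ j ∈ F, c j ^ 2 * (lam j * b j s ^ 2) := fun s => by
      simp only [hg, map_sum, map_smul, hC, sum_inner, inner_sum, inner_smul_left,
        inner_smul_right, v.inner_eq_ite, conj_trivial]
      refine Finset.sum_congr rfl fun j hj => ?_
      rw [Finset.sum_eq_single j]
      · simp only [if_true]; ring
      · intro i _ hij
        simp [hij]
      · exact fun h => absurd hj h
    simp only [h1]
    rw [intervalIntegral.integral_finsetSum]
    · refine Finset.sum_congr rfl fun j _ => ?_
      rw [intervalIntegral.integral_const_mul, integral_revFactor_sq (hm j) (hlam j) ht]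
    · intro j _
      refine ContinuousOn.intervalIntegrable ?_
      rw [uIcc_of_le ht.1]
      exact continuousOn_const.mul (continuousOn_const.mul ((hbc j).pow 2))
  have h0m : Measurable (Z 0) := hZ.measurable 0 ⟨le_rfl, hT⟩
  have key := integral_mul_expI_wienerIntegral hZ.wiener (inner_diagonal_nonneg hC hlam) ht.1 hder
    hg'c (F := fun ω => expI (∑ j ∈ F, c j * revContraction (m j) (lam j) T t *
      revMode v a T Z j 0 ω)) ?_ (fun ω => (norm_expI _).le) ?_
  · rw [hvar] at key
    rw [← key]
    refine integral_congr_ae ?_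
    filter_upwards [revMode_solution hS hm hlam hZ, hZ.wiener.continuous] with ω hω hN
    rw [← expI_add]
    congr 1
    have hint : ∀ j, IntervalIntegrable (fun s => c j * b' j s * inner ℝ (v j) (N s.toNNReal ω))
        volume 0 t := fun j => by
      refine ContinuousOn.intervalIntegrable ?_
      rw [uIcc_of_le ht.1]
      exact (continuousOn_const.mul (hb'c j)).mul (Continuous.continuousOn
        (continuous_const.inner (hN.comp continuous_real_toNNReal)))
    have h2 : wienerIntegral g g' t (fun s => N s ω) = ∑ j ∈ F,
        (c j * inner ℝ (v j) (N t.toNNReal ω) -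
          ∫ s in (0 : ℝ)..t, c j * b' j s * inner ℝ (v j) (N s.toNNReal ω)) := by
      rw [wienerIntegral, Finset.sum_sub_distrib]
      simp only [hg, hg', sum_inner, inner_smul_left, conj_trivial, hbt, mul_one]
      rw [intervalIntegral.integral_finsetSum fun j _ => hint j]
    rw [h2, ← Finset.sum_add_distrib]
    refine Finset.sum_congr rfl fun j _ => ?_
    have h3 := hω j t ht
    rw [revFactor_zero (hVT j), one_mul] at h3
    have h4 : ∫ s in (0 : ℝ)..t, c j * b' j s * inner ℝ (v j) (N s.toNNReal ω) =
        -(c j * revContraction (m j) (lam j) T t) * ∫ s in (0 : ℝ)..t,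
          revRate (m j) (lam j) T s * revFactor (m j) (lam j) T s *
            inner ℝ (v j) (N s.toNNReal ω) := by
      rw [← intervalIntegral.integral_const_mul]
      exact intervalIntegral.integral_congr fun s _ => by simp only [hb']; ring
    rw [h4]
    have h5 : revContraction (m j) (lam j) T t * revFactor (m j) (lam j) T t = 1 := hbt j
    linear_combination (c j * revContraction (m j) (lam j) T t) * h3 -
      c j * (revMode v a T Z j t ω - inner ℝ (v j) (N t.toNNReal ω)) * h5
  · have := fun j => measurable_revMode (v := v) (a := a) hZ ⟨le_rfl, hT⟩ j
    exact (measurable_expI.comp (by fun_prop)).aestronglyMeasurable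
  · exact UncorrelatedWithPath.of_indepFun hZ.indep h0m.aemeasurable hZ.wiener.measurable
      (f := fun z => expI (∑ j ∈ F, c j * revContraction (m j) (lam j) T t *
        inner ℝ (v j) (z - Real.exp (-(T - 0) / 2) • a))) (by fun_prop)

/-- All modes have a limit at the terminal time, which vanishes if the terminal variance does. -/
lemma exists_revMode_terminal (hS : HasAffineScore v S y a m lam) (hm : ∀ j, 0 ≤ m j)
    (hlam : ∀ j, 0 < lam j) (hT : 0 < T) (hZ : IsReverseSolution C S y T Z N P) :
    ∃ wT : ℕ → Ω → ℝ, (∀ j, AEMeasurable (wT j) P) ∧ ∀ᵐ ω ∂P, ∀ j,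
      Tendsto (fun t => revMode v a T Z j t ω) (𝓝[<] T) (𝓝 (wT j ω)) ∧ (m j = 0 → wT j ω = 0) := by
  have hlim : ∀ᵐ ω ∂P, ∀ j, Tendsto (fun t => revMode v a T Z j t ω) (𝓝[<] T)
      (𝓝 (limUnder (𝓝[<] T) fun t => revMode v a T Z j t ω)) ∧
      (m j = 0 → limUnder (𝓝[<] T) (fun t => revMode v a T Z j t ω) = 0) := by
    filter_upwards [revMode_solution hS hm hlam hZ, hZ.wiener.continuous] with ω hω hN j
    obtain ⟨ℓ, h1, h2⟩ := exists_tendsto_revMode (hm j) (hlam j) hT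
      (w := fun t => revMode v a T Z j t ω)
      (M := fun t => inner ℝ (v j) (N t.toNNReal ω))
      (continuous_const.inner (hN.comp continuous_real_toNNReal)) (hω j)
    rw [h1.limUnder_eq]
    exact ⟨h1, h2⟩
  -- `limUnder` is arbitrary off the convergence set, which is conull; measurability comes from a
  -- sequence of times increasing to `T`.
  refine ⟨fun j ω => limUnder (𝓝[<] T) fun t => revMode v a T Z j t ω, fun j => ?_, hlim⟩
  obtain ⟨u, -, hu, hut⟩ := exists_seq_strictMono_tendsto' hT
  refine aemeasurable_of_tendsto_metrizable_ae atTop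
    (f := fun k => revMode v a T Z j (u k))
    (fun k => (measurable_revMode hZ ⟨(hu k).1.le, (hu k).2⟩ j).aemeasurable) ?_
  filter_upwards [hlim] with ω hω
  exact (hω j).1.comp (tendsto_nhdsWithin_iff.2 ⟨hut, Eventually.of_forall fun k => (hu k).2⟩)

/-- Joint characteristic function of finitely many modes at the terminal time. -/
lemma integral_expI_revMode_terminal (hS : HasAffineScore v S y a m lam) (hm : ∀ j, 0 ≤ m j)
    (hlam : ∀ j, 0 < lam j) (hC : ∀ j, C (v j) = lam j • v j) (hT : 0 < T)
    (hZ : IsReverseSolution C S y T Z N P) {wT : ℕ → Ω → ℝ}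
    (hwT : ∀ᵐ ω ∂P, ∀ j, Tendsto (fun t => revMode v a T Z j t ω) (𝓝[<] T) (𝓝 (wT j ω)))
    (F : Finset ℕ) (c : ℕ → ℝ) :
    ∫ ω, expI (∑ j ∈ F, c j * wT j ω) ∂P =
      (∫ ω, expI (∑ j ∈ F, c j * revContraction (m j) (lam j) T T * revMode v a T Z j 0 ω) ∂P) *
        gaussExp 0 (∑ j ∈ F, c j ^ 2 * (m j -
          revContraction (m j) (lam j) T T ^ 2 * fwdVar (m j) (lam j) T)) := by
  have hI : ∀ᶠ t in 𝓝[<] T, t ∈ Ico 0 T := by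
    filter_upwards [Ioo_mem_nhdsLT hT] with t ht using ⟨ht.1.le, ht.2⟩
  have hmeas : ∀ t ∈ Ico 0 T, ∀ j, Measurable (revMode v a T Z j t) := fun t ht j =>
    measurable_revMode hZ ht j
  have h0 := hmeas 0 ⟨le_rfl, hT⟩
  have h1 : Tendsto (fun t => ∫ ω, expI (∑ j ∈ F, c j * revMode v a T Z j t ω) ∂P) (𝓝[<] T)
      (𝓝 (∫ ω, expI (∑ j ∈ F, c j * wT j ω) ∂P)) := by
    refine tendsto_integral_filter_of_dominated_convergence (fun _ => 1) ?_
      (Eventually.of_forall fun t => ae_of_all _ fun ω => (norm_expI _).le) (integrable_const _) ?_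
    · filter_upwards [hI] with t ht
      have := hmeas t ht
      exact (measurable_expI.comp (by fun_prop)).aestronglyMeasurable
    · filter_upwards [hwT] with ω hω
      exact (continuous_expI.tendsto _).comp (tendsto_finsetSum _ fun j _ => (hω j).const_mul _)
  have hΦ : ∀ j, Tendsto (revContraction (m j) (lam j) T) (𝓝[<] T)
      (𝓝 (revContraction (m j) (lam j) T T)) := fun j =>
    (continuous_revContraction.tendsto T).mono_left nhdsWithin_le_nhds
  have h2 : Tendsto (fun t => ∫ ω, expI (∑ j ∈ F, c j * revContraction (m j) (lam j) T t *
      revMode v a T Z j 0 ω) ∂P) (𝓝[<] T) (𝓝 (∫ ω, expI (∑ j ∈ F, c j *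
        revContraction (m j) (lam j) T T * revMode v a T Z j 0 ω) ∂P)) := by
    refine tendsto_integral_filter_of_dominated_convergence (fun _ => 1)
      (Eventually.of_forall fun t => (measurable_expI.comp (by fun_prop)).aestronglyMeasurable)
      (Eventually.of_forall fun t => ae_of_all _ fun ω => (norm_expI _).le) (integrable_const _)
      (ae_of_all _ fun ω => ?_)
    exact (continuous_expI.tendsto _).comp
      (tendsto_finsetSum _ fun j _ => ((hΦ j).const_mul _).mul_const _)
  have h3 : Tendsto (fun t => ∑ j ∈ F, c j ^ 2 * (fwdVar (m j) (lam j) (T - t) -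
      revContraction (m j) (lam j) T t ^ 2 * fwdVar (m j) (lam j) T)) (𝓝[<] T)
      (𝓝 (∑ j ∈ F, c j ^ 2 * (m j -
        revContraction (m j) (lam j) T T ^ 2 * fwdVar (m j) (lam j) T))) := by
    refine tendsto_finsetSum _ fun j _ => Tendsto.const_mul _ (Tendsto.sub ?_
      (((hΦ j).pow 2).mul_const _))
    have h4 : Tendsto (fun t => fwdVar (m j) (lam j) (T - t)) (𝓝 T)
        (𝓝 (fwdVar (m j) (lam j) (T - T))) :=
      (by fun_prop : Continuous fun t => fwdVar (m j) (lam j) (T - t)).tendsto T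
    rw [sub_self, fwdVar_zero] at h4
    exact h4.mono_left nhdsWithin_le_nhds
  have h5 : Tendsto (fun V => gaussExp 0 V) (𝓝 (∑ j ∈ F, c j ^ 2 * (m j -
        revContraction (m j) (lam j) T T ^ 2 * fwdVar (m j) (lam j) T))) (𝓝 _) :=
    (continuous_gaussExp.comp (by fun_prop : Continuous fun V : ℝ => ((0 : ℝ), V))).tendsto _
  refine tendsto_nhds_unique h1 ((h2.mul (h5.comp h3)).congr' ?_)
  filter_upwards [hI] with t ht
  exact (integral_expI_revMode hS hm hlam hC hZ ht F c).symm

/-- Exact reversal of a finite family of modes. -/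
lemma integral_expI_revMode_exact (hS : HasAffineScore v S y a m lam) (hm : ∀ j, 0 ≤ m j)
    (hlam : ∀ j, 0 < lam j) (hC : ∀ j, C (v j) = lam j • v j) (hT : 0 < T)
    (hZ : IsReverseSolution C S y T Z N P) {F : Finset ℕ}
    (h0 : ∀ c : ℕ → ℝ, ∫ ω, expI (∑ j ∈ F, c j * revMode v a T Z j 0 ω) ∂P =
      gaussExp 0 (∑ j ∈ F, c j ^ 2 * fwdVar (m j) (lam j) T)) (c : ℕ → ℝ) :
    (∀ t ∈ Ico 0 T, ∫ ω, expI (∑ j ∈ F, c j * revMode v a T Z j t ω) ∂P =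
      gaussExp 0 (∑ j ∈ F, c j ^ 2 * fwdVar (m j) (lam j) (T - t))) ∧
    ∀ wT : ℕ → Ω → ℝ,
      (∀ᵐ ω ∂P, ∀ j, Tendsto (fun t => revMode v a T Z j t ω) (𝓝[<] T) (𝓝 (wT j ω))) →
      ∫ ω, expI (∑ j ∈ F, c j * wT j ω) ∂P = gaussExp 0 (∑ j ∈ F, c j ^ 2 * m j) := by
  refine ⟨fun t ht => ?_, fun wT hwT => ?_⟩
  · rw [integral_expI_revMode hS hm hlam hC hZ ht, h0, ← gaussExp_add, ← Finset.sum_add_distrib,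
      add_zero]
    congr 1
    exact Finset.sum_congr rfl fun j _ => by ring
  · rw [integral_expI_revMode_terminal hS hm hlam hC hT hZ hwT, h0, ← gaussExp_add,
      ← Finset.sum_add_distrib, add_zero]
    congr 1
    exact Finset.sum_congr rfl fun j _ => by ring

/-- Real variables with centred Gaussian laws of summable variances are the coordinates of an
`H`-valued random variable. -/
lemma exists_randomVariable_of_coordinates (v : HilbertBasis ℕ ℝ H) (hm : ∀ j, 0 ≤ m j)
    (hms : Summable m) {w : ℕ → Ω → ℝ}
    (hw : ∀ j, HasLaw (w j) (gaussianReal 0 (m j).toNNReal) P) :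
    ∃ W : Ω → H, AEMeasurable W P ∧ ∀ᵐ ω ∂P, ∀ j, inner ℝ (v j) (W ω) = w j ω := by
  have hsq : ∀ j, ∫⁻ ω, ENNReal.ofReal (w j ω ^ 2) ∂P = ENNReal.ofReal (m j) := fun j => by
    have hL : MemLp (w j) 2 P := (hw j).hasGaussianLaw.memLp_two
    rw [← ofReal_integral_eq_lintegral_ofReal hL.integrable_sq (ae_of_all _ fun ω => sq_nonneg _)]
    congr 1
    have h1 : P[w j] = 0 := by rw [(hw j).integral_eq, integral_id_gaussianReal]
    have h2 : Var[w j; P] = m j := by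
      rw [(hw j).variance_eq, variance_id_gaussianReal, Real.coe_toNNReal _ (hm j)]
    rw [← h2, variance_of_integral_eq_zero (hw j).aemeasurable h1]
  -- The expected sum of squares is `∑ m j < ∞`, so almost every sequence of coordinates is
  -- square-summable, whatever their dependence.
  have hfin : ∀ᵐ ω ∂P, ∑' j, ENNReal.ofReal (w j ω ^ 2) < ⊤ := by
    refine ae_lt_top' (AEMeasurable.tsum fun j =>
      ((hw j).aemeasurable.pow_const 2).ennreal_ofReal) ?_
    rw [lintegral_tsum fun j => ((hw j).aemeasurable.pow_const 2).ennreal_ofReal]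
    simp only [hsq]
    rw [← ENNReal.ofReal_tsum_of_nonneg hm hms]
    exact ENNReal.ofReal_ne_top
  have hsum : ∀ᵐ ω ∂P, ∃ x : H, HasSum (fun j => w j ω • v j) x := by
    filter_upwards [hfin] with ω hω
    have h1 : Summable fun j => w j ω ^ 2 := by
      have := ENNReal.summable_toReal hω.ne
      simpa only [ENNReal.toReal_ofReal (sq_nonneg _)] using this
    have h2 : Memℓp (fun j => w j ω) 2 := by
      refine (memℓp_gen_iff (by norm_num)).2 ?_
      simpa using h1
    exact ⟨_, v.hasSum_repr_symm ⟨_, h2⟩⟩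
  refine ⟨fun ω => ∑' j, w j ω • v j, ?_, ?_⟩
  · refine aemeasurable_of_tendsto_metrizable_ae atTop
      (f := fun (k : ℕ) ω => ∑ j ∈ Finset.range k, w j ω • v j) (fun k => ?_) ?_
    · have := fun j => (hw j).aemeasurable
      exact Finset.aemeasurable_fun_sum _ fun j _ => (this j).smul_const _
    · filter_upwards [hsum] with ω ⟨x, hx⟩
      rw [hx.tsum_eq]
      exact hx.tendsto_sum_nat
  · filter_upwards [hsum] with ω ⟨x, hx⟩ j
    rw [hx.tsum_eq]
    have h1 := hx.mapL (innerSL ℝ (v j))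
    refine h1.unique ?_
    refine (hasSum_ite_eq j (w j ω)).congr_fun fun k => ?_
    simp only [map_smul, innerSL_apply_apply, v.inner_eq_ite, smul_eq_mul, eq_comm (a := j)]
    split_ifs with h <;> simp [h]

end Reverse

/-! ### Exponential convergence and weak limits. -/

section Convergence

variable {p q : ℝ}

/-- With `b = p (1 + q)` and `k = min 1 b`, `1 + b (e^T - 1) ≥ k + k (e^T - 1)`. -/
lemma modeDenom_lower (hp : 0 < p) (hq : 0 ≤ q) {T : ℝ} (hT : 0 ≤ T) :
    min 1 (p * (1 + q)) * Real.exp T ≤ modeDenom p q T := by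
  have hb : 0 < p * (1 + q) := by positivity
  have hE : 1 ≤ Real.exp T := Real.one_le_exp hT
  rw [modeDenom, mul_assoc]
  rcases le_total 1 (p * (1 + q)) with h | h
  · rw [min_eq_left h]
    nlinarith
  · rw [min_eq_right h]
    nlinarith

lemma exists_terminal_bound (hp : 0 < p) (hq : 0 ≤ q) {m V₀ : ℝ} (hm : 0 ≤ m) (hV₀ : 0 ≤ V₀)
    (y z₀ : ℝ) : ∃ K : ℝ, ∀ T : ℝ, 0 < T →
      |terminalMean p q y z₀ T - y * q / (1 + q)| ≤ K * Real.exp (-T / 2) ∧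
      |terminalVar m p q V₀ T - m / (1 + q)| ≤ K * Real.exp (-T) := by
  set k := min 1 (p * (1 + q)) with hk
  have hk0 : 0 < k := lt_min one_pos (by positivity)
  set w := y * q / (1 + q)
  set r := m / (1 + q)
  have hr : 0 ≤ r := by positivity
  -- One constant for both bounds: the first summand serves the mean, the bracket the variance.
  refine ⟨(|z₀| + |w|) / k + (V₀ / k ^ 2 + r / k), fun T hT => ?_⟩
  have hD := modeDenom_lower hp hq hT.le
  rw [← hk] at hD
  have hkE : 0 < k * Real.exp T := by positivity
  have hD0 := hkE.trans_le hD
  have hE1 : 1 ≤ Real.exp (T / 2) := Real.one_le_exp (by positivity)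
  have hEE : Real.exp T = Real.exp (T / 2) ^ 2 := by
    rw [← Real.exp_nat_mul]; congr 1; push_cast; ring
  have hn1 : Real.exp (-T / 2) = (Real.exp (T / 2))⁻¹ := by rw [← Real.exp_neg]; ring_nf
  have hn2 : Real.exp (-T) = (Real.exp T)⁻¹ := Real.exp_neg T
  constructor
  · have h1 : terminalMean p q y z₀ T - w =
        (z₀ * Real.exp (T / 2) - w) / modeDenom p q T := by
      simp only [terminalMean]
      change z₀ * Real.exp (T / 2) / modeDenom p q T + w * (1 - 1 / modeDenom p q T) - w = _
      ring
    rw [h1, abs_div, abs_of_pos hD0]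
    have h2 : |z₀ * Real.exp (T / 2) - w| ≤ (|z₀| + |w|) * Real.exp (T / 2) := by
      refine (abs_sub _ _).trans ?_
      rw [abs_mul, abs_of_pos (Real.exp_pos _)]
      nlinarith [abs_nonneg w]
    calc _ ≤ (|z₀| + |w|) * Real.exp (T / 2) / (k * Real.exp T) := by gcongr
      _ = (|z₀| + |w|) / k * Real.exp (-T / 2) := by
        rw [hn1, hEE]
        field_simp
      _ ≤ _ := by
        gcongr
        exact le_add_of_nonneg_right (by positivity)
  · have h1 : terminalVar m p q V₀ T - r =
        V₀ * (Real.exp T / modeDenom p q T ^ 2) - r / modeDenom p q T := by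
      simp only [terminalVar]
      change _ + r * (1 - 1 / modeDenom p q T) - r = _
      ring
    rw [h1]
    have h2 : V₀ * (Real.exp T / modeDenom p q T ^ 2) ≤ V₀ / k ^ 2 * Real.exp (-T) := by
      calc _ ≤ V₀ * (Real.exp T / (k * Real.exp T) ^ 2) := by gcongr
        _ = _ := by rw [hn2]; field_simp
    have h3 : r / modeDenom p q T ≤ r / k * Real.exp (-T) := by
      calc _ ≤ r / (k * Real.exp T) := by gcongr
        _ = _ := by rw [hn2]; field_simp
    refine (abs_sub _ _).trans ?_
    rw [abs_of_nonneg (by positivity), abs_of_nonneg (by positivity)]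
    have h4 : 0 ≤ (|z₀| + |w|) / k * Real.exp (-T) := by positivity
    nlinarith

lemma charFun_gaussianPM (b : ℝ) (W : ℝ≥0) (t : ℝ) :
    charFun (gaussianPM b W : Measure ℝ) t =
      Complex.exp (t * b * Complex.I - (W : ℝ) * t ^ 2 / 2) :=
  charFun_gaussianReal t

lemma tendsto_charFun_gaussianPM {ι : Type*} {L : Filter ι} {f : ι → ℝ} {V : ι → ℝ≥0} {b : ℝ}
    {W : ℝ≥0} (hf : Tendsto f L (𝓝 b)) (hV : Tendsto V L (𝓝 W)) (t : ℝ) :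
    Tendsto (fun i => charFun (gaussianPM (f i) (V i) : Measure ℝ) t) L
      (𝓝 (charFun (gaussianPM b W : Measure ℝ) t)) := by
  have h1 : Continuous fun z : ℝ × ℝ =>
      Complex.exp (t * z.1 * Complex.I - z.2 * t ^ 2 / 2) := by fun_prop
  have h2 := (h1.tendsto (b, (W : ℝ))).comp
    (hf.prodMk_nhds ((NNReal.continuous_coe.tendsto W).comp hV))
  rw [charFun_gaussianPM]
  refine h2.congr fun k => ?_
  rw [charFun_gaussianPM]
  rfl

/-- Lévy's continuity theorem along sequences, which suffice for a countably generated filter. -/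
lemma tendsto_gaussianPM {ι : Type*} {L : Filter ι} [L.IsCountablyGenerated] {f : ι → ℝ}
    {V : ι → ℝ≥0} {b : ℝ} {W : ℝ≥0} (hf : Tendsto f L (𝓝 b)) (hV : Tendsto V L (𝓝 W)) :
    Tendsto (fun i => gaussianPM (f i) (V i)) L (𝓝 (gaussianPM b W)) :=
  tendsto_of_seq_tendsto fun _ hu => ProbabilityMeasure.tendsto_of_tendsto_charFun fun t =>
    tendsto_charFun_gaussianPM (hf.comp hu) (hV.comp hu) t

lemma tendsto_of_abs_sub_le_exp {f : ℝ → ℝ} {b K r : ℝ} (hr : 0 < r)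
    (h : ∀ T, 0 < T → |f T - b| ≤ K * Real.exp (-T / r)) : Tendsto f atTop (𝓝 b) := by
  rw [tendsto_iff_dist_tendsto_zero]
  have h1 : Tendsto (fun T : ℝ => K * Real.exp (-T / r)) atTop (𝓝 0) := by
    have h2 : Tendsto (fun T : ℝ => T / r) atTop atTop := tendsto_id.atTop_div_const hr
    have h3 := (Real.tendsto_exp_neg_atTop_nhds_zero.comp h2).const_mul K
    simpa [Function.comp_def, neg_div] using h3
  refine squeeze_zero' (Eventually.of_forall fun _ => dist_nonneg) ?_ h1
  filter_upwards [eventually_gt_atTop 0] with T hT using h T hT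

end Convergence

/-! ### Translation between posterior weights and the parameters `p`, `q`. -/

section Parameters

variable {n : ℕ} {μ lam : ℕ → ℝ} {σB : ℝ} {η : Fin n → ℕ} {j : ℕ}

lemma modeQ_nonneg (hμ : ∀ j, 0 < μ j) : 0 ≤ modeQ μ σB η j := by
  unfold modeQ
  split_ifs
  · exact div_nonneg (hμ j).le (sq_nonneg _)
  · exact le_rfl

lemma obsWeight_eq_modeQ (hμ : ∀ j, 0 < μ j) (h : 0 < σB ∨ j ∉ range η) :
    obsWeight μ σB η j = modeQ μ σB η j / (1 + modeQ μ σB η j) := by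
  unfold obsWeight modeQ
  split_ifs with hj
  · have hσ := h.resolve_right (not_not.2 hj)
    have := hμ j
    field_simp
    ring
  · simp

lemma postVar_eq_modeQ (hμ : ∀ j, 0 < μ j) (h : 0 < σB ∨ j ∉ range η) :
    postVar μ σB η j = μ j / (1 + modeQ μ σB η j) := by
  have hq : 0 < 1 + modeQ μ σB η j := by linarith [modeQ_nonneg (σB := σB) (η := η) (j := j) hμ]
  rw [postVar, obsWeight_eq_modeQ hμ h]
  field_simp
  ring

lemma obsWeight_of_noiseless (hμ : ∀ j, 0 < μ j) (hσ : σB = 0) (hj : j ∈ range η) :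
    obsWeight μ σB η j = 1 := by
  simp only [obsWeight, if_pos hj, hσ]
  have := (hμ j).ne'
  simp [this]

lemma postVar_of_noiseless (hμ : ∀ j, 0 < μ j) (hσ : σB = 0) (hj : j ∈ range η) :
    postVar μ σB η j = 0 := by
  rw [postVar, obsWeight_of_noiseless hμ hσ hj, sub_self, mul_zero]

/-- The denominator is a rescaled forward variance: `D(T) = e^T V(T) / m` with `m = b / (1 + q)`. -/
lemma revContraction_terminal {p q l b T : ℝ} (hb : 0 < b) (hq : 0 ≤ q) (hl : 0 < l) (hT : 0 < T)
    (hp : p = l / b) :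
    revContraction (b / (1 + q)) l T T = Real.exp (T / 2) / modeDenom p q T := by
  have hq1 : 0 < 1 + q := by linarith
  have hm : 0 < b / (1 + q) := by positivity
  have hV := fwdVar_pos hm.le hl hT
  have hD : modeDenom p q T = Real.exp T * fwdVar (b / (1 + q)) l T / (b / (1 + q)) := by
    rw [modeDenom, fwdVar, hp, Real.exp_neg]
    field_simp
  rw [hD, revContraction, sub_self, fwdVar_zero]
  have h1 : Real.exp (-T / 2) = Real.exp (T / 2) / Real.exp T := by
    rw [← Real.exp_sub]; ring_nf
  rw [h1]
  field_simp

lemma terminalMean_eq {p q l b T : ℝ} (hb : 0 < b) (hq : 0 ≤ q) (hl : 0 < l) (hT : 0 < T)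
    (hp : p = l / b) (y z₀ : ℝ) :
    terminalMean p q y z₀ T = q / (1 + q) * y + revContraction (b / (1 + q)) l T T *
      (z₀ - Real.exp (-T / 2) * (q / (1 + q) * y)) := by
  rw [revContraction_terminal hb hq hl hT hp, terminalMean]
  have h1 : Real.exp (T / 2) * Real.exp (-T / 2) = 1 := by rw [← Real.exp_add]; ring_nf; simp
  linear_combination (1 / modeDenom p q T * (q / (1 + q) * y)) * h1

lemma terminalVar_eq {p q l b T : ℝ} (hb : 0 < b) (hq : 0 ≤ q) (hl : 0 < l) (hT : 0 < T)
    (hp : p = l / b) (V₀ : ℝ) :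
    terminalVar b p q V₀ T = revContraction (b / (1 + q)) l T T ^ 2 * V₀ + (b / (1 + q) -
      revContraction (b / (1 + q)) l T T ^ 2 * fwdVar (b / (1 + q)) l T) := by
  have hq1 : 0 < 1 + q := by linarith
  have hm : 0 < b / (1 + q) := by positivity
  have hV := fwdVar_pos hm.le hl hT
  have hD0 : 0 < modeDenom p q T := by
    have hE : 1 < Real.exp T := by simpa using hT
    have hp0 : 0 < p := by rw [hp]; positivity
    have := mul_pos (mul_pos (sub_pos.2 hE) hp0) hq1
    rw [modeDenom]
    linarith
  have hc : revContraction (b / (1 + q)) l T T * fwdVar (b / (1 + q)) l T =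
      Real.exp (-T / 2) * (b / (1 + q)) := by
    rw [revContraction, sub_self, fwdVar_zero]
    field_simp
  have h1 : Real.exp (T / 2) * Real.exp (-T / 2) = 1 := by rw [← Real.exp_add]; ring_nf; simp
  have h2 : Real.exp T = Real.exp (T / 2) ^ 2 := by
    rw [← Real.exp_nat_mul]; congr 1; push_cast; ring
  rw [sq, mul_assoc (revContraction _ _ _ _) _ (fwdVar _ _ _), hc,
    revContraction_terminal hb hq hl hT hp, terminalVar, h2]
  linear_combination (1 / modeDenom p q T * (b / (1 + q))) * h1

end Parameters

/-! ### From characteristic functions back to laws of modes and of `H`-valued variables. -/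

section Assembly

variable {Ω H : Type*} [MeasurableSpace Ω] [NormedAddCommGroup H] [InnerProductSpace ℝ H]
  [CompleteSpace H] [SecondCountableTopology H] [MeasurableSpace H] [BorelSpace H]
  {v : HilbertBasis ℕ ℝ H} {C : H →L[ℝ] H} {m lam : ℕ → ℝ} {n : ℕ} {P : Measure Ω}
  {S : ℝ → H → (Fin n → ℝ) → H} {y : Fin n → ℝ} {T : ℝ} {Z : ℝ → Ω → H} {N : ℝ≥0 → Ω → H} {a : H}

lemma inner_finset_sum_smul (v : HilbertBasis ℕ ℝ H) (F : Finset ℕ) (c : ℕ → ℝ) (x : H) :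
    inner ℝ (∑ j ∈ F, c j • v j) x = ∑ j ∈ F, c j * inner ℝ (v j) x := by
  simp [sum_inner, inner_smul_left]

lemma tsum_mul_inner_sq (v : HilbertBasis ℕ ℝ H) (V : ℕ → ℝ) (F : Finset ℕ) (c : ℕ → ℝ) :
    ∑' j, V j * inner ℝ (v j) (∑ i ∈ F, c i • v i) ^ 2 = ∑ j ∈ F, c j ^ 2 * V j := by
  have h : ∀ j, inner ℝ (v j) (∑ i ∈ F, c i • v i) = if j ∈ F then c j else 0 := fun j => by
    simp [inner_sum, inner_smul_right, v.inner_eq_ite]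
  simp only [h]
  rw [tsum_eq_sum (s := F) fun j hj => by simp [hj]]
  exact Finset.sum_congr rfl fun j hj => by rw [if_pos hj, mul_comm]

/-- `ν` is the law on `H` with mean `b` and independent Gaussian modes of variances `V`. -/
def HasGaussianModes (v : HilbertBasis ℕ ℝ H) (ν : Measure H) (b : H) (V : ℕ → ℝ) : Prop :=
  ∀ (F : Finset ℕ) (c : ℕ → ℝ), charFun ν (∑ j ∈ F, c j • v j) =
    gaussExp (inner ℝ (∑ j ∈ F, c j • v j) b) (∑ j ∈ F, c j ^ 2 * V j)

lemma HasGaussianModes.map_mode {ν : Measure H} [IsProbabilityMeasure ν] {b : H} {V : ℕ → ℝ}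
    (h : HasGaussianModes v ν b V) {j : ℕ} (hV : 0 ≤ V j) :
    ν.map (fun x => inner ℝ (v j) x) = gaussianReal (inner ℝ (v j) b) (V j).toNNReal := by
  refine (hasLaw_gaussianReal_of_expI (by fun_prop) fun c => ?_).map_eq
  have h1 := h {j} fun _ => c
  rw [← Measure.map_id (μ := ν), charFun_eq_integral_expI (by fun_prop)] at h1
  simpa [inner_smul_left, Real.coe_toNNReal _ hV] using h1

lemma HasGaussianModes.hasLaw [IsProbabilityMeasure P] {ν : Measure H} [IsProbabilityMeasure ν]
    {b : H} {V : ℕ → ℝ} (h : HasGaussianModes v ν b V) {U : Ω → H} (hU : AEMeasurable U P)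
    (hUV : ∀ (F : Finset ℕ) (c : ℕ → ℝ),
      ∫ ω, expI (∑ j ∈ F, c j * inner ℝ (v j) (U ω - b)) ∂P =
        gaussExp 0 (∑ j ∈ F, c j ^ 2 * V j)) : HasLaw U ν P := by
  have := Measure.isProbabilityMeasure_map hU
  refine ⟨hU, measure_ext_of_charFun_basis v fun F c => ?_⟩
  rw [h F c, charFun_eq_integral_expI hU, gaussExp_eq, ← hUV F c, ← integral_const_mul]
  refine integral_congr_ae (ae_of_all _ fun ω => ?_)
  simp only [← expI_add, ← inner_finset_sum_smul]
  rw [← inner_add_right, add_sub_cancel]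

lemma HasGaussianModes.integral_expI {ν : Measure H} {b : H} {V : ℕ → ℝ}
    (h : HasGaussianModes v ν b V) {U : Ω → H} (hU : HasLaw U ν P) (F : Finset ℕ) (c : ℕ → ℝ) :
    ∫ ω, expI (∑ j ∈ F, c j * inner ℝ (v j) (U ω - b)) ∂P =
      gaussExp 0 (∑ j ∈ F, c j ^ 2 * V j) := by
  have h1 := h F c
  rw [← hU.map_eq, charFun_eq_integral_expI hU.aemeasurable, gaussExp_eq] at h1
  have h2 : expI (-inner ℝ (∑ j ∈ F, c j • v j) b) * expI (inner ℝ (∑ j ∈ F, c j • v j) b) = 1 := by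
    rw [← expI_add, neg_add_cancel, expI_zero]
  rw [← one_mul (gaussExp _ _), ← h2, mul_assoc, ← h1, ← integral_const_mul]
  refine integral_congr_ae (ae_of_all _ fun ω => ?_)
  beta_reduce
  rw [← expI_add, ← inner_finset_sum_smul, inner_sub_right, neg_add_eq_sub]

variable [IsProbabilityMeasure P]

lemma integral_expI_sub_of_hasLaw {U : Ω → ℝ} {b z : ℝ} {V : ℝ≥0}
    (hU : HasLaw U (gaussianReal z V) P) (c : ℝ) :
    ∫ ω, expI (c * (U ω - b)) ∂P = gaussExp (c * (z - b)) (c ^ 2 * V) := by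
  have h1 := integral_expI_of_hasLaw hU c
  have h2 : ∀ ω, expI (c * (U ω - b)) = expI (-(c * b)) * expI (c * U ω) := fun ω => by
    rw [← expI_add]; ring_nf
  simp only [h2]
  rw [integral_const_mul, h1, gaussExp_eq, gaussExp_eq (c * (z - b)), ← mul_assoc, ← expI_add]
  ring_nf

lemma tendsto_mode {j : ℕ} {ω : Ω} {w : ℝ}
    (h : Tendsto (fun t => revMode v a T Z j t ω) (𝓝[<] T) (𝓝 w)) :
    Tendsto (fun t => inner ℝ (v j) (Z t ω)) (𝓝[<] T) (𝓝 (w + inner ℝ (v j) a)) := by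
  have h1 : Tendsto (fun t => Real.exp (-(T - t) / 2) * inner ℝ (v j) a) (𝓝[<] T)
      (𝓝 (Real.exp (-(T - T) / 2) * inner ℝ (v j) a)) :=
    ((by fun_prop : Continuous fun t => Real.exp (-(T - t) / 2) * inner ℝ (v j) a).tendsto
      T).mono_left nhdsWithin_le_nhds
  simp only [sub_self, neg_zero, zero_div, Real.exp_zero, one_mul] at h1
  refine (h.add h1).congr fun t => ?_
  rw [revMode, inner_sub_right, inner_smul_right]
  ring

/-- Terminal law of a mode with Gaussian initial law. -/
lemma hasTerminalLaw_of_gaussian (hS : HasAffineScore v S y a m lam) (hm : ∀ j, 0 ≤ m j)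
    (hlam : ∀ j, 0 < lam j) (hC : ∀ j, C (v j) = lam j • v j) (hT : 0 < T)
    (hZ : IsReverseSolution C S y T Z N P) {j : ℕ} {z₀ : ℝ} {V₀ : ℝ≥0}
    (h0 : HasLaw (fun ω => inner ℝ (v j) (Z 0 ω)) (gaussianReal z₀ V₀) P) {M V : ℝ}
    (hM : M = inner ℝ (v j) a + revContraction (m j) (lam j) T T *
      (z₀ - Real.exp (-T / 2) * inner ℝ (v j) a))
    (hV : V = revContraction (m j) (lam j) T T ^ 2 * V₀ + (m j -
      revContraction (m j) (lam j) T T ^ 2 * fwdVar (m j) (lam j) T)) (hV0 : 0 ≤ V) :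
    HasTerminalLaw (fun t ω => inner ℝ (v j) (Z t ω)) T (gaussianReal M V.toNNReal) P := by
  obtain ⟨wT, hwm, hw⟩ := exists_revMode_terminal (a := a) hS hm hlam hT hZ
  refine ⟨fun ω => wT j ω + inner ℝ (v j) a, ?_,
    hasLaw_gaussianReal_of_expI ((hwm j).add_const _) fun c => ?_⟩
  · filter_upwards [hw] with ω hω using tendsto_mode (hω j).1
  have h1 := integral_expI_revMode_terminal hS hm hlam hC hT hZ
    (hw.mono fun ω hω j => (hω j).1) {j} fun _ => c
  simp only [Finset.sum_singleton] at h1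
  have h2 : ∀ ω, revMode v a T Z j 0 ω =
      inner ℝ (v j) (Z 0 ω) - Real.exp (-T / 2) * inner ℝ (v j) a := fun ω => by
    rw [revMode, inner_sub_right, inner_smul_right, sub_zero]
  simp only [h2] at h1
  rw [integral_expI_sub_of_hasLaw h0, ← gaussExp_add] at h1
  simp only [mul_add, expI_add]
  rw [integral_mul_const, h1, mul_comm, gaussExp_eq, ← mul_assoc, ← expI_add, ← gaussExp_eq]
  rw [Real.coe_toNNReal _ hV0, hM, hV]
  ring_nf

/-- Exact reversal of a mode. -/
lemma mode_exact (hS : HasAffineScore v S y a m lam) (hm : ∀ j, 0 ≤ m j)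
    (hlam : ∀ j, 0 < lam j) (hC : ∀ j, C (v j) = lam j • v j) (hT : 0 < T)
    (hZ : IsReverseSolution C S y T Z N P) {j : ℕ}
    (h0 : HasLaw (fun ω => inner ℝ (v j) (Z 0 ω)) (gaussianReal (Real.exp (-T / 2) *
      inner ℝ (v j) a) (fwdVar (m j) (lam j) T).toNNReal) P) :
    (∀ t ∈ Ioc 0 T, HasLaw (fun ω => inner ℝ (v j) (Z (T - t) ω)) (gaussianReal
      (Real.exp (-t / 2) * inner ℝ (v j) a) (fwdVar (m j) (lam j) t).toNNReal) P) ∧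
    HasTerminalLaw (fun t ω => inner ℝ (v j) (Z t ω)) T
      (gaussianReal (inner ℝ (v j) a) (m j).toNNReal) P := by
  have hVT := fwdVar_pos (hm j) (hlam j) hT
  refine ⟨fun t ht => ?_, ?_⟩
  · have hmem : T - t ∈ Ico 0 T := ⟨by linarith [ht.2], by linarith [ht.1]⟩
    have hVt := fwdVar_pos (hm j) (hlam j) ht.1
    have hZm := hZ.measurable _ hmem
    refine hasLaw_gaussianReal_of_expI (by fun_prop) fun c => ?_
    have h2 : ∀ ω, revMode v a T Z j 0 ω =
        inner ℝ (v j) (Z 0 ω) - Real.exp (-T / 2) * inner ℝ (v j) a := fun ω => by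
      rw [revMode, inner_sub_right, inner_smul_right, sub_zero]
    have h1 := (integral_expI_revMode_exact hS hm hlam hC hT hZ (F := {j}) (fun c => by
      simp only [Finset.sum_singleton, h2]
      rw [integral_expI_sub_of_hasLaw h0, sub_self, mul_zero, Real.coe_toNNReal _ hVT.le])
      fun _ => c).1 _ hmem
    have h3 : ∀ ω, revMode v a T Z j (T - t) ω =
        inner ℝ (v j) (Z (T - t) ω) - Real.exp (-t / 2) * inner ℝ (v j) a := fun ω => by
      rw [revMode, inner_sub_right, inner_smul_right, sub_sub_cancel]
    simp only [Finset.sum_singleton, h3, sub_sub_cancel] at h1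
    have h4 : ∀ ω, expI (c * inner ℝ (v j) (Z (T - t) ω)) =
        expI (c * (Real.exp (-t / 2) * inner ℝ (v j) a)) *
          expI (c * (inner ℝ (v j) (Z (T - t) ω) - Real.exp (-t / 2) * inner ℝ (v j) a)) :=
      fun ω => by rw [← expI_add]; ring_nf
    simp only [h4]
    rw [integral_const_mul, h1, ← gaussExp_eq, Real.coe_toNNReal _ hVt.le]
  · refine hasTerminalLaw_of_gaussian hS hm hlam hC hT hZ h0 ?_ ?_ (hm j)
    · rw [sub_self, mul_zero, add_zero]
    · rw [Real.coe_toNNReal _ hVT.le]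
      ring

/-- Exact reversal in `H`. -/
lemma hilbert_exact (hS : HasAffineScore v S y a m lam) (hm : ∀ j, 0 ≤ m j) (hms : Summable m)
    (hlam : ∀ j, 0 < lam j) (hC : ∀ j, C (v j) = lam j • v j) (hT : 0 < T)
    (hZ : IsReverseSolution C S y T Z N P) {ν : ℝ → Measure H}
    (hν : ∀ t, 0 ≤ t → IsProbabilityMeasure (ν t))
    (hνm : ∀ t, 0 ≤ t → HasGaussianModes v (ν t) (Real.exp (-t / 2) • a)
      fun j => fwdVar (m j) (lam j) t)
    (h0 : HasLaw (Z 0) (ν T) P) :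
    (∀ t ∈ Ioc 0 T, HasLaw (Z (T - t)) (ν t) P) ∧
    ∃ ZT : Ω → H, (∀ᵐ ω ∂P, ∀ j : ℕ, Tendsto (fun t => inner ℝ (v j) (Z t ω)) (𝓝[<] T)
      (𝓝 (inner ℝ (v j) (ZT ω)))) ∧ HasLaw ZT (ν 0) P := by
  have hinit : ∀ (F : Finset ℕ) (c : ℕ → ℝ),
      ∫ ω, expI (∑ j ∈ F, c j * revMode v a T Z j 0 ω) ∂P =
        gaussExp 0 (∑ j ∈ F, c j ^ 2 * fwdVar (m j) (lam j) T) := fun F c => by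
    have := (hνm T hT.le).integral_expI h0 F c
    simpa only [revMode, sub_zero] using this
  have hex := fun F c => integral_expI_revMode_exact hS hm hlam hC hT hZ (hinit F) c
  refine ⟨fun t ht => ?_, ?_⟩
  · have hmem : T - t ∈ Ico 0 T := ⟨by linarith [ht.2], by linarith [ht.1]⟩
    have := hν t ht.1.le
    refine (hνm t ht.1.le).hasLaw (hZ.measurable _ hmem).aemeasurable fun F c => ?_
    simpa only [revMode, sub_sub_cancel] using (hex F c).1 _ hmem
  · obtain ⟨wT, hwm, hw⟩ := exists_revMode_terminal (a := a) hS hm hlam hT hZ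
    have hwT : ∀ᵐ ω ∂P, ∀ j, Tendsto (fun t => revMode v a T Z j t ω) (𝓝[<] T) (𝓝 (wT j ω)) :=
      hw.mono fun ω hω j => (hω j).1
    have hlaw : ∀ j, HasLaw (wT j) (gaussianReal 0 (m j).toNNReal) P := fun j =>
      hasLaw_gaussianReal_of_expI (hwm j) fun c => by
        have := (hex {j} fun _ => c).2 wT hwT
        simpa [Real.coe_toNNReal _ (hm j)] using this
    -- Mode limits alone do not give a point of `H`; summability of the posterior variances does.
    obtain ⟨W, hWm, hW⟩ := exists_randomVariable_of_coordinates v hm hms hlaw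
    refine ⟨fun ω => W ω + a, ?_, ?_⟩
    · filter_upwards [hwT, hW] with ω h1 h2 j
      rw [inner_add_right, h2]
      exact tendsto_mode (h1 j)
    · have := hν 0 le_rfl
      refine (hνm 0 le_rfl).hasLaw (hWm.add_const _) fun F c => ?_
      simp only [neg_zero, zero_div, Real.exp_zero, one_smul, add_sub_cancel_right, fwdVar_zero]
      rw [← (hex F c).2 wT hwT]
      refine integral_congr_ae ?_
      filter_upwards [hW] with ω hω
      simp only [hω]

end Assembly

/-! ### The main theorem. -/

lemma terminalVar_nonneg {p q m V₀ T : ℝ} (hp : 0 < p) (hq : 0 ≤ q) (hm : 0 ≤ m) (hV : 0 ≤ V₀)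
    (hT : 0 < T) : 0 ≤ terminalVar m p q V₀ T := by
  have hD : 1 ≤ modeDenom p q T := by
    have hE : 0 ≤ Real.exp T - 1 := sub_nonneg.2 (Real.one_le_exp hT.le)
    have : 0 ≤ (Real.exp T - 1) * p * (1 + q) := by positivity
    rw [modeDenom]
    linarith
  have h1 : 0 ≤ 1 - 1 / modeDenom p q T :=
    sub_nonneg.2 (div_le_one_of_le₀ hD (zero_le_one.trans hD))
  unfold terminalVar
  positivity

theorem mainTheorem6
    {H : Type*} [NormedAddCommGroup H] [InnerProductSpace ℝ H] [CompleteSpace H]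
    [SecondCountableTopology H] [MeasurableSpace H] [BorelSpace H]
    -- common eigenbasis of the prior covariance `Cμ` and of the diffusion covariance `C`
    (v : HilbertBasis ℕ ℝ H) (Cμ C : H →L[ℝ] H) (μ lam : ℕ → ℝ)
    (hCμ : ∀ j, Cμ (v j) = μ j • v j) (hC : ∀ j, C (v j) = lam j • v j)
    (hμ : ∀ j, 0 < μ j) (hlam : ∀ j, 0 < lam j) (hμs : Summable μ) (hlams : Summable lam)
    -- observed modes and noise level
    {n : ℕ} (η : Fin n → ℕ) (hη : Function.Injective η) (σB : ℝ) (hσB : 0 ≤ σB)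
    -- forward model
    {Ω : Type*} [MeasurableSpace Ω] (P : Measure Ω) [IsProbabilityMeasure P]
    (X : ℝ → Ω → H) (N : ℝ≥0 → Ω → H) (B : Ω → Fin n → ℝ)
    (hX : IsForwardModel Cμ C σB X N B P)
    -- conditional score
    (S : ℝ → H → (Fin n → ℝ) → H) (hS : IsConditionalScore X (observation v η X B) P S) :
    -- `κ t y` is the law of `X t` given `Y = y`
    ∃ κ : ℝ → Kernel (Fin n → ℝ) H,
      (∀ t, 0 ≤ t → IsConditionalLaw (X t) (observation v η X B) P (κ t)) ∧
      -- law of mode `j` of `X t` given `Y = y`; the posterior mode law is the case `t = 0`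
      (∀ (j : ℕ) (y : Fin n → ℝ) (t : ℝ), 0 ≤ t →
        (0 < σB ∨ j ∉ range η →
          (κ t y).map (fun x => inner ℝ (v j) x) =
            gaussianReal
              (Real.exp (-t / 2) * (modeObs η y j * modeQ μ σB η j / (1 + modeQ μ σB η j)))
              (μ j * Real.exp (-t) / (1 + modeQ μ σB η j)
                + lam j * (1 - Real.exp (-t))).toNNReal) ∧
        (σB = 0 → j ∈ range η →
          (κ t y).map (fun x => inner ℝ (v j) x) =
            gaussianReal (Real.exp (-t / 2) * modeObs η y j)
              (lam j * (1 - Real.exp (-t))).toNNReal)) ∧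
      -- exponential convergence, as `T → ∞`, of the terminal mean and variance
      (∀ (j : ℕ), 0 < σB ∨ j ∉ range η → ∀ (y : Fin n → ℝ) (z₀ : ℝ) (V₀ : ℝ≥0),
        (∃ K : ℝ, ∀ T : ℝ, 0 < T →
          |terminalMean (lam j / μ j) (modeQ μ σB η j) (modeObs η y j) z₀ T
            - modeObs η y j * modeQ μ σB η j / (1 + modeQ μ σB η j)| ≤ K * Real.exp (-T / 2) ∧
          |terminalVar (μ j) (lam j / μ j) (modeQ μ σB η j) V₀ T
            - μ j / (1 + modeQ μ σB η j)| ≤ K * Real.exp (-T)) ∧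
        Tendsto (fun T => gaussianPM
            (terminalMean (lam j / μ j) (modeQ μ σB η j) (modeObs η y j) z₀ T)
            (terminalVar (μ j) (lam j / μ j) (modeQ μ σB η j) V₀ T).toNNReal)
          atTop
          (𝓝 (gaussianPM (modeObs η y j * modeQ μ σB η j / (1 + modeQ μ σB η j))
            (μ j / (1 + modeQ μ σB η j)).toNNReal))) ∧
      -- every solution `Z` of the reverse-time equation with horizon `T` and data `y`
      (∀ (T : ℝ), 0 < T → ∀ (y : Fin n → ℝ)
        (Ω' : Type*) [MeasurableSpace Ω'] (P' : Measure Ω') [IsProbabilityMeasure P']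
        (Z : ℝ → Ω' → H) (N' : ℝ≥0 → Ω' → H), IsReverseSolution C S y T Z N' P' →
        -- explicit terminal law of a mode started from a Gaussian law
        (∀ j : ℕ, 0 < σB ∨ j ∉ range η → ∀ (z₀ : ℝ) (V₀ : ℝ≥0),
          HasLaw (fun ω => inner ℝ (v j) (Z 0 ω)) (gaussianReal z₀ V₀) P' →
          HasTerminalLaw (fun t ω => inner ℝ (v j) (Z t ω)) T
            (gaussianReal
              (terminalMean (lam j / μ j) (modeQ μ σB η j) (modeObs η y j) z₀ T)
              (terminalVar (μ j) (lam j / μ j) (modeQ μ σB η j) V₀ T).toNNReal) P') ∧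
        -- exact reversal of a mode started from the law of mode `j` of `X T` given `Y = y`
        (∀ j : ℕ,
          HasLaw (fun ω => inner ℝ (v j) (Z 0 ω))
            ((κ T y).map (fun x => inner ℝ (v j) x)) P' →
          (∀ t ∈ Ioc 0 T, HasLaw (fun ω => inner ℝ (v j) (Z (T - t) ω))
            ((κ t y).map (fun x => inner ℝ (v j) x)) P') ∧
          HasTerminalLaw (fun t ω => inner ℝ (v j) (Z t ω)) T
            ((κ 0 y).map (fun x => inner ℝ (v j) x)) P') ∧
        -- exact reversal in `H` when started from the law of `X T` given `Y = y`
        (HasLaw (Z 0) (κ T y) P' →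
          (∀ t ∈ Ioc 0 T, HasLaw (Z (T - t)) (κ t y) P') ∧
          ∃ ZT : Ω' → H,
            (∀ᵐ ω ∂P', ∀ j : ℕ, Tendsto (fun t => inner ℝ (v j) (Z t ω)) (𝓝[<] T)
              (𝓝 (inner ℝ (v j) (ZT ω)))) ∧
            HasLaw ZT (κ 0 y) P') ∧
        -- noiseless observations: the observed modes are driven to the data
        (σB = 0 → ∀ j ∈ range η,
          ∀ᵐ ω ∂P', Tendsto (fun t => inner ℝ (v j) (Z t ω)) (𝓝[<] T)
            (𝓝 (modeObs η y j)))) := by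
  have hm := postVar_nonneg (σB := σB) (η := η) hμ
  have hms : Summable (postVar μ σB η) :=
    Summable.of_nonneg_of_le hm (postVar_le hμ) hμs
  have hex : ∀ t, ∃ κ : Kernel (Fin n → ℝ) H, 0 ≤ t →
      IsConditionalLaw (X t) (observation v η X B) P κ ∧ ∀ y h, charFun (κ y) h =
        gaussExp (Real.exp (-t / 2) * inner ℝ h (postMean v μ σB η y))
          (∑' j, fwdVar (postVar μ σB η j) (lam j) t * inner ℝ (v j) h ^ 2) := fun t => by
    -- The kernel is chosen for every real `t`; at negative times it is a dummy.
    by_cases ht : 0 ≤ t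
    · obtain ⟨κ, hκ⟩ := hX.exists_conditionalLaw hη hμ hlam hCμ hC ht
      exact ⟨κ, fun _ => hκ⟩
    · exact ⟨0, fun h => absurd h ht⟩
  choose κ hκ using hex
  have hprob : ∀ y t, 0 ≤ t → IsProbabilityMeasure (κ t y) := fun y t ht =>
    (hκ t ht).1.markov.isProbabilityMeasure y
  have hmodes : ∀ y t, 0 ≤ t → HasGaussianModes v (κ t y)
      (Real.exp (-t / 2) • postMean v μ σB η y)
      fun j => fwdVar (postVar μ σB η j) (lam j) t := fun y t ht F c => by
    rw [(hκ t ht).2, tsum_mul_inner_sq, inner_smul_right]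
  have hmap : ∀ y t, 0 ≤ t → ∀ j, (κ t y).map (fun x => inner ℝ (v j) x) =
      gaussianReal (Real.exp (-t / 2) * inner ℝ (v j) (postMean v μ σB η y))
        (fwdVar (postVar μ σB η j) (lam j) t).toNNReal := fun y t ht j => by
    have := hprob y t ht
    rw [(hmodes y t ht).map_mode (fwdVar_nonneg (hm j) (hlam j) ht), inner_smul_right]
  have hp : ∀ j, 0 < lam j / μ j := fun j => div_pos (hlam j) (hμ j)
  have hq : ∀ j, 0 ≤ modeQ μ σB η j := fun j => modeQ_nonneg hμ
  refine ⟨κ, fun t ht => (hκ t ht).1, fun j y t ht => ⟨fun hj => ?_, fun hσ hj => ?_⟩,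
    fun j _ y z₀ V₀ => ?_, fun T hT y Ω' _ P' _ Z N' hZ => ?_⟩
  · rw [hmap y t ht, inner_postMean hη, obsWeight_eq_modeQ hμ hj, postVar_eq_modeQ hμ hj, fwdVar]
    congr 2 <;> ring
  · rw [hmap y t ht, inner_postMean hη, obsWeight_of_noiseless hμ hσ hj,
      postVar_of_noiseless hμ hσ hj, fwdVar]
    congr 2 <;> ring
  · obtain ⟨K, hK⟩ := exists_terminal_bound (hp j) (hq j) (hμ j).le V₀.2 (modeObs η y j) z₀
    refine ⟨⟨K, hK⟩, tendsto_gaussianPM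
      (tendsto_of_abs_sub_le_exp two_pos fun T hT => (hK T hT).1)
      ((continuous_real_toNNReal.tendsto _).comp
        (tendsto_of_abs_sub_le_exp (K := K) one_pos fun T hT => ?_))⟩
    rw [div_one]
    exact (hK T hT).2
  -- The only link with the forward model that the reverse analysis needs.
  · have hS' : HasAffineScore v S y (postMean v μ σB η y) (postVar μ σB η) lam :=
      fun u hu x j => hX.inner_score hη hμ hlam hCμ hC hX.integrable_prior hS hu x y j
    refine ⟨fun j hj z₀ V₀ h0 => ?_, fun j h0 => ?_, fun h0 => ?_, fun hσ j hj => ?_⟩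
    · refine hasTerminalLaw_of_gaussian hS' hm hlam hC hT hZ h0 ?_ ?_
        (terminalVar_nonneg (hp j) (hq j) (hμ j).le V₀.2 hT)
      · rw [inner_postMean hη, obsWeight_eq_modeQ hμ hj, postVar_eq_modeQ hμ hj]
        exact terminalMean_eq (hμ j) (hq j) (hlam j) hT rfl _ _
      · rw [postVar_eq_modeQ hμ hj]
        exact terminalVar_eq (hμ j) (hq j) (hlam j) hT rfl _
    · rw [hmap y T hT.le] at h0
      obtain ⟨h1, h2⟩ := mode_exact hS' hm hlam hC hT hZ h0
      refine ⟨fun t ht => ?_, ?_⟩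
      · rw [hmap y t ht.1.le]
        exact h1 t ht
      · rw [hmap y 0 le_rfl, fwdVar_zero, neg_zero, zero_div, Real.exp_zero, one_mul]
        exact h2
    · exact hilbert_exact hS' hm hms hlam hC hT hZ (hprob y) (hmodes y) h0
    · obtain ⟨wT, -, hw⟩ := exists_revMode_terminal (a := postMean v μ σB η y) hS' hm hlam hT hZ
      filter_upwards [hw] with ω hω
      have h1 := tendsto_mode (hω j).1
      -- Noiseless observed modes have posterior variance `0` and weight `1`, so the centred limit
      -- is `0` and the centre is the datum.
      rw [(hω j).2 (postVar_of_noiseless hμ hσ hj), inner_postMean hη,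
        obsWeight_of_noiseless hμ hσ hj, one_mul, zero_add] at h1
      exact h1
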